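/- Let $M$ be a connected smooth manifold of dimension 6 with a Riemannian metric $g$. For a smooth orthogonal almost complex structure $J$ on $(M,g)$ let $\Omega(X,Y)=g(JX,Y)$, and call an orthonormal basis $e=(e_1,\dots,e_6)$ of a tangent space adapted to $(g,J)$ if $\Omega=e_{12}+e_{34}+e_{56}$. A characteristic connection of $(g,J)$ is a connection $\nabla^c$ with $\nabla^cg=0$, $\nabla^cJ=0$ whose torsion $T^c(X,Y,Z)=g(T^c(X,Y),Z)$ is totally skew-symmetric (it is unique if it exists). Let $SU(2)=\{\mathrm{diag}(A,1):A\in SU(2)\}\subset U(3)$, acting on a tangent space through an adapted frame. The structure $(M,g,J)$ has parallel torsion related to $SU(2)$ if it has a characteristic connection with $\nabla^cT^c=0$ and, at each point, with respect to some adapted frame, $\mathrm{Hol}(\nabla^c)\subset SU(2)\subset \mathrm{Iso}(T^c)$, where $\mathrm{Iso}(T^c)=\{a\in U(3): aT^c=T^c\}$. **Theorem.** Let $(M,g,J)$ have parallel torsion related to $SU(2)$, with characteristic connection $\nabla^c$ and torsion form $T^c\neq 0$ (i.e. the structure is not Kähler). Then there is a smooth family $(\tilde J_q)_{q\in S^2}$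 of smooth orthogonal almost complex structures on $(M,g)$, which contains $J$ and in which distinct parameters give structures that differ at every point of $M$, such that: 1. for every $q\in S^2$, $(M,g,\tilde J_q)$ has parallel torsion related to $SU(2)$, and its characteristic connection is again $\nabla^c$; 2. every orbit type of the torsion form is realized: there is $r>0$ such that for every $q$ there are $\alpha_1,\alpha_5\ge 0$ with $\alpha_1^2+\alpha_5^2=r^2$ for which at each point of $M$ there is a $(g,\tilde J_q)$-adapted frame with $$T^c=\alpha_1\,(e_{14}+e_{23})\wedge e_5+\alpha_5\,(e_{12}+e_{34})\wedge e_5 ,$$ and conversely, for all $\alpha_1,\alpha_5\ge 0$ with $\alpha_1^2+\alpha_5^2=r^2$ there is some $q\in S^2$ such that at each point of $M$ there is a $(g,\tilde J_q)$-adapted frame in which $T^c$ has this form; 3. in particular, for some $q$ the structure $(g,\tilde J_q)$ is of strict type $W_4$ (a generalized Hopf structure): at each point its intrinsic torsion is non-zero and lies in $W_4=\{\theta(\Omega_q\wedge\xi)\}$, where $\Omega_q$ is the Kähler form of $(g,\tilde J_q)$ and $\xi$ ranges over the tangent vectors at that point. Here the intrinsic torsion is the projection to $T^*M\otimes\mathfrak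 m$ of the Levi-Civita connection form in adapted frames, $\mathfrak m$ is the space of 2-forms $\omega$ with $\omega(\tilde J_qX,\tilde J_qY)=-\omega(X,Y)$, and $\theta(T)(X)=-\tfrac12\,\mathrm{pr}_{\mathfrak m}(T(X,\cdot,\cdot))$. -/

import Mathlib

open Bundle Manifold ContDiff Topology

noncomputable section

/-- The model space of a six-dimensional manifold. -/
abbrev E6 : Type := EuclideanSpace ℝ (Fin 6)

section AlmostHermitian

variable {M : Type*} [TopologicalSpace M] [ChartedSpace E6 M] [IsManifold (𝓡 6) ∞ M]
  [RiemannianBundle (fun x : M => TangentSpace (𝓡 6) x)]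

variable (M) in
/-- A smooth almost complex structure on the Riemannian manifold `M` which is orthogonal for the
metric, i.e. (together with the metric) an almost hermitian structure. -/
@[ext]
structure OrthogonalACS where
  toFun : (x : M) → TangentSpace (𝓡 6) x →L[ℝ] TangentSpace (𝓡 6) x
  smooth : ContMDiff (𝓡 6) ((𝓡 6).prod 𝓘(ℝ, E6 →L[ℝ] E6)) ∞
    (fun x => TotalSpace.mk' (E6 →L[ℝ] E6)
      (E := fun x : M => TangentSpace (𝓡 6) x →L[ℝ] TangentSpace (𝓡 6) x) x (toFun x))
  sq (x : M) (v : TangentSpace (𝓡 6) x) : toFun x (toFun x v) = -v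
  orthogonal (x : M) (v w : TangentSpace (𝓡 6) x) :
    inner ℝ (toFun x v) (toFun x w) = inner ℝ v w

instance : CoeFun (OrthogonalACS M)
    (fun _ => (x : M) → TangentSpace (𝓡 6) x →L[ℝ] TangentSpace (𝓡 6) x) :=
  ⟨OrthogonalACS.toFun⟩

variable (M) in
/-- Affine connections on `M`; `cov Y x v` is the covariant derivative of `Y` at `x` in the
direction `v`. -/
abbrev AffineConnection : Type _ :=
  CovariantDerivative (𝓡 6) E6 (fun x : M => TangentSpace (𝓡 6) x)

/-- The vector field `X` is differentiable at the point `x`. -/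
def IsDiffAt (X : (y : M) → TangentSpace (𝓡 6) y) (x : M) : Prop :=
  MDifferentiableAt (𝓡 6) (𝓡 6).tangent (fun y => (⟨y, X y⟩ : TangentBundle (𝓡 6) M)) x

/-! ### Linear algebra in a tangent space -/

/-- The Kähler form `Ω(X,Y) = g(JX,Y)`. -/
def kahlerForm (J : OrthogonalACS M) (x : M) (X Y : TangentSpace (𝓡 6) x) : ℝ :=
  inner ℝ (J x X) Y

/-- An orthonormal basis `e₁,…,e₆` (here indexed by `0,…,5`) of a tangent space is adapted to
`(g,J)` if `J e₁ = e₂`, `J e₃ = e₄`, `J e₅ = e₆`, i.e. if `Ω = e₁₂ + e₃₄ + e₅₆`. -/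
def IsAdapted (J : OrthogonalACS M) {x : M}
    (e : OrthonormalBasis (Fin 6) ℝ (TangentSpace (𝓡 6) x)) : Prop :=
  J x (e 0) = e 1 ∧ J x (e 2) = e 3 ∧ J x (e 4) = e 5

/-- The identification of `ℂ³` with a tangent space given by an adapted frame:
`(z₁,z₂,z₃) ↦ ∑ₖ Re(zₖ) e₂ₖ₋₁ + Im(zₖ) e₂ₖ`. -/
def ofComplex {x : M} (e : OrthonormalBasis (Fin 6) ℝ (TangentSpace (𝓡 6) x))
    (z : Fin 3 → ℂ) : TangentSpace (𝓡 6) x :=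
  (z 0).re • e 0 + (z 0).im • e 1 + (z 1).re • e 2 + (z 1).im • e 3
    + (z 2).re • e 4 + (z 2).im • e 5

/-- The embedding of `2 × 2` matrices into `3 × 3` matrices `A ↦ diag(A, 1)`. -/
def blockMatrix (A : Matrix (Fin 2) (Fin 2) ℂ) : Matrix (Fin 3) (Fin 3) ℂ :=
  !![A 0 0, A 0 1, 0; A 1 0, A 1 1, 0; 0, 0, 1]

/-- The group `SU(2) = {diag(A,1) : A ∈ SU(2)} ⊂ U(3)`, acting on the tangent space at `x` through
the frame `e`. -/
def SU2At {x : M} (e : OrthonormalBasis (Fin 6) ℝ (TangentSpace (𝓡 6) x)) :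
    Set (TangentSpace (𝓡 6) x →ₗ[ℝ] TangentSpace (𝓡 6) x) :=
  {a | ∃ A ∈ Matrix.specialUnitaryGroup (Fin 2) ℂ,
    ∀ z : Fin 3 → ℂ, a (ofComplex e z) = ofComplex e ((blockMatrix A).mulVec z)}

/-- The 3-form `e_i ∧ e_j ∧ e_k` evaluated on three vectors given by their coordinates. -/
def wedge3 (i j k : Fin 6) (X Y Z : E6) : ℝ :=
  Matrix.det !![X i, X j, X k; Y i, Y j, Y k; Z i, Z j, Z k]

/-- The 3-form `α₁ (e₁₄ + e₂₃) ∧ e₅ + α₅ (e₁₂ + e₃₄) ∧ e₅` on `ℝ⁶`. -/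
def normalForm (α₁ α₅ : ℝ) (X Y Z : E6) : ℝ :=
  α₁ * (wedge3 0 3 4 X Y Z + wedge3 1 2 4 X Y Z)
    + α₅ * (wedge3 0 1 4 X Y Z + wedge3 2 3 4 X Y Z)

/-! ### Torsion, characteristic connection, holonomy -/

/-- The torsion of a connection as a (3,0)-tensor, `T(X,Y,Z) = g(T(X,Y),Z)`. -/
def torsionForm (cov : AffineConnection M) (x : M) (X Y Z : TangentSpace (𝓡 6) x) : ℝ :=
  inner ℝ (cov.torsion x X Y) Z

set_option synthInstance.maxHeartbeats 400000
variable [IsContMDiffRiemannianBundle (𝓡 6) ∞ E6 (fun x : M => TangentSpace (𝓡 6) x)]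

/-- `cov` is the characteristic connection of `(g,J)`: a (smooth) hermitian connection, `∇g = 0`
and `∇J = 0`, with totally skew-symmetric torsion. -/
structure IsCharacteristicConnection (J : OrthogonalACS M) (cov : AffineConnection M) :
    Prop where
  smooth : cov.ContMDiffCovariantDerivative ∞
  metric : cov.IsMetricCompatible
  complex : ∀ (x : M) (Y : (y : M) → TangentSpace (𝓡 6) y), IsDiffAt Y x →
    ∀ v : TangentSpace (𝓡 6) x, cov (fun y => J y (Y y)) x v = J x (cov Y x v)
  skew : ∀ (x : M) (X Y Z : TangentSpace (𝓡 6) x),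
    torsionForm cov x X Y Z = -torsionForm cov x X Z Y

/-- The torsion form is parallel, `∇T = 0`. -/
def HasParallelTorsion (cov : AffineConnection M) : Prop :=
  ∀ (x : M) (X Y Z : (y : M) → TangentSpace (𝓡 6) y),
    IsDiffAt X x → IsDiffAt Y x → IsDiffAt Z x →
    ∀ v : TangentSpace (𝓡 6) x,
      mvfderiv (𝓡 6) (fun y => torsionForm cov y (X y) (Y y) (Z y)) x v =
        torsionForm cov x (cov X x v) (Y x) (Z x) + torsionForm cov x (X x) (cov Y x v) (Z x)
          + torsionForm cov x (X x) (Y x) (cov Z x v)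

/-- `W` is the covariant derivative `DV/dt` at time `t` of the vector field `V` along the curve
`γ`: writing `V = ∑ fᵢ · (Xᵢ ∘ γ)` near `t` with vector fields `Xᵢ` on `M`, one has
`DV/dt = ∑ fᵢ' Xᵢ + fᵢ ∇_{γ'} Xᵢ`. -/
def HasCovDerivAlong (cov : AffineConnection M) (γ : ℝ → M)
    (V : (t : ℝ) → TangentSpace (𝓡 6) (γ t)) (t : ℝ) (W : TangentSpace (𝓡 6) (γ t)) : Prop :=
  ∃ (n : ℕ) (f : Fin n → ℝ → ℝ) (X : Fin n → (x : M) → TangentSpace (𝓡 6) x),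
    (∀ i, DifferentiableAt ℝ (f i) t) ∧ (∀ i, IsDiffAt (X i) (γ t)) ∧
    (∀ᶠ s in 𝓝 t, V s = ∑ i, f i s • X i (γ s)) ∧
    W = ∑ i, (deriv (f i) t • X i (γ t)
      + f i t • cov (X i) (γ t) (mfderiv 𝓘(ℝ, ℝ) (𝓡 6) γ t (1 : ℝ)))

/-- Parallel transport along piecewise smooth curves from `x` to `y`: along a segment of a smooth
curve, `P` sends the initial value of every parallel field to its final value, and piecewise
smooth curves are concatenations of such segments. -/
inductive IsParallelTransport (cov : AffineConnection M) :
    (x y : M) → (TangentSpace (𝓡 6) x →ₗ[ℝ] TangentSpace (𝓡 6) y) → Prop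
  | segment (γ : ℝ → M) (hγ : ContMDiff 𝓘(ℝ, ℝ) (𝓡 6) ∞ γ) (a b : ℝ)
      (P : TangentSpace (𝓡 6) (γ a) →ₗ[ℝ] TangentSpace (𝓡 6) (γ b))
      (hP : ∀ v : TangentSpace (𝓡 6) (γ a), ∃ V : (t : ℝ) → TangentSpace (𝓡 6) (γ t),
        (∀ t, HasCovDerivAlong cov γ V t 0) ∧ V a = v ∧ V b = P v) :
      IsParallelTransport cov (γ a) (γ b) P
  | trans {x y z : M} {P : TangentSpace (𝓡 6) x →ₗ[ℝ] TangentSpace (𝓡 6) y}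
      {Q : TangentSpace (𝓡 6) y →ₗ[ℝ] TangentSpace (𝓡 6) z}
      (hP : IsParallelTransport cov x y P) (hQ : IsParallelTransport cov y z Q) :
      IsParallelTransport cov x z (Q.comp P)

/-- The holonomy group at `x`: parallel transports along piecewise smooth loops at `x`. -/
def holonomyGroup (cov : AffineConnection M) (x : M) :
    Set (TangentSpace (𝓡 6) x →ₗ[ℝ] TangentSpace (𝓡 6) x) :=
  {P | IsParallelTransport cov x x P}

/-- The isotropy group of the torsion form at `x`: all unitary transformations of the tangent
space which preserve the torsion form. -/
def isotropyGroup (J : OrthogonalACS M) (cov : AffineConnection M) (x : M) :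
    Set (TangentSpace (𝓡 6) x →ₗ[ℝ] TangentSpace (𝓡 6) x) :=
  {a | (∀ X Y, (inner ℝ (a X) (a Y) : ℝ) = inner ℝ X Y) ∧ (∀ X, a (J x X) = J x (a X)) ∧
    ∀ X Y Z, torsionForm cov x (a X) (a Y) (a Z) = torsionForm cov x X Y Z}

/-- `(g,J)` is an almost hermitian structure with parallel torsion related to `SU(2)`, with
characteristic connection `cov = ∇ᶜ`: `∇ᶜTᶜ = 0` and `Hol(∇ᶜ) ⊂ SU(2) ⊂ Iso(Tᶜ)`. -/
structure IsRelatedToSU2 (J : OrthogonalACS M) (cov : AffineConnection M) : Prop where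
  characteristic : IsCharacteristicConnection J cov
  parallel : HasParallelTorsion cov
  su2 : ∀ x : M, ∃ e : OrthonormalBasis (Fin 6) ℝ (TangentSpace (𝓡 6) x), IsAdapted J e ∧
    holonomyGroup cov x ⊆ SU2At e ∧ SU2At e ⊆ isotropyGroup J cov x

/-- At every point, the `U(3)`-orbit of the torsion form with respect to `(g,J)` is the orbit of
`α₁ (e₁₄ + e₂₃) ∧ e₅ + α₅ (e₁₂ + e₃₄) ∧ e₅`. -/
def HasTorsionOrbit (J : OrthogonalACS M) (cov : AffineConnection M) (α₁ α₅ : ℝ) : Prop :=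
  ∀ x : M, ∃ e : OrthonormalBasis (Fin 6) ℝ (TangentSpace (𝓡 6) x), IsAdapted J e ∧
    ∀ X Y Z : TangentSpace (𝓡 6) x,
      torsionForm cov x X Y Z = normalForm α₁ α₅ (e.repr X) (e.repr Y) (e.repr Z)

/-! ### Intrinsic torsion and the class `W₄` -/

/-- `D` is the Levi-Civita connection. -/
def IsLeviCivita (D : AffineConnection M) : Prop :=
  D.IsMetricCompatible ∧ ∀ x : M, D.torsion x = 0

/-- The tensor `(∇_X J) Y = ∇_X (J Y) - J (∇_X Y)` at the point `x`. -/
def derivJ (J : OrthogonalACS M) (D : AffineConnection M) (x : M)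
    (X Y : TangentSpace (𝓡 6) x) : TangentSpace (𝓡 6) x :=
  D (fun y => J y (FiberBundle.extend E6 Y y)) x X - J x (D (FiberBundle.extend E6 Y) x X)

/-- The intrinsic torsion `Γ(X)(Y,Z)` of `(g,J)`, where `D` is the Levi-Civita connection: the
projection of the connection form to the 2-forms anti-commuting with `J`. In an adapted frame, the
connection form `ω(X)(Y,Z)` satisfies `g((∇_X J)Y,Z) = ω(X)(JY,Z) + ω(X)(Y,JZ)`, so that its
projection `(ω(X)(Y,Z) - ω(X)(JY,JZ))/2` equals `-g((∇_X J)Y,JZ)/2`. -/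
def intrinsicTorsion (J : OrthogonalACS M) (D : AffineConnection M) (x : M)
    (X Y Z : TangentSpace (𝓡 6) x) : ℝ :=
  -(1 / 2) * inner ℝ (derivJ J D x X Y) (J x Z)

/-- The 3-form `Ω ∧ ξ`. -/
def kahlerWedge (J : OrthogonalACS M) (x : M) (ξ X Y Z : TangentSpace (𝓡 6) x) : ℝ :=
  kahlerForm J x X Y * inner ℝ ξ Z + kahlerForm J x Y Z * inner ℝ ξ X
    + kahlerForm J x Z X * inner ℝ ξ Y

/-- The map `θ(T) = -½ ∑ eᵢ ⊗ pr_𝔪(eᵢ ⌟ T)` from 3-forms to the space of intrinsic torsions, where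
`pr_𝔪(ω)(Y,Z) = (ω(Y,Z) - ω(JY,JZ))/2` projects 2-forms to those anti-commuting with `J`. -/
def thetaMap (J : OrthogonalACS M) (x : M)
    (T : TangentSpace (𝓡 6) x → TangentSpace (𝓡 6) x → TangentSpace (𝓡 6) x → ℝ)
    (X Y Z : TangentSpace (𝓡 6) x) : ℝ :=
  -(1 / 2) * ((T X Y Z - T X (J x Y) (J x Z)) / 2)

/-- `(g,J)` is of strict type `W₄`: at every point the intrinsic torsion lies in
`W₄ = {θ(Ω ∧ ξ)}` and is not zero. -/
def IsStrictTypeW4 (J : OrthogonalACS M) : Prop :=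
  ∃ D : AffineConnection M, IsLeviCivita D ∧ ∀ x : M,
    (∃ ξ, intrinsicTorsion J D x = thetaMap J x (kahlerWedge J x ξ)) ∧
      intrinsicTorsion J D x ≠ 0

/-! ### Families of almost complex structures -/

/-- The sphere `S² ⊂ ℝ³`. -/
abbrev S2 : Type := Metric.sphere (0 : EuclideanSpace ℝ (Fin 3)) 1

/-- A smooth `S²`-family of orthogonal almost complex structures: smooth jointly in the parameter
and in the point of `M`, and such that distinct parameters give almost complex structures that
differ at every point of `M`. -/
structure IsSphereFamily (Jt : S2 → OrthogonalACS M) : Prop where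
  smooth : ContMDiff ((𝓡 2).prod (𝓡 6)) ((𝓡 6).prod 𝓘(ℝ, E6 →L[ℝ] E6)) ∞
    (fun p : S2 × M => TotalSpace.mk' (E6 →L[ℝ] E6)
      (E := fun x : M => TangentSpace (𝓡 6) x →L[ℝ] TangentSpace (𝓡 6) x) p.2 (Jt p.1 p.2))
  injective : ∀ x : M, Function.Injective (fun q : S2 => Jt q x)

end AlmostHermitian

end

/-! Identify the first four directions of an adapted frame with the quaternions. Then SU(2) acts as
the unit quaternions and commutes with a quaternionic triple I₁, I₂, I₃. For a ∈ ℝ³ let I_a = a₁I₁ +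
a₂I₂ + a₃I₃, with 2-form ω_a. An SU(2)-invariant 3-form is ω_a ∧ e₅ + ω_b ∧ e₆
(`exists_eq_wedgeForm`).

The geometric point is that a and b are linearly dependent (`torsion_relations`). Holonomy fixes e₅,
e₆ and commutes with the Iᵢ, so all of these extend to parallel fields; let ξ, η extend e₅, e₆.
Since T(ξ,η) = 0, the fields ξ, η commute, and the Jacobi identity with [ξ,X] = ∇_ξ X - T(ξ,X) gives
R(ξ,η) = [T(η,·), T(ξ,·)], a multiple of I_{a×b} by a non-zero constant. Curvature commutes with
parallel endomorphisms, in particular with all Iᵢ, which forces a × b = 0.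

Hence T = r ω_u ∧ ζ with unit vectors u and ζ, and after rotating the triple and the e₅e₆-plane T =
r ω₁ ∧ e₅ (`exists_parallel_frames`). In this frame J is I_q plus the rotation of the e₅e₆-plane,
for some q ∈ S². Every q ∈ S² gives an orthogonal structure which is parallel for the same
connection and has the same SU(2). The orbit of T relative to it depends only on the angle between
±q and the first axis: α₅ = r|q₁| and α₁ = r√(1 - q₁²). For q = (1,0,0) one gets T = Ω ∧ r e₅
because e₅₆ ∧ e₅ = 0; this is the W₄ structure.

The analytic work links holonomy, defined by curves, to ∇, defined by derivatives. Transport along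
short chart segments solves a linear differential equation and preserves g, J and T
(`exists_transport_line`); connectedness joins all points. A tensor invariant under transport solves
a linear total differential equation, so it is smooth and parallel (`contDiffOn_of_hasLineDerivAt`,
`IsInvariantField.cov_eq_zero`, `IsInvariantEndo.cov_apply`). -/

noncomputable section
set_option linter.unusedSectionVars false
set_option synthInstance.maxHeartbeats 400000

/-! ### Linear differential equations and regularity of their solutions -/

section Calculus

/-- Existence of solutions of a linear differential equation with small coefficients. -/
theorem exists_linear_ode {F : Type*} [NormedAddCommGroup F] [NormedSpace ℝ F] [CompleteSpace F]
    (A : ℝ → F →L[ℝ] F) (hA : ContinuousOn A (Set.Icc (-2) 2)) (C : ℝ) (hC : C ≤ 1 / 4)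
    (hAC : ∀ t ∈ Set.Icc (-2 : ℝ) 2, ‖A t‖ ≤ C) :
    ∃ Φ : ℝ → F →L[ℝ] F, Φ 0 = 1 ∧
      (∀ t ∈ Set.Ioo (-2 : ℝ) 2, HasDerivAt Φ (A t ∘L Φ t) t) ∧ ‖Φ 1 - 1‖ ≤ 2 * C := by
  have hC0 : 0 ≤ C := (norm_nonneg _).trans (hAC 0 (by norm_num))
  -- Solutions are confined to the unit ball around the identity, where the norm is at most 2. The
  -- speed is then at most `2 * C`, and over time 2 the displacement is at most `4 * C ≤ 1`; this is
  -- the origin of the bound `1 / 4`.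
  have hpl : IsPicardLindelof (fun t (Φ : F →L[ℝ] F) => A t ∘L Φ) (tmin := -2) (tmax := 2)
      ⟨0, by norm_num⟩ (1 : F →L[ℝ] F) 1 0 ⟨C * 2, by positivity⟩ ⟨C, hC0⟩ := by
    constructor
    · intro t ht
      refine LipschitzOnWith.of_dist_le_mul fun x _ y _ => ?_
      rw [dist_eq_norm, dist_eq_norm, ← ContinuousLinearMap.comp_sub]
      exact (ContinuousLinearMap.opNorm_comp_le _ _).trans
        (mul_le_mul_of_nonneg_right (hAC t ht) (norm_nonneg _))
    · intro x _
      exact hA.clm_comp continuousOn_const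
    · intro t ht x hx
      refine (ContinuousLinearMap.opNorm_comp_le _ _).trans ?_
      have h1 : ‖x‖ ≤ 2 := by
        have h2 : ‖x - 1‖ ≤ 1 := by simpa [dist_eq_norm] using hx
        have h3 : ‖(1 : F →L[ℝ] F)‖ ≤ 1 := ContinuousLinearMap.norm_id_le
        calc ‖x‖ = ‖(x - 1) + 1‖ := by simp
          _ ≤ ‖x - 1‖ + ‖(1 : F →L[ℝ] F)‖ := norm_add_le _ _
          _ ≤ 2 := by linarith
      exact mul_le_mul (hAC t ht) h1 (norm_nonneg _) hC0
    · simp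
      change C * 2 * 2 ≤ 1
      linarith
  obtain ⟨Φ, h0, h1⟩ := hpl.exists_eq_forall_mem_Icc_hasDerivWithinAt₀
  have hd : ∀ t ∈ Set.Ioo (-2 : ℝ) 2, HasDerivAt Φ (A t ∘L Φ t) t := fun t ht =>
    (h1 t (Set.Ioo_subset_Icc_self ht)).hasDerivAt (Icc_mem_nhds ht.1 ht.2)
  refine ⟨Φ, h0, hd, ?_⟩
  have hd' : ∀ t ∈ Set.Icc (0 : ℝ) 1, HasDerivAt (fun t => Φ t - 1) (A t ∘L Φ t) t := fun t ht =>
    (hd t ⟨by linarith [ht.1], by linarith [ht.2]⟩).sub_const 1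
  -- Grönwall with the crude Lipschitz constant 1 gives `C * (exp 1 - 1)`, below `2 * C`. Linearity
  -- in `C` is what later yields continuity of invariant tensors.
  have hb := norm_le_gronwallBound_of_norm_deriv_right_le (f := fun t => Φ t - 1)
    (f' := fun t => A t ∘L Φ t) (δ := 0) (K := 1) (ε := C) (a := 0) (b := 1)
    (fun t ht => (hd' t ht).continuousAt.continuousWithinAt)
    (fun t ht => (hd' t (Set.Ico_subset_Icc_self ht)).hasDerivWithinAt) (by
      have h2 : Φ 0 = 1 := h0
      simp [h2]) (by
      intro t ht
      have h2 : ‖A t‖ ≤ C := hAC t ⟨by linarith [ht.1], by linarith [ht.2]⟩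
      have h3 : A t ∘L Φ t = A t ∘L (Φ t - 1) + A t := by
        ext; simp
      rw [h3]
      refine (norm_add_le _ _).trans (add_le_add ?_ h2)
      exact (ContinuousLinearMap.opNorm_comp_le _ _).trans
        (mul_le_mul_of_nonneg_right (h2.trans (by linarith)) (norm_nonneg _))) 1 (by norm_num)
  have he := Real.exp_one_lt_d9
  rw [gronwallBound_of_K_ne_0 one_ne_zero] at hb
  simp only [zero_mul, zero_add, div_one, sub_zero, mul_one] at hb
  nlinarith

/-- A continuous function whose directional derivatives are given by a continuous field of
linear maps is differentiable. -/
theorem hasFDerivAt_of_hasLineDerivAt {E F : Type*} [NormedAddCommGroup E] [NormedSpace ℝ E]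
    [NormedAddCommGroup F] [NormedSpace ℝ F] {U : Set E} (hU : IsOpen U) {ψ : E → F}
    {D : E → E →L[ℝ] F} (hD : ContinuousOn D U)
    (h : ∀ z ∈ U, ∀ v, HasLineDerivAt ℝ ψ (D z v) z v) {z : E} (hz : z ∈ U) :
    HasFDerivAt ψ (D z) z := by
  rw [hasFDerivAt_iff_isLittleO_nhds_zero, Asymptotics.isLittleO_iff]
  intro ε hε
  have hc := (hD.continuousAt (hU.mem_nhds hz))
  obtain ⟨δ, hδ, hball⟩ := Metric.eventually_nhds_iff_ball.1
    ((Metric.continuousAt_iff'.1 hc ε hε).and (hU.mem_nhds hz))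
  filter_upwards [Metric.ball_mem_nhds (0 : E) hδ] with v hv
  rw [mem_ball_zero_iff] at hv
  have hmem : ∀ s ∈ Set.Icc (0 : ℝ) 1, z + s • v ∈ Metric.ball z δ := by
    intro s hs
    rw [mem_ball_iff_norm, add_sub_cancel_left, norm_smul, Real.norm_eq_abs, abs_of_nonneg hs.1]
    nlinarith [norm_nonneg v, hs.2]
  -- With the linear part `D z v` removed, the derivative along the segment is small by continuity
  -- of `D`, and the mean value inequality applies.
  have hder : ∀ s ∈ Set.Icc (0 : ℝ) 1,
      HasDerivAt (fun s : ℝ => ψ (z + s • v) - s • D z v) (D (z + s • v) v - D z v) s := by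
    intro s hs
    have h1 : HasDerivAt (fun t : ℝ => ψ (z + s • v + t • v)) (D (z + s • v) v) 0 :=
      h _ (hball _ (hmem s hs)).2 v
    have h2 : HasDerivAt (fun t : ℝ => ψ (z + t • v)) (D (z + s • v) v) s := by
      have h3 : HasDerivAt (fun t : ℝ => ψ (z + s • v + t • v)) (D (z + s • v) v) (s - s) := by
        simpa using h1
      refine (h3.comp_sub_const s s).congr_of_eventuallyEq (.of_forall fun t => ?_)
      simp only [sub_smul]
      congr 1
      abel
    simpa using h2.fun_sub ((hasDerivAt_id s).smul_const (D z v))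
  have := norm_image_sub_le_of_norm_deriv_le_segment_01' (C := ε * ‖v‖)
    (fun s hs => (hder s hs).hasDerivWithinAt) (fun s hs => by
      have h1 := (hball _ (hmem s (Set.Ico_subset_Icc_self hs))).1
      rw [dist_eq_norm] at h1
      rw [← sub_apply]
      exact (ContinuousLinearMap.le_opNorm _ _).trans
        (mul_le_mul_of_nonneg_right h1.le (norm_nonneg _)))
  simpa [sub_sub, add_comm, sub_right_comm] using this

/-- A continuous solution of a linear total differential equation with smooth coefficients is
smooth. -/
theorem contDiffOn_of_hasLineDerivAt {E F : Type*} [NormedAddCommGroup E] [NormedSpace ℝ E]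
    [NormedAddCommGroup F] [NormedSpace ℝ F] {U : Set E} (hU : IsOpen U) {ψ : E → F}
    (hψ : ContinuousOn ψ U) {A : E → F →L[ℝ] E →L[ℝ] F} (hA : ContDiffOn ℝ ∞ A U)
    (h : ∀ z ∈ U, ∀ v, HasLineDerivAt ℝ ψ (A z (ψ z) v) z v) :
    ContDiffOn ℝ ∞ ψ U ∧ ∀ z ∈ U, HasFDerivAt ψ (A z (ψ z)) z := by
  have hd : ∀ z ∈ U, HasFDerivAt ψ (A z (ψ z)) z := fun z hz =>
    hasFDerivAt_of_hasLineDerivAt (D := fun z => A z (ψ z)) hU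
      (hA.continuousOn.clm_apply hψ) h hz
  refine ⟨?_, hd⟩
  rw [contDiffOn_infty]
  intro n
  -- Bootstrap: the derivative `A z (ψ z)` is as regular as `ψ`, so each step gains one order.
  induction n with
  | zero => simpa [contDiffOn_zero] using hψ
  | succ n ih =>
    push_cast
    rw [contDiffOn_succ_iff_fderiv_of_isOpen hU]
    refine ⟨fun z hz => (hd z hz).differentiableAt.differentiableWithinAt, by simp, ?_⟩
    refine ((hA.of_le (by exact_mod_cast le_top)).clm_apply ih).congr fun z hz => ?_
    exact (hd z hz).fderiv

/-- The product rule for the evaluation of a time-dependent linear map. -/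
theorem HasDerivAt.linearMap_apply {E F : Type*} [NormedAddCommGroup E] [NormedSpace ℝ E]
    [FiniteDimensional ℝ E] [NormedAddCommGroup F] [NormedSpace ℝ F] {f : ℝ → E →ₗ[ℝ] F}
    {f' : E →ₗ[ℝ] F} {c : ℝ → E} {c' : E} {t : ℝ}
    (hf : ∀ w, HasDerivAt (fun s => f s w) (f' w) t) (hc : HasDerivAt c c' t) :
    HasDerivAt (fun s => f s (c s)) (f' (c t) + f t c') t := by
  let b := Module.finBasis ℝ E
  have hrepr : ∀ i, HasDerivAt (fun s => b.repr (c s) i) (b.repr c' i) t := fun i =>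
    (LinearMap.toContinuousLinearMap (b.coord i)).hasFDerivAt.comp_hasDerivAt t hc
  have h1 : HasDerivAt (fun s => ∑ i, b.repr (c s) i • f s (b i))
      (∑ i, (b.repr (c t) i • f' (b i) + b.repr c' i • f t (b i))) t :=
    HasDerivAt.fun_sum fun i _ => (hrepr i).smul (hf (b i))
  have h2 : ∀ (g : E →ₗ[ℝ] F) (w : E), ∑ i, b.repr w i • g (b i) = g w := fun g w => by
    conv_rhs => rw [← b.sum_repr w]
    simp only [map_sum, map_smul]
  simp only [Finset.sum_add_distrib, h2] at h1
  exact h1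

end Calculus

/-! ### Vector fields in chart coordinates -/

section Charts

variable {M : Type*} [TopologicalSpace M] [ChartedSpace E6 M] [IsManifold (𝓡 6) ∞ M]

/-- The vectors at `x` with prescribed coordinates in the chart at `p`. -/
def chartLift (p x : M) : E6 →L[ℝ] TangentSpace (𝓡 6) x :=
  (trivializationAt E6 (TangentSpace (𝓡 6)) p).symmL ℝ x

/-- The coordinates of the vectors at `x` in the chart at `p`. -/
def chartCoord (p x : M) : TangentSpace (𝓡 6) x →L[ℝ] E6 :=
  (trivializationAt E6 (TangentSpace (𝓡 6)) p).continuousLinearMapAt ℝ x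

theorem chartCoord_chartLift {p x : M} (hx : x ∈ (chartAt E6 p).source) (w : E6) :
    chartCoord p x (chartLift p x w) = w :=
  Trivialization.continuousLinearMapAt_symmL _ (by simpa using hx) w

theorem chartLift_chartCoord {p x : M} (hx : x ∈ (chartAt E6 p).source)
    (v : TangentSpace (𝓡 6) x) : chartLift p x (chartCoord p x v) = v :=
  Trivialization.symmL_continuousLinearMapAt _ (by simpa using hx) v

theorem symm_mem_source {p : M} {z : E6} (hz : z ∈ (extChartAt (𝓡 6) p).target) :
    (extChartAt (𝓡 6) p).symm z ∈ (chartAt E6 p).source := by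
  simpa using (extChartAt (𝓡 6) p).map_target hz

theorem contMDiffAt_chartLift {p x : M} (hx : x ∈ (chartAt E6 p).source)
    {ξ : M → E6} (hξ : ContMDiffAt (𝓡 6) 𝓘(ℝ, E6) ∞ ξ x) :
    ContMDiffAt (𝓡 6) (𝓡 6).tangent ∞
      (fun y => (⟨y, chartLift p y (ξ y)⟩ : TangentBundle (𝓡 6) M)) x := by
  refine (Trivialization.contMDiffAt_section_iff (s := fun y => chartLift p y (ξ y))
    (trivializationAt E6 (TangentSpace (𝓡 6)) p) (by simpa using hx)).2 ?_
  refine hξ.congr_of_eventuallyEq ?_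
  filter_upwards [(chartAt E6 p).open_source.mem_nhds hx] with y hy
  have := chartCoord_chartLift hy (ξ y)
  rw [chartCoord, Trivialization.continuousLinearMapAt_apply, Trivialization.linearMapAt_apply,
    if_pos (by simpa using hy)] at this
  exact this

theorem isDiffAt_chartLift {p x : M} (hx : x ∈ (chartAt E6 p).source)
    {ξ : M → E6} (hξ : MDifferentiableAt (𝓡 6) 𝓘(ℝ, E6) ξ x) :
    IsDiffAt (fun y => chartLift p y (ξ y)) x := by
  refine (Trivialization.mdifferentiableAt_section_iff (𝓡 6)
    (trivializationAt E6 (TangentSpace (𝓡 6)) p) (fun y => chartLift p y (ξ y))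
    (by simpa using hx)).2 ?_
  refine hξ.congr_of_eventuallyEq ?_
  filter_upwards [(chartAt E6 p).open_source.mem_nhds hx] with y hy
  have := chartCoord_chartLift hy (ξ y)
  rw [chartCoord, Trivialization.continuousLinearMapAt_apply, Trivialization.linearMapAt_apply,
    if_pos (by simpa using hy)] at this
  exact this

theorem IsDiffAt.chartCoord {p x : M} (hx : x ∈ (chartAt E6 p).source)
    {X : (y : M) → TangentSpace (𝓡 6) y} (hX : IsDiffAt X x) :
    MDifferentiableAt (𝓡 6) 𝓘(ℝ, E6) (fun y => chartCoord p y (X y)) x := by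
  have := (Trivialization.mdifferentiableAt_section_iff (𝓡 6)
    (trivializationAt E6 (TangentSpace (𝓡 6)) p) X (by simpa using hx)).1 hX
  refine this.congr_of_eventuallyEq ?_
  filter_upwards [(chartAt E6 p).open_source.mem_nhds hx] with y hy
  rw [_root_.chartCoord, Trivialization.continuousLinearMapAt_apply, Trivialization.linearMapAt_apply,
    if_pos (by simpa using hy)]

/-- The derivative of a curve given in a chart. -/
theorem hasMFDerivAt_symm_comp {p : M} {z : ℝ → E6} {z' : E6} {t : ℝ}
    (hz : HasDerivAt z z' t) (ht : z t ∈ (extChartAt (𝓡 6) p).target) :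
    HasMFDerivAt 𝓘(ℝ, ℝ) (𝓡 6) (fun s => (extChartAt (𝓡 6) p).symm (z s)) t
      ((chartLift p ((extChartAt (𝓡 6) p).symm (z t))).comp
        (ContinuousLinearMap.toSpanSingleton ℝ z')) := by
  have h1 : MDifferentiableAt 𝓘(ℝ, E6) (𝓡 6) (extChartAt (𝓡 6) p).symm (z t) :=
    ((contMDiffOn_extChartAt_symm (n := ∞) p).contMDiffAt
      ((isOpen_extChartAt_target p).mem_nhds ht)).mdifferentiableAt (by simp)
  have h2 := TangentBundle.symmL_trivializationAt (I := 𝓡 6) (𝕜 := ℝ) (symm_mem_source ht)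
  rw [(extChartAt (𝓡 6) p).right_inv ht, ModelWithCorners.range_eq_univ, mfderivWithin_univ] at h2
  have h3 := h1.hasMFDerivAt
  rw [← h2] at h3
  exact h3.comp t hz.hasFDerivAt.hasMFDerivAt

end Charts

/-! ### Christoffel symbols of a smooth connection -/

section Christoffel

theorem ContDiffOn.sum_smulRightL_comp {E F ι : Type*} [NormedAddCommGroup E] [NormedSpace ℝ E]
    [NormedAddCommGroup F] [NormedSpace ℝ F] [Fintype ι] {ℓ : ι → E →L[ℝ] ℝ}
    {C : ι → E → E →L[ℝ] F} {s : Set E} {n : ℕ∞ω} (hC : ∀ i, ContDiffOn ℝ n (C i) s) :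
    ContDiffOn ℝ n
      (fun z => ∑ i, (ContinuousLinearMap.smulRightL ℝ E F (ℓ i)).comp (C i z)) s :=
  ContDiffOn.sum fun i _ => contDiffOn_const.clm_comp (hC i)

variable {M : Type*} [TopologicalSpace M] [ChartedSpace E6 M] [IsManifold (𝓡 6) ∞ M]

/-- `G` describes the connection in the chart at `p` over the open set `N`. -/
structure IsChristoffel (cov : AffineConnection M) (p : M) (N : Set E6)
    (G : E6 → E6 →L[ℝ] E6 →L[ℝ] E6) : Prop where
  isOpen : IsOpen N
  subset : N ⊆ (extChartAt (𝓡 6) p).target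
  smooth : ContDiffOn ℝ ∞ G N
  cov_const : ∀ z ∈ N, ∀ v w, cov (fun x => chartLift p x w) ((extChartAt (𝓡 6) p).symm z)
    (chartLift p _ v) = chartLift p _ (G z v w)

/-- Smoothness of the connection is applied to globally smooth fields, so a coordinate field is cut
off by a bump function; locality of the covariant derivative makes the cut-off harmless near `p`. -/
theorem exists_global_frame [T2Space M] (p : M) (w : E6) :
    ∃ X : (x : M) → TangentSpace (𝓡 6) x,
      ContMDiff (𝓡 6) (𝓡 6).tangent ∞ (fun x => (⟨x, X x⟩ : TangentBundle (𝓡 6) M)) ∧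
      ∀ᶠ x in 𝓝 p, X x = chartLift p x w := by
  let f : SmoothBumpFunction (𝓡 6) p := Classical.arbitrary _
  refine ⟨(fun x => f x) • fun x => chartLift p x w, ?_, ?_⟩
  · intro x
    by_cases hx : x ∈ (chartAt E6 p).source
    · exact f.contMDiffAt.smul_section (contMDiffAt_chartLift hx contMDiffAt_const)
    · have h0 : (f : M → ℝ) =ᶠ[𝓝 x] 0 := by
        rw [← notMem_tsupport_iff_eventuallyEq]
        exact fun h => hx (f.tsupport_subset_chartAt_source h)
      have h1 : ContMDiff (𝓡 6) (𝓡 6).tangent ∞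
          (fun x => (⟨x, 0⟩ : TangentBundle (𝓡 6) M)) :=
        contMDiff_zeroSection ℝ (TangentSpace (𝓡 6) : M → Type)
      refine (h1 x).congr_of_eventuallyEq ?_
      filter_upwards [h0] with y hy
      simp [hy]
  · filter_upwards [f.eventuallyEq_one] with x hx
    simp [hx]

theorem cov_congr (cov : AffineConnection M) {X Y : (x : M) → TangentSpace (𝓡 6) x} {x : M}
    (hX : IsDiffAt X x) (h : ∀ᶠ y in 𝓝 x, X y = Y y) : cov X x = cov Y x := by
  have hY : IsDiffAt Y x := by
    refine MDifferentiableAt.congr_of_eventuallyEq hX ?_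
    filter_upwards [h] with y hy
    rw [hy]
  exact cov.isCovariantDerivativeOnUniv.congr_of_eventuallyEq hX hY Filter.univ_mem h

theorem isDiffAt_of_contMDiffAt {X : (x : M) → TangentSpace (𝓡 6) x} {x : M}
    (h : ContMDiffAt (𝓡 6) (𝓡 6).tangent ∞ (fun x => (⟨x, X x⟩ : TangentBundle (𝓡 6) M)) x) :
    IsDiffAt X x :=
  h.mdifferentiableAt (by simp)

theorem cov_sum (cov : AffineConnection M) {ι : Type*} (s : Finset ι)
    {X : ι → (x : M) → TangentSpace (𝓡 6) x} {x : M} (hX : ∀ i, IsDiffAt (X i) x) :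
    IsDiffAt (fun y => ∑ i ∈ s, X i y) x ∧
      cov (fun y => ∑ i ∈ s, X i y) x = ∑ i ∈ s, cov (X i) x := by
  classical
  induction s using Finset.induction_on with
  | empty =>
    have h0 : (fun y : M => ∑ i ∈ (∅ : Finset ι), X i y) = 0 := by ext; simp
    rw [h0]
    refine ⟨?_, by simp⟩
    exact (contMDiff_zeroSection ℝ (TangentSpace (𝓡 6) : M → Type) x).mdifferentiableAt
      (n := ∞) (by simp)
  | insert i s hi ih =>
    have h1 : (fun y : M => ∑ i ∈ insert i s, X i y) = X i + fun y => ∑ i ∈ s, X i y := by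
      ext y
      simp [Finset.sum_insert hi]
    rw [h1, Finset.sum_insert hi, ← ih.2]
    exact ⟨mdifferentiableAt_add_section (hX i) ih.1,
      cov.isCovariantDerivativeOnUniv.add (hX i) ih.1⟩

/-- The symbols are the chart components of the covariant derivatives of six cut-off coordinate
fields, on the open set where these agree with the true coordinate fields. -/
theorem exists_isChristoffel [T2Space M] (cov : AffineConnection M)
    (hcov : cov.ContMDiffCovariantDerivative ∞) (p : M) :
    ∃ N G, extChartAt (𝓡 6) p p ∈ N ∧ IsChristoffel cov p N G := by
  let φ := extChartAt (𝓡 6) p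
  let b := EuclideanSpace.basisFun (Fin 6) ℝ
  choose X hX hXp using fun i : Fin 6 => exists_global_frame p (b i)
  have hcX : ∀ i, ContMDiff (𝓡 6) ((𝓡 6).prod 𝓘(ℝ, E6 →L[ℝ] E6)) ∞
      (fun x => TotalSpace.mk' (E6 →L[ℝ] E6)
        (E := fun x : M => TangentSpace (𝓡 6) x →L[ℝ] TangentSpace (𝓡 6) x) x (cov (X i) x)) := by
    intro i
    rw [← contMDiffOn_univ]
    exact hcov.contMDiff.contMDiff (by simpa using (hX i).contMDiffOn)
  obtain ⟨U, hUp, hUo, hpU⟩ := eventually_nhds_iff.1 (Filter.eventually_all.2 hXp)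
  let N : Set E6 := φ.target ∩ φ.symm ⁻¹' U
  let Cc : Fin 6 → M → E6 →L[ℝ] E6 := fun i x =>
    (chartCoord p x).comp ((cov (X i) x).comp (chartLift p x))
  have hCc : ∀ i, ContMDiffOn (𝓡 6) 𝓘(ℝ, E6 →L[ℝ] E6) ∞ (Cc i) (chartAt E6 p).source := by
    intro i
    have h1 := (Trivialization.contMDiffOn_section_baseSet_iff (s := fun x => cov (X i) x)
      (trivializationAt (E6 →L[ℝ] E6)
        (fun x : M => TangentSpace (𝓡 6) x →L[ℝ] TangentSpace (𝓡 6) x) p)).1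
        ((hcX i).contMDiffOn)
    refine (h1.mono fun x hx => by simpa using hx).congr fun x hx => ?_
    rw [hom_trivializationAt_apply]
    rfl
  refine ⟨N, fun z => ∑ i, (ContinuousLinearMap.smulRightL ℝ E6 E6
    (EuclideanSpace.proj (𝕜 := ℝ) i)).comp (Cc i (φ.symm z)), ⟨mem_extChartAt_target p, by simpa [φ] using hpU⟩, ?_, ?_, ?_, ?_⟩
  · exact (continuousOn_extChartAt_symm p).isOpen_inter_preimage
      (isOpen_extChartAt_target p) hUo
  · exact Set.inter_subset_left
  · refine ContDiffOn.sum_smulRightL_comp fun i => ?_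
    rw [← contMDiffOn_iff_contDiffOn]
    exact (hCc i).comp ((contMDiffOn_extChartAt_symm (n := ∞) p).mono Set.inter_subset_left)
      fun z hz => symm_mem_source hz.1
  · intro z hz v w
    set x := φ.symm z with hxdef
    have hx : x ∈ (chartAt E6 p).source := symm_mem_source hz.1
    have hXd : ∀ i, IsDiffAt (X i) x := fun i => isDiffAt_of_contMDiffAt (hX i x)
    have hsm : ∀ i, IsDiffAt ((fun _ : M => w i) • X i) x := fun i =>
      MDifferentiableAt.smul_section (mdifferentiableAt_const) (hXd i)
    have h1 : ∀ᶠ y in 𝓝 x, chartLift p y w = ∑ i, ((fun _ : M => w i) • X i) y := by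
      filter_upwards [hUo.mem_nhds hz.2] with y hy
      conv_lhs => rw [← b.sum_repr w]
      rw [map_sum]
      refine Finset.sum_congr rfl fun i _ => ?_
      rw [map_smul, Pi.smul_apply', hUp y hy i]
      simp [b]
    rw [cov_congr cov (isDiffAt_chartLift hx mdifferentiableAt_const) h1,
      (cov_sum cov Finset.univ hsm).2]
    have h2 : ∀ i, cov ((fun _ : M => w i) • X i) x = w i • cov (X i) x := by
      intro i
      rw [cov.isCovariantDerivativeOnUniv.leibniz (hXd i) mdifferentiableAt_const]
      have h3 : mvfderiv (𝓡 6) (fun _ : M => w i) x = 0 := mvfderiv_const _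
      rw [h3]
      ext u
      simp
    simp only [h2]
    simp [map_sum, Cc, chartLift_chartCoord hx]

/-- The covariant derivative in a chart. -/
theorem IsChristoffel.cov_chartLift {cov : AffineConnection M} {p : M} {N : Set E6}
    {G : E6 → E6 →L[ℝ] E6 →L[ℝ] E6} (hG : IsChristoffel cov p N G) {z : E6} (hz : z ∈ N)
    {ξ : E6 → E6} {ξ' : E6 →L[ℝ] E6} (hξ : HasFDerivAt ξ ξ' z) (v : E6) :
    cov (fun x => chartLift p x (ξ (extChartAt (𝓡 6) p x))) ((extChartAt (𝓡 6) p).symm z)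
      (chartLift p _ v) = chartLift p _ (ξ' v + G z v (ξ z)) := by
  let φ := extChartAt (𝓡 6) p
  let b := EuclideanSpace.basisFun (Fin 6) ℝ
  set x := (extChartAt (𝓡 6) p).symm z with hxdef
  have hφx : extChartAt (𝓡 6) p x = z := (extChartAt (𝓡 6) p).right_inv (hG.subset hz)
  have hx : x ∈ (chartAt E6 p).source := symm_mem_source (hG.subset hz)
  have hφd : HasMFDerivAt (𝓡 6) 𝓘(ℝ, E6) (extChartAt (𝓡 6) p) x (chartCoord p x) := by
    have := (mdifferentiableAt_extChartAt (I := 𝓡 6) hx).hasMFDerivAt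
    rwa [← TangentBundle.continuousLinearMapAt_trivializationAt hx] at this
  have hgi : ∀ i, HasMFDerivAt (𝓡 6) 𝓘(ℝ, ℝ) (fun y => ξ (extChartAt (𝓡 6) p y) i) x
      ((((EuclideanSpace.proj (𝕜 := ℝ) i).comp ξ').comp (chartCoord p x))) := by
    intro i
    have h1 : HasFDerivAt (fun y => ξ y i) ((EuclideanSpace.proj (𝕜 := ℝ) i).comp ξ')
        (extChartAt (𝓡 6) p x) := by
      rw [hφx]
      exact (EuclideanSpace.proj (𝕜 := ℝ) (i : Fin 6)).hasFDerivAt.comp z hξ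
    exact h1.hasMFDerivAt.comp x hφd
  have hXd : ∀ i, IsDiffAt (fun y => chartLift p y (b i)) x := fun i =>
    isDiffAt_chartLift hx mdifferentiableAt_const
  have hsm : ∀ i, IsDiffAt ((fun y : M => ξ (extChartAt (𝓡 6) p y) i) •
      fun y => chartLift p y (b i)) x := fun i =>
    MDifferentiableAt.smul_section (hgi i).mdifferentiableAt (hXd i)
  -- Expansion in coordinate fields, to which the Leibniz rule is applied term by term.
  have h1 : (fun y => chartLift p y (ξ (extChartAt (𝓡 6) p y))) = fun y =>
      ∑ i, ((fun y : M => ξ (extChartAt (𝓡 6) p y) i) • fun y => chartLift p y (b i)) y := by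
    ext y
    conv_lhs => rw [← b.sum_repr (ξ (extChartAt (𝓡 6) p y))]
    rw [map_sum]
    refine Finset.sum_congr rfl fun i _ => ?_
    rw [map_smul, Pi.smul_apply']
    simp [b]
  rw [h1, (cov_sum cov Finset.univ hsm).2]
  have h2 : ∀ i, cov ((fun y : M => ξ (extChartAt (𝓡 6) p y) i) • fun y => chartLift p y (b i)) x
      (chartLift p x v) = chartLift p x (ξ' v i • b i + ξ z i • G z v (b i)) := by
    intro i
    rw [cov.isCovariantDerivativeOnUniv.leibniz (hXd i) (hgi i).mdifferentiableAt]
    have h3 := hG.cov_const z hz v (b i)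
    have h4 : mvfderiv (𝓡 6) (fun y : M => ξ (extChartAt (𝓡 6) p y) i) x (chartLift p x v)
        = ξ' v i := by
      rw [mvfderiv, (hgi i).mfderiv]
      change ξ' (chartCoord p x (chartLift p x v)) i = _
      rw [chartCoord_chartLift hx]
    simp only [add_apply, smul_apply, ContinuousLinearMap.smulRight_apply, h4]
    rw [map_add, map_smul, map_smul, ← h3, hφx, add_comm]
  rw [sum_apply, Finset.sum_congr rfl fun i _ => h2 i, ← map_sum,
    Finset.sum_add_distrib]
  congr 2
  · conv_rhs => rw [← b.sum_repr (ξ' v)]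
    simp [b]
  · conv_rhs => rw [← b.sum_repr (ξ z)]
    simp [b]

end Christoffel

/-! ### Parallel forms are constant on parallel fields -/

section ParallelForms

variable {E : Type*} [NormedAddCommGroup E] [NormedSpace ℝ E] [FiniteDimensional ℝ E]

/-- The hypothesis on `B` says that it is parallel, those on `c` and `d` that they are parallel
fields; in the product rule the `Γ`-terms cancel in pairs. -/
theorem hasDerivAt_bilinear_zero {B : ℝ → E →ₗ[ℝ] E →ₗ[ℝ] ℝ} {Γ : E →ₗ[ℝ] E} {c d : ℝ → E} {t : ℝ}
    (hB : ∀ v w, HasDerivAt (fun s => B s v w) (B t (Γ v) w + B t v (Γ w)) t)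
    (hc : HasDerivAt c (-Γ (c t)) t) (hd : HasDerivAt d (-Γ (d t)) t) :
    HasDerivAt (fun s => B s (c s) (d s)) 0 t := by
  have h1 : ∀ w, HasDerivAt (fun s => B s (c s) w) (B t (c t) (Γ w)) t := fun w => by
    have := HasDerivAt.linearMap_apply (f := fun s => (B s).flip w)
      (f' := (B t).flip w ∘ₗ Γ + (B t).flip (Γ w)) (fun v => hB v w) hc
    simpa using this
  have h2 := HasDerivAt.linearMap_apply (f := fun s => B s (c s)) (f' := B t (c t) ∘ₗ Γ) h1 hd
  simpa using h2

theorem hasDerivAt_trilinear_zero {B : ℝ → E →ₗ[ℝ] E →ₗ[ℝ] E →ₗ[ℝ] ℝ} {Γ : E →ₗ[ℝ] E}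
    {c d e : ℝ → E} {t : ℝ}
    (hB : ∀ u v w, HasDerivAt (fun s => B s u v w)
      (B t (Γ u) v w + B t u (Γ v) w + B t u v (Γ w)) t)
    (hc : HasDerivAt c (-Γ (c t)) t) (hd : HasDerivAt d (-Γ (d t)) t)
    (he : HasDerivAt e (-Γ (e t)) t) :
    HasDerivAt (fun s => B s (c s) (d s) (e s)) 0 t := by
  have h1 : ∀ v w, HasDerivAt (fun s => B s (c s) v w)
      (B t (c t) (Γ v) w + B t (c t) v (Γ w)) t := fun v w => by
    have := HasDerivAt.linearMap_apply (f := fun s => ((B s).flip v).flip w)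
      (f' := ((B t).flip v).flip w ∘ₗ Γ + ((B t).flip (Γ v)).flip w + ((B t).flip v).flip (Γ w))
      (fun u => hB u v w) hc
    refine this.congr_deriv ?_
    simp
    ring
  have h2 : ∀ w, HasDerivAt (fun s => B s (c s) (d s) w) (B t (c t) (d t) (Γ w)) t := fun w => by
    have := HasDerivAt.linearMap_apply (f := fun s => (B s (c s)).flip w)
      (f' := (B t (c t)).flip w ∘ₗ Γ + (B t (c t)).flip (Γ w)) (fun v => h1 v w) hd
    simpa using this
  have h3 := HasDerivAt.linearMap_apply (f := fun s => B s (c s) (d s))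
    (f' := B t (c t) (d t) ∘ₗ Γ) h2 he
  simpa using h3

end ParallelForms

/-! ### Parallel fields along curves in a chart -/

section ParallelCurves

variable {M : Type*} [TopologicalSpace M] [ChartedSpace E6 M] [IsManifold (𝓡 6) ∞ M]

/-- The field of bilinear forms `F` is parallel over the open set `N` of the chart at `p`. -/
def IsParallelBilin (cov : AffineConnection M) (p : M) (N : Set E6)
    (F : (x : M) → TangentSpace (𝓡 6) x →ₗ[ℝ] TangentSpace (𝓡 6) x →ₗ[ℝ] ℝ) : Prop :=
  ∀ x, extChartAt (𝓡 6) p x ∈ N → x ∈ (chartAt E6 p).source → ∀ v w,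
    MDifferentiableAt (𝓡 6) 𝓘(ℝ, ℝ) (fun y => F y (chartLift p y v) (chartLift p y w)) x ∧
    ∀ u, mvfderiv (𝓡 6) (fun y => F y (chartLift p y v) (chartLift p y w)) x u =
      F x (cov (fun y => chartLift p y v) x u) (chartLift p x w) +
        F x (chartLift p x v) (cov (fun y => chartLift p y w) x u)

/-- The field of trilinear forms `F` is parallel over the open set `N` of the chart at `p`. -/
def IsParallelTrilin (cov : AffineConnection M) (p : M) (N : Set E6)
    (F : (x : M) → TangentSpace (𝓡 6) x →ₗ[ℝ] TangentSpace (𝓡 6) x →ₗ[ℝ]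
      TangentSpace (𝓡 6) x →ₗ[ℝ] ℝ) : Prop :=
  ∀ x, extChartAt (𝓡 6) p x ∈ N → x ∈ (chartAt E6 p).source → ∀ v₁ v₂ v₃,
    MDifferentiableAt (𝓡 6) 𝓘(ℝ, ℝ)
      (fun y => F y (chartLift p y v₁) (chartLift p y v₂) (chartLift p y v₃)) x ∧
    ∀ u, mvfderiv (𝓡 6)
        (fun y => F y (chartLift p y v₁) (chartLift p y v₂) (chartLift p y v₃)) x u =
      F x (cov (fun y => chartLift p y v₁) x u) (chartLift p x v₂) (chartLift p x v₃) +
        F x (chartLift p x v₁) (cov (fun y => chartLift p y v₂) x u) (chartLift p x v₃) +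
        F x (chartLift p x v₁) (chartLift p x v₂) (cov (fun y => chartLift p y v₃) x u)

/-- `c` is the coordinate expression of a parallel field along the curve with coordinates `z`. -/
structure IsParallelCoord (N : Set E6) (G : E6 → E6 →L[ℝ] E6 →L[ℝ] E6) (z z' c : ℝ → E6) :
    Prop where
  mem : ∀ t, z t ∈ N
  deriv_curve : ∀ t, HasDerivAt z (z' t) t
  deriv_field : ∀ t, HasDerivAt c (-(G (z t) (z' t) (c t))) t

variable {cov : AffineConnection M} {p : M} {N : Set E6} {G : E6 → E6 →L[ℝ] E6 →L[ℝ] E6}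

theorem hasDerivAt_comp_symm {f : M → ℝ} {z : ℝ → E6} {z' : E6} {t : ℝ}
    (hf : MDifferentiableAt (𝓡 6) 𝓘(ℝ, ℝ) f ((extChartAt (𝓡 6) p).symm (z t)))
    (hz : HasDerivAt z z' t) (ht : z t ∈ (extChartAt (𝓡 6) p).target) :
    HasDerivAt (fun s => f ((extChartAt (𝓡 6) p).symm (z s)))
      (mvfderiv (𝓡 6) f ((extChartAt (𝓡 6) p).symm (z t)) (chartLift p _ z')) t := by
  have h1 := hf.hasMFDerivAt.comp t (hasMFDerivAt_symm_comp hz ht)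
  have h2 : HasFDerivAt (fun s => f ((extChartAt (𝓡 6) p).symm (z s)))
      ((mvfderiv (𝓡 6) f ((extChartAt (𝓡 6) p).symm (z t))).comp ((chartLift p _).comp
        (ContinuousLinearMap.toSpanSingleton ℝ z'))) t :=
    hasMFDerivAt_iff_hasFDerivAt.1 h1
  refine h2.hasDerivAt.congr_deriv ?_
  change mvfderiv (𝓡 6) f _ (chartLift p _ ((1 : ℝ) • z')) = _
  rw [one_smul]

variable {z z' c d e : ℝ → E6}

theorem IsParallelCoord.hasCovDerivAlong (hG : IsChristoffel cov p N G)
    (hc : IsParallelCoord N G z z' c) (t : ℝ) :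
    HasCovDerivAlong cov (fun s => (extChartAt (𝓡 6) p).symm (z s))
      (fun s => chartLift p _ (c s)) t 0 := by
  let b := EuclideanSpace.basisFun (Fin 6) ℝ
  have hd : ∀ i, HasDerivAt (fun s => c s i) ((-(G (z t) (z' t) (c t))) i) t := fun i =>
    (EuclideanSpace.proj (𝕜 := ℝ) (i : Fin 6)).hasFDerivAt.comp_hasDerivAt t (hc.deriv_field t)
  have hx := symm_mem_source (hG.subset (hc.mem t))
  refine ⟨6, fun i s => c s i, fun i x => chartLift p x (b i), fun i => (hd i).differentiableAt,
    fun i => isDiffAt_chartLift hx mdifferentiableAt_const, .of_forall fun s => ?_, ?_⟩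
  · change chartLift p _ (c s) = _
    conv_lhs => rw [← b.sum_repr (c s)]
    rw [map_sum]
    refine Finset.sum_congr rfl fun i _ => ?_
    rw [map_smul]
    simp [b]
  · have h1 := (hasMFDerivAt_symm_comp (hc.deriv_curve t) (hG.subset (hc.mem t))).mfderiv
    have h2 : mfderiv 𝓘(ℝ, ℝ) (𝓡 6) (fun s => (extChartAt (𝓡 6) p).symm (z s)) t (1 : ℝ)
        = chartLift p _ (z' t) := by
      rw [h1]
      change chartLift p _ ((1 : ℝ) • z' t) = _
      rw [one_smul]
    rw [h2]
    simp only [(hd _).deriv, hG.cov_const _ (hc.mem t)]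
    rw [Finset.sum_add_distrib]
    simp only [← map_smul, ← map_sum, ← map_add]
    have h3 : ∑ i, (-(G (z t) (z' t) (c t))) i • b i = -(G (z t) (z' t) (c t)) := by
      conv_rhs => rw [← b.sum_repr (-(G (z t) (z' t) (c t)))]
      simp [b]
    have h4 : ∑ i, c t i • b i = c t := by
      conv_rhs => rw [← b.sum_repr (c t)]
      simp [b]
    rw [h3, h4, neg_add_cancel, map_zero]

theorem IsParallelBilin.eq_of_isParallelCoord
    {F : (x : M) → TangentSpace (𝓡 6) x →ₗ[ℝ] TangentSpace (𝓡 6) x →ₗ[ℝ] ℝ}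
    (hF : IsParallelBilin cov p N F) (hG : IsChristoffel cov p N G)
    (hc : IsParallelCoord N G z z' c) (hd : IsParallelCoord N G z z' d) (a b : ℝ) :
    F ((extChartAt (𝓡 6) p).symm (z a)) (chartLift p _ (c a)) (chartLift p _ (d a)) =
      F ((extChartAt (𝓡 6) p).symm (z b)) (chartLift p _ (c b)) (chartLift p _ (d b)) := by
  have key : ∀ t, HasDerivAt (fun t => F ((extChartAt (𝓡 6) p).symm (z t))
      (chartLift p _ (c t)) (chartLift p _ (d t))) 0 t := by
    intro t
    have hx := symm_mem_source (hG.subset (hc.mem t))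
    refine hasDerivAt_bilinear_zero (Γ := (G (z t) (z' t)).toLinearMap)
      (B := fun s => (F ((extChartAt (𝓡 6) p).symm (z s))).compl₁₂
        (chartLift p _).toLinearMap (chartLift p _).toLinearMap) ?_
      (hc.deriv_field t) (hd.deriv_field t)
    intro v w
    obtain ⟨h1, h2⟩ := hF ((extChartAt (𝓡 6) p).symm (z t))
      (by rw [(extChartAt (𝓡 6) p).right_inv (hG.subset (hc.mem t))]; exact hc.mem t) hx v w
    have h3 := hasDerivAt_comp_symm h1 (hc.deriv_curve t) (hG.subset (hc.mem t))
    rw [h2, hG.cov_const _ (hc.mem t), hG.cov_const _ (hc.mem t)] at h3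
    exact h3
  exact is_const_of_deriv_eq_zero (fun t => (key t).differentiableAt) (fun t => (key t).deriv) a b

theorem IsParallelTrilin.eq_of_isParallelCoord
    {F : (x : M) → TangentSpace (𝓡 6) x →ₗ[ℝ] TangentSpace (𝓡 6) x →ₗ[ℝ]
      TangentSpace (𝓡 6) x →ₗ[ℝ] ℝ}
    (hF : IsParallelTrilin cov p N F) (hG : IsChristoffel cov p N G)
    (hc : IsParallelCoord N G z z' c) (hd : IsParallelCoord N G z z' d)
    (he : IsParallelCoord N G z z' e) (a b : ℝ) :
    F ((extChartAt (𝓡 6) p).symm (z a)) (chartLift p _ (c a)) (chartLift p _ (d a))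
        (chartLift p _ (e a)) =
      F ((extChartAt (𝓡 6) p).symm (z b)) (chartLift p _ (c b)) (chartLift p _ (d b))
        (chartLift p _ (e b)) := by
  have key : ∀ t, HasDerivAt (fun t => F ((extChartAt (𝓡 6) p).symm (z t))
      (chartLift p _ (c t)) (chartLift p _ (d t)) (chartLift p _ (e t))) 0 t := by
    intro t
    have hx := symm_mem_source (hG.subset (hc.mem t))
    refine hasDerivAt_trilinear_zero (Γ := (G (z t) (z' t)).toLinearMap)
      (B := fun s => ((F ((extChartAt (𝓡 6) p).symm (z s))).compl₁₂
        (chartLift p _).toLinearMap (chartLift p _).toLinearMap).compr₂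
        (LinearMap.lcomp ℝ ℝ (chartLift p _).toLinearMap)) ?_
      (hc.deriv_field t) (hd.deriv_field t) (he.deriv_field t)
    intro u v w
    obtain ⟨h1, h2⟩ := hF ((extChartAt (𝓡 6) p).symm (z t))
      (by rw [(extChartAt (𝓡 6) p).right_inv (hG.subset (hc.mem t))]; exact hc.mem t) hx u v w
    have h3 := hasDerivAt_comp_symm h1 (hc.deriv_curve t) (hG.subset (hc.mem t))
    rw [h2, hG.cov_const _ (hc.mem t), hG.cov_const _ (hc.mem t), hG.cov_const _ (hc.mem t)] at h3
    exact h3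
  exact is_const_of_deriv_eq_zero (fun t => (key t).differentiableAt) (fun t => (key t).deriv) a b

/-- Parallel transport along a smooth curve in a chart, from the solutions of the equation of
parallel fields. -/
theorem isParallelTransport_of_coord (hG : IsChristoffel cov p N G)
    (hz : ContDiff ℝ ∞ z) (a b : ℝ) (x y : M) (hx : x = (extChartAt (𝓡 6) p).symm (z a))
    (hy : y = (extChartAt (𝓡 6) p).symm (z b))
    (P : TangentSpace (𝓡 6) x →ₗ[ℝ] TangentSpace (𝓡 6) y)
    (hP : ∀ v, ∃ c, IsParallelCoord N G z z' c ∧ chartLift p x (c a) = v ∧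
      chartLift p y (c b) = P v) :
    IsParallelTransport cov x y P := by
  subst hx hy
  refine IsParallelTransport.segment (fun s => (extChartAt (𝓡 6) p).symm (z s)) ?_ a b P ?_
  · have hmem : ∀ t, z t ∈ (extChartAt (𝓡 6) p).target := fun t => by
      obtain ⟨c, hc, -⟩ := hP 0
      exact hG.subset (hc.mem t)
    intro t
    exact ((contMDiffOn_extChartAt_symm (n := ∞) p).contMDiffAt
      ((isOpen_extChartAt_target p).mem_nhds (hmem t))).comp t hz.contMDiff.contMDiffAt
  · intro v
    obtain ⟨c, hc, ha, hb⟩ := hP v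
    exact ⟨fun s => chartLift p _ (c s), hc.hasCovDerivAlong hG, ha, hb⟩

end ParallelCurves

/-! ### The metric, the Kähler form and the torsion are parallel -/

section ParallelTensors

variable {M : Type*} [TopologicalSpace M] [ChartedSpace E6 M] [IsManifold (𝓡 6) ∞ M]
  [RiemannianBundle (fun x : M => TangentSpace (𝓡 6) x)]
  [IsContMDiffRiemannianBundle (𝓡 6) ∞ E6 (fun x : M => TangentSpace (𝓡 6) x)]
  {cov : AffineConnection M} {p : M} {N : Set E6} {G : E6 → E6 →L[ℝ] E6 →L[ℝ] E6}

/-- The metric as a field of bilinear maps. -/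
def metricBilin (x : M) : TangentSpace (𝓡 6) x →ₗ[ℝ] TangentSpace (𝓡 6) x →ₗ[ℝ] ℝ :=
  innerₗ (TangentSpace (𝓡 6) x)

/-- The torsion form as a field of trilinear maps. -/
def torsionTrilin (cov : AffineConnection M) (x : M) :
    TangentSpace (𝓡 6) x →ₗ[ℝ] TangentSpace (𝓡 6) x →ₗ[ℝ] TangentSpace (𝓡 6) x →ₗ[ℝ] ℝ :=
  LinearMap.compr₂ (ContinuousLinearMap.toLinearMap₁₂ (cov.torsion x))
    (innerₗ (TangentSpace (𝓡 6) x))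

theorem isParallelBilin_metric (hcov : cov.IsMetricCompatible) :
    IsParallelBilin cov p N (metricBilin (M := M)) := by
  intro x _ hx v w
  have hv : IsDiffAt (fun y => chartLift p y v) x := isDiffAt_chartLift hx mdifferentiableAt_const
  have hw : IsDiffAt (fun y => chartLift p y w) x := isDiffAt_chartLift hx mdifferentiableAt_const
  refine ⟨hv.inner_bundle hw, fun u => ?_⟩
  have := hcov.mvfderiv_inner_eq (FiberBundle.extend E6 u) hv hw
  simpa using! this

theorem OrthogonalACS.isDiffAt (J : OrthogonalACS M) {X : (x : M) → TangentSpace (𝓡 6) x} {x : M}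
    (hX : IsDiffAt X x) : IsDiffAt (fun y => J y (X y)) x :=
  MDifferentiableAt.clm_bundle_apply ((J.smooth x).mdifferentiableAt (by simp)) hX

theorem isParallelBilin_kahler {J : OrthogonalACS M} (hJ : IsCharacteristicConnection J cov) :
    IsParallelBilin cov p N (fun x => metricBilin x ∘ₗ (J x).toLinearMap) := by
  intro x _ hx v w
  have hv : IsDiffAt (fun y => chartLift p y v) x := isDiffAt_chartLift hx mdifferentiableAt_const
  have hw : IsDiffAt (fun y => chartLift p y w) x := isDiffAt_chartLift hx mdifferentiableAt_const
  refine ⟨(J.isDiffAt hv).inner_bundle hw, fun u => ?_⟩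
  have := hJ.metric.mvfderiv_inner_eq (FiberBundle.extend E6 u) (J.isDiffAt hv) hw
  dsimp only at this
  rw [hJ.complex x _ hv] at this
  simpa using! this

/-- The derivative formula is the hypothesis; the content is differentiability, since `mvfderiv` is
0 by default at points where it fails. It follows by writing the torsion through covariant
derivatives and the Lie bracket of coordinate fields. -/
theorem isParallelTrilin_torsion (hG : IsChristoffel cov p N G) (hT : HasParallelTorsion cov) :
    IsParallelTrilin cov p N (torsionTrilin cov) := by
  intro x hxN hx v₁ v₂ v₃
  have hd : ∀ v, IsDiffAt (fun y => chartLift p y v) x := fun v =>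
    isDiffAt_chartLift hx mdifferentiableAt_const
  refine ⟨?_, fun u => hT x _ _ _ (hd v₁) (hd v₂) (hd v₃) u⟩
  have hφ : ContMDiffAt (𝓡 6) 𝓘(ℝ, E6) ∞ (extChartAt (𝓡 6) p) x :=
    contMDiffAt_extChartAt' hx
  have hev : ∀ᶠ y in 𝓝 x, extChartAt (𝓡 6) p y ∈ N ∧ y ∈ (chartAt E6 p).source :=
    (hφ.continuousAt.eventually (hG.isOpen.mem_nhds hxN)).and
      ((chartAt E6 p).open_source.mem_nhds hx)
  have hcov : ∀ v w, IsDiffAt (fun y => cov (fun y => chartLift p y w) y (chartLift p y v)) x := by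
    intro v w
    have h1 : IsDiffAt (fun y => chartLift p y (G (extChartAt (𝓡 6) p y) v w)) x := by
      refine isDiffAt_chartLift hx ?_
      have h2 : DifferentiableAt ℝ (fun z => G z v w) (extChartAt (𝓡 6) p x) := by
        have := (hG.smooth.contDiffAt (hG.isOpen.mem_nhds hxN)).differentiableAt (by simp)
        exact (this.clm_apply (differentiableAt_const v)).clm_apply (differentiableAt_const w)
      exact h2.mdifferentiableAt.comp x (hφ.mdifferentiableAt (by simp))
    refine MDifferentiableAt.congr_of_eventuallyEq h1 ?_
    filter_upwards [hev] with y hy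
    have h3 := hG.cov_const _ hy.1 v w
    rw [(extChartAt (𝓡 6) p).left_inv (by simpa using hy.2)] at h3
    rw [h3]
  have hbr : IsDiffAt (VectorField.mlieBracket (𝓡 6) (fun y => chartLift p y v₁)
      (fun y => chartLift p y v₂)) x := by
    have : IsManifold (𝓡 6) (((⊤ : ℕ∞) : ℕ∞ω) + 1) M := by simpa
    have : IsManifold (𝓡 6) (minSmoothness ℝ 2) M := by
      simpa using (inferInstance : IsManifold (𝓡 6) 2 M)
    exact (ContMDiffAt.mlieBracket_vectorField (m := 1) (n := ⊤)
      (contMDiffAt_chartLift hx contMDiffAt_const)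
      (contMDiffAt_chartLift hx contMDiffAt_const)
      (by simpa using (by exact_mod_cast le_top : ((1 + 1 : ℕ∞) : ℕ∞ω) ≤ ∞))).mdifferentiableAt (by simp)
  have htor : IsDiffAt (fun y => cov.torsion y (chartLift p y v₁) (chartLift p y v₂)) x := by
    have h1 := mdifferentiableAt_sub_section (mdifferentiableAt_sub_section (hcov v₁ v₂) (hcov v₂ v₁)) hbr
    refine MDifferentiableAt.congr_of_eventuallyEq h1 ?_
    filter_upwards [hev] with y hy
    rw [cov.torsion_apply (X := fun y => chartLift p y v₁) (Y := fun y => chartLift p y v₂)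
      (isDiffAt_chartLift hy.2 mdifferentiableAt_const)
      (isDiffAt_chartLift hy.2 mdifferentiableAt_const)]
    rfl
  exact MDifferentiableAt.inner_bundle htor (hd v₃)

end ParallelTensors

/-! ### Parallel transport and its invariants -/

section Transport

variable {M : Type*} [TopologicalSpace M] [ChartedSpace E6 M] [IsManifold (𝓡 6) ∞ M]
  [RiemannianBundle (fun x : M => TangentSpace (𝓡 6) x)]
  [IsContMDiffRiemannianBundle (𝓡 6) ∞ E6 (fun x : M => TangentSpace (𝓡 6) x)]
  {J : OrthogonalACS M} {cov : AffineConnection M} {p : M} {N : Set E6}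
  {G : E6 → E6 →L[ℝ] E6 →L[ℝ] E6}

/-- `P` and its inverse are parallel transports which preserve the metric, the almost complex
structure and the torsion. -/
structure IsReversibleTransport (J : OrthogonalACS M) (cov : AffineConnection M) {x y : M}
    (P : TangentSpace (𝓡 6) x ≃ₗ[ℝ] TangentSpace (𝓡 6) y) : Prop where
  transport : IsParallelTransport cov x y P.toLinearMap
  transport_symm : IsParallelTransport cov y x P.symm.toLinearMap
  inner_map (v w : TangentSpace (𝓡 6) x) : (inner ℝ (P v) (P w) : ℝ) = inner ℝ v w
  map_acs (v : TangentSpace (𝓡 6) x) : P (J x v) = J y (P v)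
  map_torsion (v w : TangentSpace (𝓡 6) x) : P (cov.torsion x v w) = cov.torsion y (P v) (P w)

theorem IsReversibleTransport.symm {x y : M} {P : TangentSpace (𝓡 6) x ≃ₗ[ℝ] TangentSpace (𝓡 6) y}
    (hP : IsReversibleTransport J cov P) : IsReversibleTransport J cov P.symm where
  transport := hP.transport_symm
  transport_symm := hP.transport
  inner_map v w := by rw [← hP.inner_map]; simp
  map_acs v := by rw [LinearEquiv.symm_apply_eq, hP.map_acs]; simp
  map_torsion v w := by rw [LinearEquiv.symm_apply_eq, hP.map_torsion]; simp

theorem IsReversibleTransport.trans {x y z : M}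
    {P : TangentSpace (𝓡 6) x ≃ₗ[ℝ] TangentSpace (𝓡 6) y}
    {Q : TangentSpace (𝓡 6) y ≃ₗ[ℝ] TangentSpace (𝓡 6) z}
    (hP : IsReversibleTransport J cov P) (hQ : IsReversibleTransport J cov Q) :
    IsReversibleTransport J cov (P.trans Q) where
  transport := hP.transport.trans hQ.transport
  transport_symm := hQ.transport_symm.trans hP.transport_symm
  inner_map v w := by simp [hP.inner_map, hQ.inner_map]
  map_acs v := by simp [hP.map_acs, hQ.map_acs]
  map_torsion v w := by simp [hP.map_torsion, hQ.map_torsion]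

theorem exists_ball_norm_le {E F : Type*} [NormedAddCommGroup E] [NormedAddCommGroup F]
    {G : E → F} {N : Set E} (hN : IsOpen N) (hG : ContinuousOn G N) {z₀ : E} (hz₀ : z₀ ∈ N) :
    ∃ ρ > 0, ∃ K > 0, ∀ z ∈ Metric.ball z₀ ρ, z ∈ N ∧ ‖G z‖ ≤ K := by
  have hc : ContinuousAt G z₀ := hG.continuousAt (hN.mem_nhds hz₀)
  have h1 : ∀ᶠ z in 𝓝 z₀, ‖G z‖ < ‖G z₀‖ + 1 :=
    (Filter.Tendsto.norm hc).eventually_lt_const (lt_add_one _)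
  have h2 : ∀ᶠ z in 𝓝 z₀, z ∈ N := hN.mem_nhds hz₀
  obtain ⟨ρ, hρ, h⟩ := Metric.eventually_nhds_iff_ball.1 (h2.and h1)
  exact ⟨ρ, hρ, ‖G z₀‖ + 1, by positivity, fun z hz => ⟨(h z hz).1, (h z hz).2.le⟩⟩

/-- Parallel transport along short straight lines of a chart. -/
theorem exists_transport_line (hG : IsChristoffel cov p N G)
    (hJ : IsCharacteristicConnection J cov) (hT : HasParallelTorsion cov) {z₀ : E6}
    (hz₀ : z₀ ∈ N) :
    ∃ ε > 0, ∃ C, ∀ v : E6, ‖v‖ < ε → ∃ Φ : ℝ → E6 →L[ℝ] E6,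
      Φ 0 = 1 ∧ HasDerivAt Φ (-(G z₀ v)) 0 ∧ ‖Φ 1 - 1‖ ≤ C * ‖v‖ ∧
      ∀ s ∈ Set.Icc (-1 : ℝ) 1, z₀ + s • v ∈ N ∧
        ∃ P : TangentSpace (𝓡 6) ((extChartAt (𝓡 6) p).symm z₀) ≃ₗ[ℝ]
            TangentSpace (𝓡 6) ((extChartAt (𝓡 6) p).symm (z₀ + s • v)),
          IsReversibleTransport J cov P ∧
          ∀ w, P (chartLift p _ w) = chartLift p _ (Φ s w) := by
  obtain ⟨ρ, hρ, K, hK, hb⟩ :=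
    exists_ball_norm_le hG.isOpen hG.smooth.continuousOn hz₀
  -- The factor `ρ / 3` keeps `z₀ + t • v` in the ball for `|t| ≤ 2`; `1 / (4 * K)` makes the
  -- coefficient small enough for `exists_linear_ode`, whose estimate yields the constant `2 * K`.
  refine ⟨min (ρ / 3) (1 / (4 * K)), by positivity, 2 * K, fun v hv => ?_⟩
  have hv1 : ‖v‖ < ρ / 3 := hv.trans_le (min_le_left _ _)
  have hv2 : K * ‖v‖ ≤ 1 / 4 := by
    have := (hv.trans_le (min_le_right _ _)).le
    rw [le_div_iff₀ (by positivity)] at this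
    linarith
  have hball : ∀ t ∈ Set.Icc (-2 : ℝ) 2, z₀ + t • v ∈ Metric.ball z₀ ρ := by
    intro t ht
    rw [mem_ball_iff_norm, add_sub_cancel_left, norm_smul, Real.norm_eq_abs]
    have : |t| ≤ 2 := abs_le.2 ht
    nlinarith [norm_nonneg v, abs_nonneg t]
  have hline : Continuous fun t : ℝ => z₀ + t • v := by fun_prop
  obtain ⟨Φ, h0, hΦ, hn⟩ := exists_linear_ode (fun t => -(G (z₀ + t • v) v))
    (((hG.smooth.continuousOn.comp hline.continuousOn fun t ht => (hb _ (hball t ht)).1).clm_apply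
      continuousOn_const).neg) (K * ‖v‖) hv2 (fun t ht => by
      rw [norm_neg]
      exact (ContinuousLinearMap.le_opNorm _ _).trans
        (mul_le_mul_of_nonneg_right (hb _ (hball t ht)).2 (norm_nonneg _)))
  refine ⟨Φ, h0, ?_, by linarith, fun s hs => ?_⟩
  · have := hΦ 0 (by norm_num)
    rw [h0] at this
    simpa using! this
  have hs2 : ∀ r ∈ Set.Icc (0 : ℝ) 1, s * r ∈ Set.Icc (-1 : ℝ) 1 := by
    intro r hr
    rw [Set.mem_Icc, ← abs_le, abs_mul]
    have h1 : |s| ≤ 1 := abs_le.2 hs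
    have h2 : |r| ≤ 1 := abs_le.2 ⟨by linarith [hr.1], hr.2⟩
    nlinarith [abs_nonneg s, abs_nonneg r]
  -- Transport is defined through smooth curves on all of ℝ, while the segment leaves the chart
  -- eventually. A smooth step from 0 to 1 reparametrises it, so that the curve stays in `N` for all
  -- times.
  let χ := Real.smoothTransition
  have hχ : ContDiff ℝ ∞ χ := Real.smoothTransition.contDiff
  have hχm : ∀ t, s * χ t ∈ Set.Icc (-1 : ℝ) 1 := fun t =>
    hs2 _ ⟨Real.smoothTransition.nonneg t, Real.smoothTransition.le_one t⟩
  have hχd : ∀ t, HasDerivAt χ (deriv χ t) t := fun t =>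
    (hχ.differentiable (by simp) t).hasDerivAt
  let z : ℝ → E6 := fun t => z₀ + (s * χ t) • v
  let z' : ℝ → E6 := fun t => (s * deriv χ t) • v
  have hz : ContDiff ℝ ∞ z := contDiff_const.add ((contDiff_const.mul hχ).smul contDiff_const)
  let c : E6 → ℝ → E6 := fun w t => Φ (s * χ t) w
  have hc : ∀ w, IsParallelCoord N G z z' (c w) := by
    intro w
    refine ⟨fun t => (hb _ (hball _ ?_)).1, fun t => ?_, fun t => ?_⟩
    · exact ⟨by linarith [(hχm t).1], by linarith [(hχm t).2]⟩
    · exact (((hχd t).const_mul s).smul_const v).const_add z₀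
    -- Reparametrisation multiplies both sides of the equation by `s * χ'`. It needs `Φ` only on
    -- [-1, 1], inside the open interval where the equation holds.
    · have h1 := (hΦ (s * χ t) ⟨by linarith [(hχm t).1], by linarith [(hχm t).2]⟩).scomp t
        ((hχd t).const_mul s)
      have h2 := h1.clm_apply (hasDerivAt_const t w)
      refine h2.congr_deriv ?_
      simp [z, z', c]
  have hz0 : z 0 = z₀ := by simp [z, χ]
  have hz1 : z 1 = z₀ + s • v := by simp [z, χ]
  have hc0 : ∀ w, c w 0 = w := by simp [c, χ, h0]
  have hc1 : ∀ w, c w 1 = Φ s w := by simp [c, χ]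
  have hsN : z₀ + s • v ∈ N := by rw [← hz1]; exact (hc 0).mem 1
  refine ⟨hsN, ?_⟩
  set x := (extChartAt (𝓡 6) p).symm z₀ with hx
  set y := (extChartAt (𝓡 6) p).symm (z₀ + s • v) with hy
  have hxs : x ∈ (chartAt E6 p).source := symm_mem_source (hG.subset hz₀)
  have hinner : ∀ w w', (inner ℝ (chartLift p y (Φ s w)) (chartLift p y (Φ s w')) : ℝ) =
      inner ℝ (chartLift p x w) (chartLift p x w') := by
    intro w w'
    have := (isParallelBilin_metric hJ.metric).eq_of_isParallelCoord hG (hc w) (hc w') 1 0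
    rwa [hz0, hz1, hc0, hc0, hc1, hc1] at this
  have hkahler : ∀ w w', (inner ℝ (J y (chartLift p y (Φ s w))) (chartLift p y (Φ s w')) : ℝ) =
      inner ℝ (J x (chartLift p x w)) (chartLift p x w') := by
    intro w w'
    have := (isParallelBilin_kahler hJ).eq_of_isParallelCoord hG (hc w) (hc w') 1 0
    rwa [hz0, hz1, hc0, hc0, hc1, hc1] at this
  have htorsion : ∀ u w w', torsionForm cov y (chartLift p y (Φ s u)) (chartLift p y (Φ s w))
      (chartLift p y (Φ s w')) =
      torsionForm cov x (chartLift p x u) (chartLift p x w) (chartLift p x w') := by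
    intro u w w'
    have := (isParallelTrilin_torsion hG hT).eq_of_isParallelCoord hG (hc u) (hc w) (hc w') 1 0
    rwa [hz0, hz1, hc0, hc0, hc0, hc1, hc1, hc1] at this
  let L : TangentSpace (𝓡 6) x →ₗ[ℝ] TangentSpace (𝓡 6) y :=
    ((chartLift p y).comp ((Φ s).comp (chartCoord p x))).toLinearMap
  have hL : ∀ w, L (chartLift p x w) = chartLift p y (Φ s w) := fun w => by
    change chartLift p y (Φ s (chartCoord p x (chartLift p x w))) = _
    rw [chartCoord_chartLift hxs]
  have hLi : ∀ u w, (inner ℝ (L u) (L w) : ℝ) = inner ℝ u w := by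
    intro u w
    rw [← chartLift_chartCoord hxs u, ← chartLift_chartCoord hxs w, hL, hL, hinner]
  -- An isometry is injective, hence bijective because the dimensions agree; invertibility of `Φ s`
  -- need not be known separately.
  have hinj : Function.Injective L := by
    rw [injective_iff_map_eq_zero]
    intro u hu
    have := hLi u u
    rw [hu, inner_zero_left] at this
    exact inner_self_eq_zero.1 this.symm
  have : FiniteDimensional ℝ (TangentSpace (𝓡 6) x) := inferInstanceAs (FiniteDimensional ℝ E6)
  have : FiniteDimensional ℝ (TangentSpace (𝓡 6) y) := inferInstanceAs (FiniteDimensional ℝ E6)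
  let P : TangentSpace (𝓡 6) x ≃ₗ[ℝ] TangentSpace (𝓡 6) y :=
    LinearEquiv.ofInjectiveOfFinrankEq L hinj rfl
  have hPL : ∀ u, P u = L u := fun u => rfl
  refine ⟨P, ⟨?_, ?_, hLi, ?_, ?_⟩, hL⟩
  · refine isParallelTransport_of_coord (z := z) (z' := z') hG hz 0 1 x y (by rw [hz0])
      (by rw [hz1]) _ fun u => ⟨c (chartCoord p x u), hc _, ?_, ?_⟩
    · rw [hc0, chartLift_chartCoord hxs]
    · rw [hc1]
      rfl
  -- The inverse is the transport along the same curve, read from time 1 to time 0.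
  · refine isParallelTransport_of_coord (z := z) (z' := z') hG hz 1 0 y x (by rw [hz1])
      (by rw [hz0]) _ fun u => ⟨c (chartCoord p x (P.symm u)), hc _, ?_, ?_⟩
    · rw [hc1, ← hL, ← hPL, chartLift_chartCoord hxs, LinearEquiv.apply_symm_apply]
    · rw [hc0, chartLift_chartCoord hxs]
      rfl
  · intro u
    refine ext_inner_right ℝ fun w => ?_
    obtain ⟨w, rfl⟩ := P.surjective w
    rw [hPL, hPL, hPL, hLi, ← chartLift_chartCoord hxs u, ← chartLift_chartCoord hxs w, hL, hL,
      hkahler]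
  · intro u₁ u₂
    refine ext_inner_right ℝ fun w => ?_
    obtain ⟨w, rfl⟩ := P.surjective w
    rw [hPL, hPL, hPL, hPL, hLi, ← chartLift_chartCoord hxs u₁, ← chartLift_chartCoord hxs u₂,
      ← chartLift_chartCoord hxs w, hL, hL, hL]
    exact (htorsion _ _ _).symm

theorem eventually_exists_transport [T2Space M] (hJ : IsCharacteristicConnection J cov)
    (hT : HasParallelTorsion cov) (x : M) :
    ∀ᶠ y in 𝓝 x, ∃ P : TangentSpace (𝓡 6) x ≃ₗ[ℝ] TangentSpace (𝓡 6) y,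
      IsReversibleTransport J cov P := by
  obtain ⟨N, G, hx, hG⟩ := exists_isChristoffel cov hJ.smooth x
  obtain ⟨ε, hε, C, h⟩ := exists_transport_line hG hJ hT hx
  filter_upwards [(continuousAt_extChartAt (I := 𝓡 6) x).eventually (Metric.ball_mem_nhds _ hε),
    extChartAt_source_mem_nhds (I := 𝓡 6) x] with y hy hys
  obtain ⟨Φ, -, -, -, hΦ⟩ := h (extChartAt (𝓡 6) x y - extChartAt (𝓡 6) x x)
    (by rwa [← mem_ball_iff_norm])
  obtain ⟨-, hP⟩ := hΦ 1 (by norm_num)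
  have hP' : ∃ P : TangentSpace (𝓡 6) ((extChartAt (𝓡 6) x).symm (extChartAt (𝓡 6) x x)) ≃ₗ[ℝ]
      TangentSpace (𝓡 6) ((extChartAt (𝓡 6) x).symm (extChartAt (𝓡 6) x x +
        (1 : ℝ) • (extChartAt (𝓡 6) x y - extChartAt (𝓡 6) x x))),
      IsReversibleTransport J cov P := by
    obtain ⟨P, hP, -⟩ := hP
    exact ⟨P, hP⟩
  rwa [one_smul, add_sub_cancel, (extChartAt (𝓡 6) x).left_inv hys,
    extChartAt_to_inv x] at hP'

/-- Being joined by a reversible transport is an equivalence relation, and it holds near every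
point, so connectedness leaves one class. -/
theorem exists_transport [T2Space M] [ConnectedSpace M] (hJ : IsCharacteristicConnection J cov)
    (hT : HasParallelTorsion cov) (x y : M) :
    ∃ P : TangentSpace (𝓡 6) x ≃ₗ[ℝ] TangentSpace (𝓡 6) y, IsReversibleTransport J cov P := by
  refine PreconnectedSpace.induction₂' (fun x y => ∃ P : TangentSpace (𝓡 6) x ≃ₗ[ℝ]
    TangentSpace (𝓡 6) y, IsReversibleTransport J cov P) (fun x => ?_) ⟨?_⟩ x y
  · filter_upwards [eventually_exists_transport hJ hT x] with y ⟨P, hP⟩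
    exact ⟨⟨P, hP⟩, _, hP.symm⟩
  · rintro x y z ⟨P, hP⟩ ⟨Q, hQ⟩
    exact ⟨_, hP.trans hQ⟩

end Transport

/-! ### Transport-invariant functions solve total differential equations -/

section InvariantSolutions

variable {E : Type*} [NormedAddCommGroup E] [NormedSpace ℝ E]

theorem HasLineDerivAt.of_forall_norm_lt {F : Type*} [NormedAddCommGroup F] [NormedSpace ℝ F]
    {ψ : E → F} {D : E →L[ℝ] F} {z : E} {ε : ℝ} (hε : 0 < ε)
    (h : ∀ v, ‖v‖ < ε → HasLineDerivAt ℝ ψ (D v) z v) (v : E) :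
    HasLineDerivAt ℝ ψ (D v) z v := by
  have hpos : 0 < ε / (2 * (‖v‖ + 1)) := by positivity
  have h1 : ‖(ε / (2 * (‖v‖ + 1))) • v‖ < ε := by
    rw [norm_smul, Real.norm_of_nonneg hpos.le, div_mul_eq_mul_div, div_lt_iff₀ (by positivity)]
    nlinarith [norm_nonneg v]
  have h2 := (h _ h1).smul (ε / (2 * (‖v‖ + 1)))⁻¹
  rwa [map_smul, inv_smul_smul₀ hpos.ne', inv_smul_smul₀ hpos.ne'] at h2

/-- The bound is uniform in the direction of `v`. This gives continuity of invariant functions,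
which directional derivatives alone would not. -/
theorem tendsto_one_of_norm_le {R : Type*} [NormedRing R] {Φ : E → ℝ → R} {ε C : ℝ} (hε : 0 < ε)
    (h : ∀ v, ‖v‖ < ε → ‖Φ v 1 - 1‖ ≤ C * ‖v‖) (z₀ : E) :
    Filter.Tendsto (fun z => Φ (z - z₀) 1) (𝓝 z₀) (𝓝 1) := by
  rw [tendsto_iff_norm_sub_tendsto_zero]
  have h1 : Filter.Tendsto (fun z => C * ‖z - z₀‖) (𝓝 z₀) (𝓝 0) := by
    have : Continuous fun z => C * ‖z - z₀‖ := by fun_prop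
    simpa using this.tendsto z₀
  refine squeeze_zero' (.of_forall fun _ => norm_nonneg _) ?_ h1
  filter_upwards [Metric.ball_mem_nhds z₀ hε] with z hz
  exact h _ (by rwa [← mem_ball_iff_norm])

/-- Functions invariant under the transport with generator `-G` solve the equation of parallel
vector fields. -/
theorem contDiffOn_of_transport_apply {N : Set E} {G : E → E →L[ℝ] E →L[ℝ] E} (hN : IsOpen N)
    (hG : ContDiffOn ℝ ∞ G N) {ψ : E → E}
    (h : ∀ z₀ ∈ N, ∃ ε > 0, ∃ C, ∀ v : E, ‖v‖ < ε → ∃ Φ : ℝ → E →L[ℝ] E,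
      Φ 0 = 1 ∧ HasDerivAt Φ (-(G z₀ v)) 0 ∧ ‖Φ 1 - 1‖ ≤ C * ‖v‖ ∧
      ∀ s ∈ Set.Icc (-1 : ℝ) 1, ψ (z₀ + s • v) = Φ s (ψ z₀)) :
    ContDiffOn ℝ ∞ ψ N ∧ ∀ z ∈ N, HasFDerivAt ψ (-(G z).flip (ψ z)) z := by
  refine contDiffOn_of_hasLineDerivAt (A := fun z => -(G z).flip) hN ?_ ?_ ?_
  · intro z₀ hz₀
    refine ContinuousAt.continuousWithinAt ?_
    obtain ⟨ε, hε, C, hv⟩ := h z₀ hz₀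
    choose! Φ _ _ hn hψ using hv
    have h1 := ((ContinuousLinearMap.apply ℝ E (ψ z₀)).continuous.tendsto 1).comp
      (tendsto_one_of_norm_le hε hn z₀)
    refine h1.congr' ?_
    filter_upwards [Metric.ball_mem_nhds z₀ hε] with z hz
    have := hψ (z - z₀) (by rwa [← mem_ball_iff_norm]) 1 (by norm_num)
    change Φ (z - z₀) 1 (ψ z₀) = ψ z
    rw [← this, one_smul, add_sub_cancel]
  · exact ((ContinuousLinearMap.flipₗᵢ ℝ E E E).toContinuousLinearEquiv.contDiff.comp_contDiffOn
      hG).neg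
  · intro z hz
    obtain ⟨ε, hε, C, hv⟩ := h z hz
    refine HasLineDerivAt.of_forall_norm_lt hε fun v hvε => ?_
    obtain ⟨Φ, -, hd, -, hψ⟩ := hv v hvε
    have h1 := hd.clm_apply (hasDerivAt_const (0 : ℝ) (ψ z))
    have h2 : HasDerivAt (fun s : ℝ => ψ (z + s • v)) _ 0 := h1.congr_of_eventuallyEq (by
      filter_upwards [Icc_mem_nhds (by norm_num : (-1 : ℝ) < 0) (by norm_num : (0 : ℝ) < 1)]
        with s hs using hψ s hs)
    refine HasDerivAt.congr_deriv h2 ?_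
    simp

/-- The map `g ↦ (L ↦ (v ↦ [L, g v]))`. -/
def commutatorL (E R : Type*) [NormedAddCommGroup E] [NormedSpace ℝ E] [NormedRing R]
    [NormedAlgebra ℝ R] : (E →L[ℝ] R) →L[ℝ] R →L[ℝ] E →L[ℝ] R :=
  ((ContinuousLinearMap.compL ℝ R (R →L[ℝ] R) (E →L[ℝ] R)).flip
    (ContinuousLinearMap.mul ℝ R - (ContinuousLinearMap.mul ℝ R).flip)).comp
    (ContinuousLinearMap.compL ℝ E R R).flip

theorem commutatorL_apply {R : Type*} [NormedRing R] [NormedAlgebra ℝ R] (g : E →L[ℝ] R) (L : R)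
    (v : E) : commutatorL E R g L v = L * g v - g v * L := rfl

/-- At the identity the inverse has derivative minus the increment, so conjugation differentiates to
a commutator. `Ring.inverse` avoids assuming that `Φ s` is a unit for every `s`. -/
theorem hasDerivAt_conj {R : Type*} [NormedRing R] [NormedAlgebra ℝ R] [CompleteSpace R]
    {Φ : ℝ → R} {g : R} (h0 : Φ 0 = 1) (hd : HasDerivAt Φ (-g) 0) (a : R) :
    HasDerivAt (fun s => Φ s * a * Ring.inverse (Φ s)) (a * g - g * a) 0 := by
  have h3 : HasDerivAt (fun s => Ring.inverse (Φ s)) g 0 := by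
    have h4 := hasFDerivAt_ringInverse (𝕜 := ℝ) (1 : Rˣ)
    rw [Units.val_one, ← h0] at h4
    refine (h4.comp_hasDerivAt 0 hd).congr_deriv ?_
    rw [neg_apply, ContinuousLinearMap.mulLeftRight_apply, inv_one, Units.val_one, one_mul,
      mul_one, neg_neg]
  refine ((hd.mul_const a).mul h3).congr_deriv ?_
  rw [h0, Ring.inverse_one, mul_one, one_mul, neg_mul, neg_add_eq_sub]

/-- Functions invariant under the transport by conjugation with generator `-G` solve the equation
of parallel endomorphism fields. -/
theorem contDiffOn_of_transport_conj {R : Type*} [NormedRing R] [NormedAlgebra ℝ R]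
    [CompleteSpace R] {N : Set E} {G : E → E →L[ℝ] R}
    (hN : IsOpen N) (hG : ContDiffOn ℝ ∞ G N) {ψ : E → R}
    (h : ∀ z₀ ∈ N, ∃ ε > 0, ∃ C, ∀ v : E, ‖v‖ < ε → ∃ Φ : ℝ → R,
      Φ 0 = 1 ∧ HasDerivAt Φ (-(G z₀ v)) 0 ∧ ‖Φ 1 - 1‖ ≤ C * ‖v‖ ∧
      ∀ s ∈ Set.Icc (-1 : ℝ) 1, ψ (z₀ + s • v) * Φ s = Φ s * ψ z₀) :
    ContDiffOn ℝ ∞ ψ N ∧ ∀ z ∈ N, ∃ ψ' : E →L[ℝ] R, HasFDerivAt ψ ψ' z ∧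
      ∀ v, ψ' v = ψ z * G z v - G z v * ψ z := by
  have hA : ContDiffOn ℝ ∞ (fun z => commutatorL E R (G z)) N :=
    contDiffOn_const.clm_apply hG
  have key := contDiffOn_of_hasLineDerivAt (ψ := ψ) (A := fun z => commutatorL E R (G z)) hN ?_
    hA ?_
  · exact ⟨key.1, fun z hz => ⟨_, key.2 z hz, fun v => rfl⟩⟩
  · intro z₀ hz₀
    refine ContinuousAt.continuousWithinAt ?_
    obtain ⟨ε, hε, C, hv⟩ := h z₀ hz₀
    choose! Φ _ _ hn hψ using hv
    have h0 := tendsto_one_of_norm_le hε hn z₀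
    have h1 : Filter.Tendsto (fun z => Ring.inverse (Φ (z - z₀) 1)) (𝓝 z₀) (𝓝 1) := by
      have := (NormedRing.inverse_continuousAt (1 : Rˣ)).tendsto.comp h0
      rw [Units.val_one, Ring.inverse_one] at this
      exact this
    have h2 := (h0.mul (tendsto_const_nhds (x := ψ z₀))).mul h1
    simp only [one_mul, mul_one] at h2
    refine h2.congr' ?_
    -- Near `z₀` the transport is close to 1, hence a unit, and the intertwining relation can be
    -- solved for `ψ z`.
    have hu : ∀ᶠ z in 𝓝 z₀, IsUnit (Φ (z - z₀) 1) :=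
      h0.eventually (Units.isOpen.mem_nhds isUnit_one)
    filter_upwards [Metric.ball_mem_nhds z₀ hε, hu] with z hz hu
    have := hψ (z - z₀) (by rwa [← mem_ball_iff_norm]) 1 (by norm_num)
    rw [← this, one_smul, add_sub_cancel, mul_assoc, Ring.mul_inverse_cancel _ hu, mul_one]
  · intro z hz
    obtain ⟨ε, hε, C, hv⟩ := h z hz
    refine HasLineDerivAt.of_forall_norm_lt hε fun v hvε => ?_
    obtain ⟨Φ, h0, hd, -, hψ⟩ := hv v hvε
    have h1 := hasDerivAt_conj h0 hd (ψ z)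
    have hu : ∀ᶠ s in 𝓝 (0 : ℝ), IsUnit (Φ s) :=
      hd.continuousAt.eventually (Units.isOpen.mem_nhds (by rw [h0]; exact isUnit_one))
    have h2 : HasDerivAt (fun s : ℝ => ψ (z + s • v)) _ 0 := h1.congr_of_eventuallyEq (by
      filter_upwards [Icc_mem_nhds (by norm_num : (-1 : ℝ) < 0) (by norm_num : (0 : ℝ) < 1), hu]
        with s hs hu
      rw [← hψ s hs, mul_assoc, Ring.mul_inverse_cancel _ hu, mul_one])
    refine HasDerivAt.congr_deriv h2 ?_
    rw [commutatorL_apply]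

end InvariantSolutions

/-! ### Invariant tensors are smooth and parallel -/

section InvariantTensors

variable {M : Type*} [TopologicalSpace M] [ChartedSpace E6 M] [IsManifold (𝓡 6) ∞ M]
  [RiemannianBundle (fun x : M => TangentSpace (𝓡 6) x)]
  [IsContMDiffRiemannianBundle (𝓡 6) ∞ E6 (fun x : M => TangentSpace (𝓡 6) x)]
  {J : OrthogonalACS M} {cov : AffineConnection M} {p : M} {N : Set E6}
  {G : E6 → E6 →L[ℝ] E6 →L[ℝ] E6}

/-- The vector field `ξ` is invariant under parallel transport. -/
def IsInvariantField (J : OrthogonalACS M) (cov : AffineConnection M)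
    (ξ : (x : M) → TangentSpace (𝓡 6) x) : Prop :=
  ∀ x y (P : TangentSpace (𝓡 6) x ≃ₗ[ℝ] TangentSpace (𝓡 6) y), IsReversibleTransport J cov P →
    P (ξ x) = ξ y

/-- The endomorphism field `L` is invariant under parallel transport. -/
def IsInvariantEndo (J : OrthogonalACS M) (cov : AffineConnection M)
    (L : (x : M) → TangentSpace (𝓡 6) x →L[ℝ] TangentSpace (𝓡 6) x) : Prop :=
  ∀ x y (P : TangentSpace (𝓡 6) x ≃ₗ[ℝ] TangentSpace (𝓡 6) y), IsReversibleTransport J cov P →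
    ∀ v, P (L x v) = L y (P v)

/-- In coordinates the transport along a segment is `Φ s`, so invariance is exactly the hypothesis
of `contDiffOn_of_transport_apply`. -/
theorem IsInvariantField.contDiffOn (hG : IsChristoffel cov p N G)
    (hJ : IsCharacteristicConnection J cov) (hT : HasParallelTorsion cov)
    {ξ : (x : M) → TangentSpace (𝓡 6) x} (hξ : IsInvariantField J cov ξ) :
    ContDiffOn ℝ ∞ (fun z => chartCoord p _ (ξ ((extChartAt (𝓡 6) p).symm z))) N ∧
      ∀ z ∈ N, HasFDerivAt (fun z => chartCoord p _ (ξ ((extChartAt (𝓡 6) p).symm z)))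
        (-(G z).flip (chartCoord p _ (ξ ((extChartAt (𝓡 6) p).symm z)))) z := by
  refine contDiffOn_of_transport_apply hG.isOpen hG.smooth fun z₀ hz₀ => ?_
  obtain ⟨ε, hε, C, h⟩ := exists_transport_line hG hJ hT hz₀
  refine ⟨ε, hε, C, fun v hv => ?_⟩
  obtain ⟨Φ, h0, hd, hn, hP⟩ := h v hv
  refine ⟨Φ, h0, hd, hn, fun s hs => ?_⟩
  obtain ⟨hN, P, hP, hPΦ⟩ := hP s hs
  have h1 := hPΦ (chartCoord p _ (ξ ((extChartAt (𝓡 6) p).symm z₀)))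
  rw [chartLift_chartCoord (symm_mem_source (hG.subset hz₀)), hξ _ _ P hP] at h1
  beta_reduce
  rw [h1, chartCoord_chartLift (symm_mem_source (hG.subset hN))]

theorem IsInvariantEndo.contDiffOn (hG : IsChristoffel cov p N G)
    (hJ : IsCharacteristicConnection J cov) (hT : HasParallelTorsion cov)
    {L : (x : M) → TangentSpace (𝓡 6) x →L[ℝ] TangentSpace (𝓡 6) x}
    (hL : IsInvariantEndo J cov L) :
    ContDiffOn ℝ ∞ (fun z => (chartCoord p ((extChartAt (𝓡 6) p).symm z)).comp
        ((L _).comp (chartLift p _))) N ∧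
      ∀ z ∈ N, ∃ ψ' : E6 →L[ℝ] E6 →L[ℝ] E6,
        HasFDerivAt (fun z => (chartCoord p ((extChartAt (𝓡 6) p).symm z)).comp
          ((L _).comp (chartLift p _))) ψ' z ∧
        ∀ v, ψ' v = (chartCoord p ((extChartAt (𝓡 6) p).symm z)).comp
            ((L _).comp (chartLift p _)) * G z v -
          G z v * (chartCoord p ((extChartAt (𝓡 6) p).symm z)).comp
            ((L _).comp (chartLift p _)) := by
  refine contDiffOn_of_transport_conj hG.isOpen hG.smooth fun z₀ hz₀ => ?_
  obtain ⟨ε, hε, C, h⟩ := exists_transport_line hG hJ hT hz₀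
  refine ⟨ε, hε, C, fun v hv => ?_⟩
  obtain ⟨Φ, h0, hd, hn, hP⟩ := h v hv
  refine ⟨Φ, h0, hd, hn, fun s hs => ?_⟩
  obtain ⟨hN, P, hP, hPΦ⟩ := hP s hs
  ext1 w
  have h1 := hL _ _ P hP (chartLift p _ w)
  rw [hPΦ, ← chartLift_chartCoord (symm_mem_source (hG.subset hz₀)) (L _ (chartLift p _ w)), hPΦ]
    at h1
  change chartCoord p _ (L _ (chartLift p _ (Φ s w))) = Φ s (chartCoord p _ (L _ (chartLift p _ w)))
  rw [← h1, chartCoord_chartLift (symm_mem_source (hG.subset hN))]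

theorem eventually_chartLift_chartCoord (p : M) (Y : (x : M) → TangentSpace (𝓡 6) x) :
    ∀ᶠ x in 𝓝 p, chartLift p x (chartCoord p _ (Y ((extChartAt (𝓡 6) p).symm
      (extChartAt (𝓡 6) p x)))) = Y x := by
  filter_upwards [extChartAt_source_mem_nhds (I := 𝓡 6) p] with x hx
  rw [(extChartAt (𝓡 6) p).left_inv hx, chartLift_chartCoord (by simpa using hx)]

variable [T2Space M]

theorem IsInvariantField.contMDiff (hJ : IsCharacteristicConnection J cov)
    (hT : HasParallelTorsion cov) {ξ : (x : M) → TangentSpace (𝓡 6) x}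
    (hξ : IsInvariantField J cov ξ) :
    ContMDiff (𝓡 6) (𝓡 6).tangent ∞ (fun x => (⟨x, ξ x⟩ : TangentBundle (𝓡 6) M)) := by
  intro p
  obtain ⟨N, G, hp, hG⟩ := exists_isChristoffel cov hJ.smooth p
  have h1 := ((hξ.contDiffOn hG hJ hT).1.contDiffAt (hG.isOpen.mem_nhds hp)).contMDiffAt.comp p
    (contMDiffAt_extChartAt (I := 𝓡 6) (n := ∞) (x := p))
  refine (contMDiffAt_chartLift (mem_chart_source E6 p) h1).congr_of_eventuallyEq ?_
  filter_upwards [eventually_chartLift_chartCoord p ξ] with x hx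
  exact congrArg _ hx.symm

/-- In coordinates the covariant derivative is the derivative plus the Christoffel term, and the
equation of `IsInvariantField.contDiffOn` says that these cancel. -/
theorem IsInvariantField.cov_eq_zero (hJ : IsCharacteristicConnection J cov)
    (hT : HasParallelTorsion cov) {ξ : (x : M) → TangentSpace (𝓡 6) x}
    (hξ : IsInvariantField J cov ξ) (p : M) (v : TangentSpace (𝓡 6) p) : cov ξ p v = 0 := by
  obtain ⟨N, G, hp, hG⟩ := exists_isChristoffel cov hJ.smooth p
  have h1 := hG.cov_chartLift hp ((hξ.contDiffOn hG hJ hT).2 _ hp) (chartCoord p p v)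
  rw [extChartAt_to_inv] at h1
  have h2 := cov_congr cov (isDiffAt_of_contMDiffAt (hξ.contMDiff hJ hT p))
    ((eventually_chartLift_chartCoord p ξ).mono fun _ h => h.symm)
  rw [h2, ← chartLift_chartCoord (mem_chart_source E6 p) v, h1]
  simp

theorem IsInvariantEndo.contMDiff (hJ : IsCharacteristicConnection J cov)
    (hT : HasParallelTorsion cov)
    {L : (x : M) → TangentSpace (𝓡 6) x →L[ℝ] TangentSpace (𝓡 6) x}
    (hL : IsInvariantEndo J cov L) :
    ContMDiff (𝓡 6) ((𝓡 6).prod 𝓘(ℝ, E6 →L[ℝ] E6)) ∞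
      (fun x => TotalSpace.mk' (E6 →L[ℝ] E6)
        (E := fun x : M => TangentSpace (𝓡 6) x →L[ℝ] TangentSpace (𝓡 6) x) x (L x)) := by
  intro p
  obtain ⟨N, G, hp, hG⟩ := exists_isChristoffel cov hJ.smooth p
  have h1 := ((hL.contDiffOn hG hJ hT).1.contDiffAt (hG.isOpen.mem_nhds hp)).contMDiffAt.comp p
    (contMDiffAt_extChartAt (I := 𝓡 6) (n := ∞) (x := p))
  refine (Trivialization.contMDiffAt_section_iff (s := L)
    (trivializationAt (E6 →L[ℝ] E6)
      (fun x : M => TangentSpace (𝓡 6) x →L[ℝ] TangentSpace (𝓡 6) x) p)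
    (mem_baseSet_trivializationAt _ _ p)).2 ?_
  refine h1.congr_of_eventuallyEq ?_
  filter_upwards [extChartAt_source_mem_nhds (I := 𝓡 6) p] with x hx
  rw [hom_trivializationAt_apply, Function.comp_apply, (extChartAt (𝓡 6) p).left_inv hx]
  rfl

/-- With `ψ` the matrix of `L`, its derivative is the commutator of `ψ` with the Christoffel term.
This turns the Christoffel term of `L Y` into `L` applied to that of `Y`. -/
theorem IsInvariantEndo.cov_apply (hJ : IsCharacteristicConnection J cov)
    (hT : HasParallelTorsion cov)
    {L : (x : M) → TangentSpace (𝓡 6) x →L[ℝ] TangentSpace (𝓡 6) x}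
    (hL : IsInvariantEndo J cov L) {p : M} {Y : (x : M) → TangentSpace (𝓡 6) x}
    (hY : IsDiffAt Y p) (v : TangentSpace (𝓡 6) p) :
    cov (fun x => L x (Y x)) p v = L p (cov Y p v) := by
  obtain ⟨N, G, hp, hG⟩ := exists_isChristoffel cov hJ.smooth p
  obtain ⟨-, hd⟩ := hL.contDiffOn hG hJ hT
  obtain ⟨ψ', hψ', hψv⟩ := hd _ hp
  have hps := mem_chart_source E6 p
  have hLY : IsDiffAt (fun x => L x (Y x)) p :=
    MDifferentiableAt.clm_bundle_apply ((hL.contMDiff hJ hT p).mdifferentiableAt (by simp)) hY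
  have hη : DifferentiableAt ℝ (fun z => chartCoord p _ (Y ((extChartAt (𝓡 6) p).symm z)))
      (extChartAt (𝓡 6) p p) := by
    have h1 : MDifferentiableAt (𝓡 6) 𝓘(ℝ, E6) (fun y => chartCoord p y (Y y))
        ((extChartAt (𝓡 6) p).symm (extChartAt (𝓡 6) p p)) := by
      rw [extChartAt_to_inv]
      exact hY.chartCoord hps
    have h2 := ((contMDiffOn_extChartAt_symm (I := 𝓡 6) (n := ∞) p).contMDiffAt
      ((isOpen_extChartAt_target p).mem_nhds (mem_extChartAt_target p))).mdifferentiableAt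
        (by simp)
    exact (h1.comp _ h2).differentiableAt
  have hη' := hη.hasFDerivAt
  have h1 := hG.cov_chartLift hp hη' (chartCoord p p v)
  have h2 := hG.cov_chartLift hp (hψ'.clm_apply hη') (chartCoord p p v)
  have e1 := cov_congr cov hY ((eventually_chartLift_chartCoord p Y).mono fun _ h => h.symm)
  have e2 : cov (fun x => L x (Y x)) p = cov (fun x => chartLift p x
      (((chartCoord p ((extChartAt (𝓡 6) p).symm (extChartAt (𝓡 6) p x))).comp
          ((L _).comp (chartLift p _))) (chartCoord p _ (Y ((extChartAt (𝓡 6) p).symm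
            (extChartAt (𝓡 6) p x)))))) p := by
    refine cov_congr cov hLY ?_
    filter_upwards [extChartAt_source_mem_nhds (I := 𝓡 6) p] with x hx
    have hx' : x ∈ (chartAt E6 p).source := by simpa using hx
    rw [(extChartAt (𝓡 6) p).left_inv hx]
    change _ = chartLift p x (chartCoord p x (L x (chartLift p x (chartCoord p x (Y x)))))
    rw [chartLift_chartCoord hx', chartLift_chartCoord hx']
  rw [extChartAt_to_inv] at h1 h2
  rw [e2, e1, ← chartLift_chartCoord hps v, h2, h1]
  have hψw : ∀ w u, ψ' w u = chartCoord p p (L p (chartLift p p (G (extChartAt (𝓡 6) p p) w u))) -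
      G (extChartAt (𝓡 6) p p) w (chartCoord p p (L p (chartLift p p u))) := by
    intro w u
    rw [hψv, extChartAt_to_inv]
    rfl
  rw [add_apply, ContinuousLinearMap.flip_apply, hψw]
  simp only [chartLift_chartCoord hps, ContinuousLinearMap.comp_apply, map_add, map_sub]
  abel

end InvariantTensors

/-! ### Holonomy-invariant data and the curvature identity -/

section Extension

variable {M : Type*} [TopologicalSpace M] [ChartedSpace E6 M] [IsManifold (𝓡 6) ∞ M]
  [RiemannianBundle (fun x : M => TangentSpace (𝓡 6) x)]
  [IsContMDiffRiemannianBundle (𝓡 6) ∞ E6 (fun x : M => TangentSpace (𝓡 6) x)]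
  {J : OrthogonalACS M} {cov : AffineConnection M}

/-- A linear endomorphism of a tangent space, as a continuous one. -/
def endoCLM {x y : M} (f : TangentSpace (𝓡 6) x →ₗ[ℝ] TangentSpace (𝓡 6) y) :
    TangentSpace (𝓡 6) x →L[ℝ] TangentSpace (𝓡 6) y :=
  have : FiniteDimensional ℝ (TangentSpace (𝓡 6) x) := inferInstanceAs (FiniteDimensional ℝ E6)
  LinearMap.toContinuousLinearMap f

@[simp]
theorem endoCLM_apply {x y : M} (f : TangentSpace (𝓡 6) x →ₗ[ℝ] TangentSpace (𝓡 6) y)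
    (v : TangentSpace (𝓡 6) x) : endoCLM f v = f v := rfl

/-- The path from `x` to `y` to `z` and back to `x` is a loop. Invariance under holonomy thus makes
the transported object independent of the chosen paths. -/
theorem IsReversibleTransport.holonomy_conj {x y z : M}
    {P : TangentSpace (𝓡 6) x ≃ₗ[ℝ] TangentSpace (𝓡 6) y}
    {Q : TangentSpace (𝓡 6) y ≃ₗ[ℝ] TangentSpace (𝓡 6) z}
    {R : TangentSpace (𝓡 6) x ≃ₗ[ℝ] TangentSpace (𝓡 6) z}
    (hP : IsReversibleTransport J cov P) (hQ : IsReversibleTransport J cov Q)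
    (hR : IsReversibleTransport J cov R) :
    ((P.trans Q).trans R.symm).toLinearMap ∈ holonomyGroup cov x :=
  ((hP.trans hQ).trans hR.symm).transport

theorem isInvariantField_of_holonomy {x : M} {P : (y : M) → TangentSpace (𝓡 6) x ≃ₗ[ℝ]
      TangentSpace (𝓡 6) y} (hP : ∀ y, IsReversibleTransport J cov (P y))
    {v : TangentSpace (𝓡 6) x} (hv : ∀ h ∈ holonomyGroup cov x, h v = v) :
    IsInvariantField J cov fun y => P y v := by
  intro y z Q hQ
  have := hv _ ((hP y).holonomy_conj hQ (hP z))
  rw [LinearEquiv.coe_coe, LinearEquiv.trans_apply, LinearEquiv.symm_apply_eq] at this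
  exact this

theorem isInvariantEndo_of_holonomy {x : M} {P : (y : M) → TangentSpace (𝓡 6) x ≃ₗ[ℝ]
      TangentSpace (𝓡 6) y} (hP : ∀ y, IsReversibleTransport J cov (P y))
    {L : TangentSpace (𝓡 6) x →ₗ[ℝ] TangentSpace (𝓡 6) x}
    (hL : ∀ h ∈ holonomyGroup cov x, ∀ v, h (L v) = L (h v)) :
    IsInvariantEndo J cov fun y =>
      endoCLM ((P y).toLinearMap ∘ₗ L ∘ₗ (P y).symm.toLinearMap) := by
  intro y z Q hQ v
  have := hL _ ((hP y).holonomy_conj hQ (hP z)) ((P y).symm v)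
  rw [LinearEquiv.coe_coe, LinearEquiv.trans_apply, LinearEquiv.symm_apply_eq] at this
  simpa using this

theorem IsInvariantField.torsion_endo {ξ : (x : M) → TangentSpace (𝓡 6) x}
    (hξ : IsInvariantField J cov ξ) : IsInvariantEndo J cov fun x => cov.torsion x (ξ x) := by
  intro x y P hP v
  rw [hP.map_torsion, hξ x y P hP]

theorem mlieBracket_eq {X Y : (x : M) → TangentSpace (𝓡 6) x} {x : M} (hX : IsDiffAt X x)
    (hY : IsDiffAt Y x) : VectorField.mlieBracket (𝓡 6) X Y x =
      cov Y x (X x) - cov X x (Y x) - cov.torsion x (X x) (Y x) := by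
  rw [cov.torsion_apply hX hY]
  abel

theorem cov_sub (cov : AffineConnection M) {X Y : (x : M) → TangentSpace (𝓡 6) x} {x : M}
    (hX : IsDiffAt X x) (hY : IsDiffAt Y x) :
    cov (fun y => X y - Y y) x = cov X x - cov Y x := by
  have h1 := cov.isCovariantDerivativeOnUniv.add
    (mdifferentiableAt_sub_section hX hY) hY
  rw [sub_add_cancel] at h1
  rw [h1, add_sub_cancel_right]
  rfl

variable [T2Space M]

/-- The curvature in the direction of two parallel fields whose bracket vanishes. -/
theorem cov_cov_sub_of_invariant (hJ : IsCharacteristicConnection J cov)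
    (hT : HasParallelTorsion cov) {ξ η : (x : M) → TangentSpace (𝓡 6) x}
    (hξ : IsInvariantField J cov ξ) (hη : IsInvariantField J cov η)
    (h0 : ∀ x, cov.torsion x (ξ x) (η x) = 0) {X : (x : M) → TangentSpace (𝓡 6) x}
    (hX : ContMDiff (𝓡 6) (𝓡 6).tangent ∞ (fun x => (⟨x, X x⟩ : TangentBundle (𝓡 6) M)))
    (x : M) :
    cov (fun y => cov X y (η y)) x (ξ x) - cov (fun y => cov X y (ξ y)) x (η x) =
      cov.torsion x (η x) (cov.torsion x (ξ x) (X x)) -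
        cov.torsion x (ξ x) (cov.torsion x (η x) (X x)) := by
  have : IsManifold (𝓡 6) (minSmoothness ℝ 3) M := by
    simpa using (inferInstance : IsManifold (𝓡 6) 3 M)
  have hcX : ContMDiff (𝓡 6) ((𝓡 6).prod 𝓘(ℝ, E6 →L[ℝ] E6)) ∞
      (fun x => TotalSpace.mk' (E6 →L[ℝ] E6)
        (E := fun x : M => TangentSpace (𝓡 6) x →L[ℝ] TangentSpace (𝓡 6) x) x (cov X x)) := by
    rw [← contMDiffOn_univ]
    exact hJ.smooth.contMDiff.contMDiff (by simpa using hX.contMDiffOn)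
  have hdX : ∀ x, IsDiffAt X x := fun x => isDiffAt_of_contMDiffAt (hX x)
  have hd : ∀ {ζ : (x : M) → TangentSpace (𝓡 6) x}, IsInvariantField J cov ζ →
      ∀ x, IsDiffAt ζ x ∧ IsDiffAt (fun y => cov X y (ζ y)) x ∧
        IsDiffAt (fun y => cov.torsion y (ζ y) (X y)) x := by
    intro ζ hζ x
    have h1 := hζ.contMDiff hJ hT x
    exact ⟨isDiffAt_of_contMDiffAt h1, isDiffAt_of_contMDiffAt ((hcX x).clm_bundle_apply h1),
      isDiffAt_of_contMDiffAt ((hζ.torsion_endo.contMDiff hJ hT x).clm_bundle_apply (hX x))⟩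
  -- For parallel `ζ` one of the two covariant derivatives in the bracket drops out: [ζ, X] = ∇_ζ X
  -- - T(ζ, X).
  have hbr : ∀ {ζ : (x : M) → TangentSpace (𝓡 6) x}, IsInvariantField J cov ζ →
      VectorField.mlieBracket (𝓡 6) ζ X = fun y => cov X y (ζ y) - cov.torsion y (ζ y) (X y) := by
    intro ζ hζ
    ext1 y
    rw [mlieBracket_eq (cov := cov) (hd hζ y).1 (hdX y), hζ.cov_eq_zero hJ hT, sub_zero]
  have hbr2 : ∀ {ζ θ : (x : M) → TangentSpace (𝓡 6) x}, IsInvariantField J cov ζ →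
      IsInvariantField J cov θ →
      VectorField.mlieBracket (𝓡 6) θ (VectorField.mlieBracket (𝓡 6) ζ X) x =
        cov (fun y => cov X y (ζ y)) x (θ x) - cov.torsion x (ζ x) (cov X x (θ x)) -
          (cov.torsion x (θ x) (cov X x (ζ x)) -
            cov.torsion x (θ x) (cov.torsion x (ζ x) (X x))) := by
    intro ζ θ hζ hθ
    rw [hbr hζ, mlieBracket_eq (cov := cov)
      (Y := fun y => cov X y (ζ y) - cov.torsion y (ζ y) (X y)) (hd hθ x).1
      (mdifferentiableAt_sub_section (hd hζ x).2.1 (hd hζ x).2.2), hθ.cov_eq_zero hJ hT,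
      sub_zero, cov_sub cov (hd hζ x).2.1 (hd hζ x).2.2, sub_apply,
      hζ.torsion_endo.cov_apply hJ hT (hdX x), map_sub]
  have hbr0 : VectorField.mlieBracket (𝓡 6) ξ η = fun _ => 0 := by
    ext1 y
    rw [mlieBracket_eq (cov := cov) (hd hξ y).1 (hd hη y).1, hξ.cov_eq_zero hJ hT,
      hη.cov_eq_zero hJ hT, h0, sub_zero, sub_zero]
  have hs : ∀ {ζ : (x : M) → TangentSpace (𝓡 6) x},
      ContMDiffAt (𝓡 6) (𝓡 6).tangent ∞ (fun x => (⟨x, ζ x⟩ : TangentBundle (𝓡 6) M)) x →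
      ContMDiffAt (𝓡 6) (𝓡 6).tangent (minSmoothness ℝ 2)
        (fun x => (⟨x, ζ x⟩ : TangentBundle (𝓡 6) M)) x := fun h =>
    h.of_le (by simpa using (by exact_mod_cast le_top : ((2 : ℕ∞) : ℕ∞ω) ≤ ∞))
  -- Jacobi identity for `ξ`, `η`, `X` with [ξ, η] = 0. The mixed terms T(ξ, ∇_η X) and T(η, ∇_ξ X)
  -- occur on both sides and cancel, leaving the curvature and the commutator of the torsions.
  have key := VectorField.leibniz_identity_mlieBracket_apply (I := 𝓡 6)
    (hs (hξ.contMDiff hJ hT x)) (hs (hη.contMDiff hJ hT x)) (hs (hX x))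
  have hz : VectorField.mlieBracket (𝓡 6) (fun y : M => (0 : TangentSpace (𝓡 6) y)) X x = 0 := by
    have := VectorField.mlieBracket_zero_left (I := 𝓡 6) (W := X)
    exact congrFun this x
  rw [hbr2 hη hξ, hbr2 hξ hη, hbr0, hz, zero_add] at key
  have e : ∀ a b c d e h : TangentSpace (𝓡 6) x,
      a - b - (c - d) = e - c - (b - h) → a - e = h - d := by
    intro a b c d e h he
    have : a - e = (a - b - (c - d)) - (e - c - (b - h)) + (h - d) := by abel
    rw [this, he, sub_self, zero_add]
  exact e _ _ _ _ _ _ key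

/-- If the parallel fields `ξ`, `η` satisfy `T(ξ,η) = 0`, then the commutator of `T(ξ,·)` and
`T(η,·)` commutes with the parallel endomorphisms. -/
theorem torsion_commutator_commute (hJ : IsCharacteristicConnection J cov)
    (hT : HasParallelTorsion cov) {ξ η : (x : M) → TangentSpace (𝓡 6) x}
    (hξ : IsInvariantField J cov ξ) (hη : IsInvariantField J cov η)
    (h0 : ∀ x, cov.torsion x (ξ x) (η x) = 0)
    {L : (x : M) → TangentSpace (𝓡 6) x →L[ℝ] TangentSpace (𝓡 6) x}
    (hL : IsInvariantEndo J cov L) (x : M) (v : TangentSpace (𝓡 6) x) :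
    cov.torsion x (η x) (cov.torsion x (ξ x) (L x v)) -
        cov.torsion x (ξ x) (cov.torsion x (η x) (L x v)) =
      L x (cov.torsion x (η x) (cov.torsion x (ξ x) v) -
        cov.torsion x (ξ x) (cov.torsion x (η x) v)) := by
  obtain ⟨X, hX, hXv⟩ := exists_global_frame x (chartCoord x x v)
  have hXx : X x = v := by
    rw [hXv.self_of_nhds, chartLift_chartCoord (mem_chart_source E6 x)]
  have hLX : ContMDiff (𝓡 6) (𝓡 6).tangent ∞
      (fun x => (⟨x, L x (X x)⟩ : TangentBundle (𝓡 6) M)) := fun y =>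
    (hL.contMDiff hJ hT y).clm_bundle_apply (hX y)
  have hcX : ContMDiff (𝓡 6) ((𝓡 6).prod 𝓘(ℝ, E6 →L[ℝ] E6)) ∞
      (fun x => TotalSpace.mk' (E6 →L[ℝ] E6)
        (E := fun x : M => TangentSpace (𝓡 6) x →L[ℝ] TangentSpace (𝓡 6) x) x (cov X x)) := by
    rw [← contMDiffOn_univ]
    exact hJ.smooth.contMDiff.contMDiff (by simpa using hX.contMDiffOn)
  have hdc : ∀ {ζ : (x : M) → TangentSpace (𝓡 6) x}, IsInvariantField J cov ζ →
      IsDiffAt (fun y => cov X y (ζ y)) x := fun hζ =>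
    isDiffAt_of_contMDiffAt ((hcX x).clm_bundle_apply (hζ.contMDiff hJ hT x))
  have h1 := cov_cov_sub_of_invariant hJ hT hξ hη h0 hX x
  have h2 := cov_cov_sub_of_invariant hJ hT hξ hη h0 hLX x
  -- `L` passes through both covariant derivatives, i.e. it commutes with the curvature.
  simp only [hL.cov_apply hJ hT (isDiffAt_of_contMDiffAt (hX _)), hL.cov_apply hJ hT (hdc hξ),
    hL.cov_apply hJ hT (hdc hη)] at h2
  rw [hXx] at h1 h2
  rw [← h2, ← h1, map_sub]

end Extension

/-! ### Quaternions on a frame and SU(2)-invariant 3-forms -/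

section LinearAlgebra

variable {V : Type*} [NormedAddCommGroup V] [InnerProductSpace ℝ V]
  (e : OrthonormalBasis (Fin 6) ℝ V)

/-- The endomorphism `a I₁ + b I₂ + c I₃` of the first four coordinates, where `I₁, I₂, I₃` is the
standard quaternionic triple, plus `d` times the rotation in the last two coordinates. -/
def frameEndo (a b c d : ℝ) : V →ₗ[ℝ] V :=
  e.toBasis.constr ℝ ![a • e 1 + b • e 2 + c • e 3, -a • e 0 + c • e 2 - b • e 3,
    -b • e 0 - c • e 1 + a • e 3, -c • e 0 + b • e 1 - a • e 2, d • e 5, -d • e 4]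

/-- The action of the unit quaternion with coordinates `c₀, c₁, c₂, c₃`, which commutes with
`I₁, I₂, I₃`. -/
def su2Endo (c₀ c₁ c₂ c₃ : ℝ) : V →ₗ[ℝ] V :=
  e.toBasis.constr ℝ ![c₀ • e 0 + c₁ • e 1 + c₂ • e 2 + c₃ • e 3,
    -c₁ • e 0 + c₀ • e 1 - c₃ • e 2 + c₂ • e 3, -c₂ • e 0 + c₃ • e 1 + c₀ • e 2 - c₁ • e 3,
    -c₃ • e 0 - c₂ • e 1 + c₁ • e 2 + c₀ • e 3, e 4, e 5]

theorem constr_apply_frame (f : Fin 6 → V) (i : Fin 6) : e.toBasis.constr ℝ f (e i) = f i := by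
  rw [← e.coe_toBasis, Module.Basis.constr_basis]

theorem frame_expand (v : V) : v = e.repr v 0 • e 0 + e.repr v 1 • e 1 + e.repr v 2 • e 2 +
    e.repr v 3 • e 3 + e.repr v 4 • e 4 + e.repr v 5 • e 5 := by
  conv_lhs => rw [← e.sum_repr v, Fin.sum_univ_six]

section Values

variable (a b c d : ℝ)

theorem frameEndo_zero : frameEndo e a b c d (e 0) = a • e 1 + b • e 2 + c • e 3 :=
  constr_apply_frame e _ 0

theorem frameEndo_one : frameEndo e a b c d (e 1) = -a • e 0 + c • e 2 - b • e 3 :=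
  constr_apply_frame e _ 1

theorem frameEndo_two : frameEndo e a b c d (e 2) = -b • e 0 - c • e 1 + a • e 3 :=
  constr_apply_frame e _ 2

theorem frameEndo_three : frameEndo e a b c d (e 3) = -c • e 0 + b • e 1 - a • e 2 :=
  constr_apply_frame e _ 3

theorem frameEndo_four : frameEndo e a b c d (e 4) = d • e 5 :=
  constr_apply_frame e _ 4

theorem frameEndo_five : frameEndo e a b c d (e 5) = -d • e 4 :=
  constr_apply_frame e _ 5

theorem su2Endo_zero : su2Endo e a b c d (e 0) = a • e 0 + b • e 1 + c • e 2 + d • e 3 :=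
  constr_apply_frame e _ 0

theorem su2Endo_one : su2Endo e a b c d (e 1) = -b • e 0 + a • e 1 - d • e 2 + c • e 3 :=
  constr_apply_frame e _ 1

theorem su2Endo_two : su2Endo e a b c d (e 2) = -c • e 0 + d • e 1 + a • e 2 - b • e 3 :=
  constr_apply_frame e _ 2

theorem su2Endo_three : su2Endo e a b c d (e 3) = -d • e 0 - c • e 1 + b • e 2 + a • e 3 :=
  constr_apply_frame e _ 3

theorem su2Endo_four : su2Endo e a b c d (e 4) = e 4 :=
  constr_apply_frame e _ 4

theorem su2Endo_five : su2Endo e a b c d (e 5) = e 5 :=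
  constr_apply_frame e _ 5

theorem repr_frameEndo (v : V) : e.repr (frameEndo e a b c d v) =
    !₂[-a * e.repr v 1 - b * e.repr v 2 - c * e.repr v 3,
      a * e.repr v 0 + b * e.repr v 3 - c * e.repr v 2,
      -a * e.repr v 3 + b * e.repr v 0 + c * e.repr v 1,
      a * e.repr v 2 - b * e.repr v 1 + c * e.repr v 0, -d * e.repr v 5, d * e.repr v 4] := by
  conv_lhs => rw [frame_expand e v]
  simp only [map_add, map_smul, frameEndo_zero, frameEndo_one, frameEndo_two, frameEndo_three,
    frameEndo_four, frameEndo_five, map_sub, e.repr_self]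
  ext i
  fin_cases i <;> simp <;> ring

theorem repr_su2Endo (v : V) : e.repr (su2Endo e a b c d v) =
    !₂[a * e.repr v 0 - b * e.repr v 1 - c * e.repr v 2 - d * e.repr v 3,
      b * e.repr v 0 + a * e.repr v 1 + d * e.repr v 2 - c * e.repr v 3,
      c * e.repr v 0 - d * e.repr v 1 + a * e.repr v 2 + b * e.repr v 3,
      d * e.repr v 0 + c * e.repr v 1 - b * e.repr v 2 + a * e.repr v 3,
      e.repr v 4, e.repr v 5] := by
  conv_lhs => rw [frame_expand e v]
  simp only [map_add, map_smul, su2Endo_zero, su2Endo_one, su2Endo_two, su2Endo_three,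
    su2Endo_four, su2Endo_five, map_sub, e.repr_self]
  ext i
  fin_cases i <;> simp <;> ring

end Values

theorem inner_eq_coords (v w : V) : (inner ℝ v w : ℝ) = e.repr v 0 * e.repr w 0 +
    e.repr v 1 * e.repr w 1 + e.repr v 2 * e.repr w 2 + e.repr v 3 * e.repr w 3 +
    e.repr v 4 * e.repr w 4 + e.repr v 5 * e.repr w 5 := by
  rw [← e.repr.inner_map_map, PiLp.inner_apply, Fin.sum_univ_six]
  simp [mul_comm]

theorem inner_frame (i : Fin 6) (v : V) : (inner ℝ (e i) v : ℝ) = e.repr v i :=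
  (e.repr_apply_apply v i).symm

theorem su2Endo_frameEndo_comm (c₀ c₁ c₂ c₃ a b c d : ℝ) (v : V) :
    su2Endo e c₀ c₁ c₂ c₃ (frameEndo e a b c d v) =
      frameEndo e a b c d (su2Endo e c₀ c₁ c₂ c₃ v) := by
  apply e.repr.injective
  simp only [repr_su2Endo, repr_frameEndo]
  ext i
  fin_cases i <;> simp <;> ring

theorem inner_su2Endo {c₀ c₁ c₂ c₃ : ℝ} (h : c₀ ^ 2 + c₁ ^ 2 + c₂ ^ 2 + c₃ ^ 2 = 1) (v w : V) :
    (inner ℝ (su2Endo e c₀ c₁ c₂ c₃ v) (su2Endo e c₀ c₁ c₂ c₃ w) : ℝ) = inner ℝ v w := by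
  simp only [inner_eq_coords e, repr_su2Endo]
  simp
  linear_combination (e.repr v 0 * e.repr w 0 + e.repr v 1 * e.repr w 1 + e.repr v 2 * e.repr w 2 +
    e.repr v 3 * e.repr w 3) * h

theorem inner_frameEndo_left (a b c d : ℝ) (v w : V) :
    (inner ℝ (frameEndo e a b c d v) w : ℝ) = -inner ℝ v (frameEndo e a b c d w) := by
  simp only [inner_eq_coords e, repr_frameEndo]
  simp
  ring

theorem frameEndo_frameEndo {a b c : ℝ} (h : a ^ 2 + b ^ 2 + c ^ 2 = 1) (v : V) :
    frameEndo e a b c 1 (frameEndo e a b c 1 v) = -v := by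
  apply e.repr.injective
  simp only [repr_frameEndo, map_neg]
  ext i
  fin_cases i <;> simp
  · linear_combination -(e.repr v 0) * h
  · linear_combination -(e.repr v 1) * h
  · linear_combination -(e.repr v 2) * h
  · linear_combination -(e.repr v 3) * h

theorem inner_frameEndo_frameEndo {a b c : ℝ} (h : a ^ 2 + b ^ 2 + c ^ 2 = 1) (v w : V) :
    (inner ℝ (frameEndo e a b c 1 v) (frameEndo e a b c 1 w) : ℝ) = inner ℝ v w := by
  rw [inner_frameEndo_left, frameEndo_frameEndo e h, inner_neg_right, neg_neg]

/-- An isometry which fixes the last two vectors of the frame and commutes with the quaternionic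
triple is the action of a unit quaternion. -/
theorem exists_eq_su2Endo {f : V →ₗ[ℝ] V} (hf : ∀ v w, (inner ℝ (f v) (f w) : ℝ) = inner ℝ v w)
    (h4 : f (e 4) = e 4) (h5 : f (e 5) = e 5)
    (hc : ∀ a b c v, f (frameEndo e a b c 0 v) = frameEndo e a b c 0 (f v)) :
    ∃ c₀ c₁ c₂ c₃ : ℝ, c₀ ^ 2 + c₁ ^ 2 + c₂ ^ 2 + c₃ ^ 2 = 1 ∧ f = su2Endo e c₀ c₁ c₂ c₃ := by
  -- `f` is an isometry fixing `e 4` and `e 5`, so `f (e 0)` is orthogonal to both.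
  have k4 : e.repr (f (e 0)) 4 = 0 := by
    rw [← inner_frame, ← h4, hf]
    simp [e.inner_eq_ite]
  have k5 : e.repr (f (e 0)) 5 = 0 := by
    rw [← inner_frame, ← h5, hf]
    simp [e.inner_eq_ite]
  have h0 := frame_expand e (f (e 0))
  rw [k4, k5, zero_smul, zero_smul, add_zero, add_zero] at h0
  set c₀ := e.repr (f (e 0)) 0
  set c₁ := e.repr (f (e 0)) 1
  set c₂ := e.repr (f (e 0)) 2
  set c₃ := e.repr (f (e 0)) 3
  have hn := hf (e 0) (e 0)
  rw [inner_eq_coords e (f (e 0)), k4, k5, e.inner_eq_one] at hn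
  -- The triple carries `e 0` to `e 1`, `e 2`, `e 3`, so a map commuting with it is determined on
  -- the quaternionic part by `f (e 0)`.
  have i1 : frameEndo e 1 0 0 0 (e 0) = e 1 := by simp [frameEndo_zero]
  have i2 : frameEndo e 0 1 0 0 (e 0) = e 2 := by simp [frameEndo_zero]
  have i3 : frameEndo e 0 0 1 0 (e 0) = e 3 := by simp [frameEndo_zero]
  refine ⟨c₀, c₁, c₂, c₃, by linear_combination hn, e.toBasis.ext fun i => ?_⟩
  have e1 : f (e 1) = su2Endo e c₀ c₁ c₂ c₃ (e 1) := by
    rw [← i1, hc, su2Endo_frameEndo_comm, su2Endo_zero, ← h0]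
  have e2 : f (e 2) = su2Endo e c₀ c₁ c₂ c₃ (e 2) := by
    rw [← i2, hc, su2Endo_frameEndo_comm, su2Endo_zero, ← h0]
  have e3 : f (e 3) = su2Endo e c₀ c₁ c₂ c₃ (e 3) := by
    rw [← i3, hc, su2Endo_frameEndo_comm, su2Endo_zero, ← h0]
  rw [e.coe_toBasis]
  fin_cases i
  · exact h0.trans (su2Endo_zero e _ _ _ _).symm
  · exact e1
  · exact e2
  · exact e3
  · exact h4.trans (su2Endo_four e _ _ _ _).symm
  · exact h5.trans (su2Endo_five e _ _ _ _).symm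

/-- The 3-form `ω ∧ ζ` for the 2-form `ω = ⟨L ·, ·⟩`. -/
def wedgeForm (L : V →ₗ[ℝ] V) (ζ X Y Z : V) : ℝ :=
  inner ℝ (L X) Y * inner ℝ ζ Z + inner ℝ (L Y) Z * inner ℝ ζ X + inner ℝ (L Z) X * inner ℝ ζ Y

theorem normalForm_eq_wedgeForm (α₁ α₅ : ℝ) (X Y Z : V) :
    normalForm α₁ α₅ (e.repr X) (e.repr Y) (e.repr Z) =
      wedgeForm (frameEndo e α₅ 0 α₁ 0) (e 4) X Y Z := by
  simp only [wedgeForm, inner_frame, inner_eq_coords e (frameEndo e _ _ _ _ _), repr_frameEndo,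
    normalForm, wedge3, Matrix.det_fin_three]
  simp
  ring

/-- The rotation of the last plane contributes e₅₆ ∧ e₅ = 0. Hence the Kähler form can replace ω₁ in
the torsion. -/
theorem wedgeForm_frameEndo_one (X Y Z : V) :
    wedgeForm (frameEndo e 1 0 0 1) (e 4) X Y Z = wedgeForm (frameEndo e 1 0 0 0) (e 4) X Y Z := by
  simp only [wedgeForm, inner_frame, inner_eq_coords e (frameEndo e _ _ _ _ _), repr_frameEndo]
  simp
  ring

theorem wedgeForm_su2Endo {c₀ c₁ c₂ c₃ : ℝ} (h : c₀ ^ 2 + c₁ ^ 2 + c₂ ^ 2 + c₃ ^ 2 = 1)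
    (a b c d : ℝ) (X Y Z : V) :
    wedgeForm (frameEndo e a b c d) (e 4) (su2Endo e c₀ c₁ c₂ c₃ X) (su2Endo e c₀ c₁ c₂ c₃ Y)
      (su2Endo e c₀ c₁ c₂ c₃ Z) = wedgeForm (frameEndo e a b c d) (e 4) X Y Z := by
  have h4 := fun v => inner_su2Endo e h (e 4) v
  simp only [su2Endo_four] at h4
  simp only [wedgeForm, ← su2Endo_frameEndo_comm, inner_su2Endo e h, h4]

/-- The trilinear forms which are invariant under `SU(2)`. -/
theorem exists_eq_wedgeForm {T : V →ₗ[ℝ] V →ₗ[ℝ] V →ₗ[ℝ] ℝ} (hs : ∀ X Y Z, T X Y Z = -T Y X Z)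
    (hs' : ∀ X Y Z, T X Y Z = -T X Z Y)
    (hT : ∀ c₀ c₁ c₂ c₃ : ℝ, c₀ ^ 2 + c₁ ^ 2 + c₂ ^ 2 + c₃ ^ 2 = 1 → ∀ X Y Z,
      T (su2Endo e c₀ c₁ c₂ c₃ X) (su2Endo e c₀ c₁ c₂ c₃ Y) (su2Endo e c₀ c₁ c₂ c₃ Z) = T X Y Z) :
    ∃ a₁ a₂ a₃ b₁ b₂ b₃ : ℝ, ∀ X Y Z, T X Y Z =
      wedgeForm (frameEndo e a₁ a₂ a₃ 0) (e 4) X Y Z +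
        wedgeForm (frameEndo e b₁ b₂ b₃ 0) (e 5) X Y Z := by
  let pr : V → V := fun v => e.repr v 0 • e 0 + e.repr v 1 • e 1 + e.repr v 2 • e 2 +
    e.repr v 3 • e 3
  have hpr : ∀ v, v = pr v + e.repr v 4 • e 4 + e.repr v 5 • e 5 := fun v => frame_expand e v
  have hneg : ∀ v, su2Endo e (-1) 0 0 0 (pr v) = -pr v := fun v => by
    simp only [pr, map_add, map_smul, su2Endo_zero, su2Endo_one, su2Endo_two, su2Endo_three]
    module
  -- -1 ∈ SU(2) changes the sign of every value with an odd number of arguments in the quaternionic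
  -- part.
  have hm := hT (-1) 0 0 0 (by norm_num)
  have h444 : ∀ X Y Z, T (pr X) (pr Y) (pr Z) = 0 := by
    intro X Y Z
    have := hm (pr X) (pr Y) (pr Z)
    simp only [hneg, map_neg, LinearMap.neg_apply] at this
    linarith
  have h4 : ∀ X, T (pr X) (e 4) (e 5) = 0 := by
    intro X
    have := hm (pr X) (e 4) (e 5)
    simp only [hneg, su2Endo_four, su2Endo_five, map_neg, LinearMap.neg_apply] at this
    linarith
  have hd1 : ∀ X Z, T X X Z = 0 := fun X Z => by linarith [hs X X Z]
  have hd2 : ∀ X Z, T Z X X = 0 := fun X Z => by linarith [hs' Z X X]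
  have hd3 : ∀ X Z, T X Z X = 0 := fun X Z => by rw [hs', hd1, neg_zero]
  have hk : ∀ k, su2Endo e 0 1 0 0 (e k) = e k → su2Endo e 0 0 (-1) 0 (e k) = e k →
      ∀ X Y, T (pr X) (pr Y) (e k) =
        inner ℝ (frameEndo e (T (e 0) (e 1) (e k)) (T (e 0) (e 2) (e k))
          (T (e 0) (e 3) (e k)) 0 X) Y := by
    intro k hk1 hk2 X Y
    -- Invariance under two unit quaternions suffices: it expresses the values on the pairs (2,3),
    -- (1,3), (1,2) through those on (0,1), (0,2), (0,3).
    have hi := hT 0 1 0 0 (by norm_num)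
    have hj := hT 0 0 (-1) 0 (by norm_num)
    have r1 := hi (e 0) (e 2) (e k)
    have r2 := hi (e 0) (e 3) (e k)
    have r3 := hj (e 0) (e 1) (e k)
    simp only [hk1, hk2, su2Endo_zero, su2Endo_one, su2Endo_two, su2Endo_three, zero_smul,
      one_smul, neg_smul, neg_zero, neg_neg, zero_add, add_zero, zero_sub, sub_zero, map_neg,
      LinearMap.neg_apply] at r1 r2 r3
    simp only [pr, map_add, map_smul, LinearMap.add_apply, LinearMap.smul_apply, smul_eq_mul, hd1,
      hs (e 1) (e 0), hs (e 2) (e 0), hs (e 3) (e 0), hs (e 2) (e 1), hs (e 3) (e 1),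
      hs (e 3) (e 2), inner_eq_coords e (frameEndo e _ _ _ _ _), repr_frameEndo]
    simp
    rw [← r1, ← r3, ← r2]
    ring
  refine ⟨T (e 0) (e 1) (e 4), T (e 0) (e 2) (e 4), T (e 0) (e 3) (e 4), T (e 0) (e 1) (e 5),
    T (e 0) (e 2) (e 5), T (e 0) (e 3) (e 5), fun X Y Z => ?_⟩
  have k4 := hk 4 (su2Endo_four e _ _ _ _) (su2Endo_four e _ _ _ _)
  have k5 := hk 5 (su2Endo_five e _ _ _ _) (su2Endo_five e _ _ _ _)
  have c1 : ∀ k X Y, T (pr X) (e k) (pr Y) = -T (pr X) (pr Y) (e k) := fun k X Y => hs' _ _ _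
  have c2 : ∀ k X Y, T (e k) (pr X) (pr Y) = T (pr X) (pr Y) (e k) := fun k X Y => by
    rw [hs, hs', neg_neg]
  have c3 : ∀ X, T (pr X) (e 5) (e 4) = 0 := fun X => by rw [hs', h4, neg_zero]
  have c4 : ∀ X, T (e 4) (pr X) (e 5) = 0 := fun X => by rw [hs, h4, neg_zero]
  have c5 : ∀ X, T (e 5) (pr X) (e 4) = 0 := fun X => by rw [hs, c3, neg_zero]
  have c6 : ∀ X, T (e 4) (e 5) (pr X) = 0 := fun X => by rw [hs', c4, neg_zero]
  have c7 : ∀ X, T (e 5) (e 4) (pr X) = 0 := fun X => by rw [hs', c5, neg_zero]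
  have hZ : ∀ a b c, (inner ℝ (frameEndo e a b c 0 Z) X : ℝ) =
      -inner ℝ (frameEndo e a b c 0 X) Z := fun a b c => by
    rw [inner_frameEndo_left, real_inner_comm]
  conv_lhs => rw [hpr X, hpr Y, hpr Z]
  simp only [map_add, map_smul, LinearMap.add_apply, LinearMap.smul_apply, smul_eq_mul, hd1, hd2,
    hd3, h444, h4, c1, c2, c3, c4, c5, c6, c7, k4, k5, wedgeForm, inner_frame,
    hZ]
  ring

end LinearAlgebra

/-! ### Rotating the quaternionic triple -/

section FrameChange

/-- `q, p, m` are the rows of a rotation matrix; the orthogonality of the columns is recorded for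
the first column only. -/
structure IsRotation (q p m : Fin 3 → ℝ) : Prop where
  qq : q 0 ^ 2 + q 1 ^ 2 + q 2 ^ 2 = 1
  pp : p 0 ^ 2 + p 1 ^ 2 + p 2 ^ 2 = 1
  mm : m 0 ^ 2 + m 1 ^ 2 + m 2 ^ 2 = 1
  qp : q 0 * p 0 + q 1 * p 1 + q 2 * p 2 = 0
  qm : q 0 * m 0 + q 1 * m 1 + q 2 * m 2 = 0
  pm : p 0 * m 0 + p 1 * m 1 + p 2 * m 2 = 0
  m0 : m 0 = q 1 * p 2 - q 2 * p 1
  m1 : m 1 = q 2 * p 0 - q 0 * p 2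
  m2 : m 2 = q 0 * p 1 - q 1 * p 0
  q0 : q 0 = p 1 * m 2 - p 2 * m 1
  q1 : q 1 = p 2 * m 0 - p 0 * m 2
  q2 : q 2 = p 0 * m 1 - p 1 * m 0
  p0 : p 0 = m 1 * q 2 - m 2 * q 1
  p1 : p 1 = m 2 * q 0 - m 0 * q 2
  p2 : p 2 = m 0 * q 1 - m 1 * q 0
  c0 : q 0 * q 0 + p 0 * p 0 + m 0 * m 0 = 1
  c1 : q 0 * q 1 + p 0 * p 1 + m 0 * m 1 = 0
  c2 : q 0 * q 2 + p 0 * p 2 + m 0 * m 2 = 0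

theorem exists_polar (x y : ℝ) : ∃ n a b : ℝ, 0 ≤ n ∧ a ^ 2 + b ^ 2 = 1 ∧ x = n * a ∧ y = n * b := by
  by_cases h : x ^ 2 + y ^ 2 = 0
  · have hx : x = 0 := by nlinarith [sq_nonneg x, sq_nonneg y]
    have hy : y = 0 := by nlinarith [sq_nonneg x, sq_nonneg y]
    exact ⟨0, 1, 0, le_rfl, by norm_num, by simpa using hx, by simpa using hy⟩
  · have hp : 0 < x ^ 2 + y ^ 2 := lt_of_le_of_ne (by positivity) (Ne.symm h)
    have hs := Real.sqrt_pos.2 hp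
    refine ⟨√(x ^ 2 + y ^ 2), x / √(x ^ 2 + y ^ 2), y / √(x ^ 2 + y ^ 2), hs.le, ?_, ?_, ?_⟩
    · rw [div_pow, div_pow, Real.sq_sqrt hp.le, ← add_div, div_self h]
    · field_simp
    · field_simp

/-- The freedom to turn `p`, `m` around `q` is spent on `p 0 = 0`, which removes the I₂-coefficient
from the torsion; the sign `σ` will be absorbed by turning the last plane by π. -/
theorem exists_isRotation (q : Fin 3 → ℝ) (hq : q 0 ^ 2 + q 1 ^ 2 + q 2 ^ 2 = 1) :
    ∃ (p m : Fin 3 → ℝ) (σ : ℝ), IsRotation q p m ∧ σ ^ 2 = 1 ∧ p 0 = 0 ∧ 0 ≤ σ * q 0 ∧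
      0 ≤ σ * m 0 := by
  obtain ⟨n, a, b, hn, hab, h1, h2⟩ := exists_polar (q 1) (q 2)
  obtain ⟨σ, hσ, hσq⟩ : ∃ σ : ℝ, σ ^ 2 = 1 ∧ 0 ≤ σ * q 0 := by
    rcases le_total 0 (q 0) with h | h
    · exact ⟨1, by norm_num, by linarith⟩
    · exact ⟨-1, by norm_num, by linarith⟩
  have hqn : q 0 ^ 2 + n ^ 2 = 1 := by
    rw [h1, h2] at hq
    linear_combination hq - n ^ 2 * hab
  -- With `(q 1, q 2) = n (a, b)`, the vector (0, -b, a) is orthogonal to both `q` and the first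
  -- axis, and `m` is forced to be `q × p`. Then `σ * m 0 = n ≥ 0`.
  refine ⟨![0, -σ * b, σ * a], ![σ * n, -σ * q 0 * a, -σ * q 0 * b], σ, ?_, hσ, rfl, hσq, ?_⟩
  · constructor <;> (try simp) <;> (try rw [h1]) <;> (try rw [h2]) <;> grind
  · change 0 ≤ σ * (σ * n)
    rw [← mul_assoc, ← pow_two, hσ, one_mul]
    exact hn

/-- The hypotheses say a × b = 0. If a = 0 the direction is taken from b; otherwise b is its own
projection `⟨u, b⟩ u` onto the direction `u` of a. -/
theorem exists_parallel {a₁ a₂ a₃ b₁ b₂ b₃ : ℝ} (h₁ : a₂ * b₃ = a₃ * b₂) (h₂ : a₃ * b₁ = a₁ * b₃)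
    (h₃ : a₁ * b₂ = a₂ * b₁) : ∃ (u : Fin 3 → ℝ) (s t : ℝ), u 0 ^ 2 + u 1 ^ 2 + u 2 ^ 2 = 1 ∧
      (a₁ = s * u 0 ∧ a₂ = s * u 1 ∧ a₃ = s * u 2) ∧ b₁ = t * u 0 ∧ b₂ = t * u 1 ∧ b₃ = t * u 2 := by
  have key : ∀ x y z : ℝ, ∃ (u : Fin 3 → ℝ) (s : ℝ), u 0 ^ 2 + u 1 ^ 2 + u 2 ^ 2 = 1 ∧
      x = s * u 0 ∧ y = s * u 1 ∧ z = s * u 2 := by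
    intro x y z
    obtain ⟨n, a, b, -, hab, hx, hy⟩ := exists_polar x y
    obtain ⟨s, c, d, -, hcd, hn, hz⟩ := exists_polar n z
    refine ⟨![c * a, c * b, d], s, ?_, ?_, ?_, hz⟩
    · simp only [Matrix.cons_val_zero, Matrix.cons_val_one, Matrix.cons_val]
      linear_combination hcd + c ^ 2 * hab
    · simp only [Matrix.cons_val_zero]
      rw [hx, hn, mul_assoc]
    · simp only [Matrix.cons_val_one, Matrix.cons_val_zero]
      rw [hy, hn, mul_assoc]
  obtain ⟨u, s, hu, ha₁, ha₂, ha₃⟩ := key a₁ a₂ a₃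
  by_cases hs : s = 0
  · obtain ⟨w, t, hw, hb⟩ := key b₁ b₂ b₃
    subst hs
    exact ⟨w, 0, t, hw, by simp [ha₁, ha₂, ha₃], hb⟩
  · refine ⟨u, s, u 0 * b₁ + u 1 * b₂ + u 2 * b₃, hu, ⟨ha₁, ha₂, ha₃⟩, ?_, ?_, ?_⟩
    all_goals
      rw [ha₁, ha₂] at h₃
      rw [ha₂, ha₃] at h₁
      rw [ha₃, ha₁] at h₂
      rw [mul_assoc, mul_assoc] at h₁ h₂ h₃
      replace h₁ := mul_left_cancel₀ hs h₁
      replace h₂ := mul_left_cancel₀ hs h₂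
      replace h₃ := mul_left_cancel₀ hs h₃
    · linear_combination -b₁ * hu + u 2 * h₂ - u 1 * h₃
    · linear_combination -b₂ * hu + u 0 * h₃ - u 2 * h₁
    · linear_combination -b₃ * hu + u 1 * h₁ - u 0 * h₂

variable {V : Type*} [NormedAddCommGroup V] [InnerProductSpace ℝ V]
  {e f : OrthonormalBasis (Fin 6) ℝ V}

/-- The frame `f` arises from `e` by a rotation of the quaternionic triple and a rotation of the
last two vectors. -/
structure IsFrameChange (e f : OrthonormalBasis (Fin 6) ℝ V) (q p m : Fin 3 → ℝ) (c s : ℝ) :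
    Prop where
  rotation : IsRotation q p m
  zero : f 0 = e 0
  one : f 1 = q 0 • e 1 + q 1 • e 2 + q 2 • e 3
  two : f 2 = p 0 • e 1 + p 1 • e 2 + p 2 • e 3
  three : f 3 = m 0 • e 1 + m 1 • e 2 + m 2 • e 3
  four : f 4 = c • e 4 + s • e 5
  five : f 5 = -s • e 4 + c • e 5

theorem exists_isFrameChange (e : OrthonormalBasis (Fin 6) ℝ V) {q p m : Fin 3 → ℝ}
    (hR : IsRotation q p m) {c s : ℝ} (hcs : c ^ 2 + s ^ 2 = 1) :
    ∃ f : OrthonormalBasis (Fin 6) ℝ V, IsFrameChange e f q p m c s := by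
  have : FiniteDimensional ℝ V := e.toBasis.finiteDimensional_of_finite
  let v : Fin 6 → V := ![e 0, q 0 • e 1 + q 1 • e 2 + q 2 • e 3, p 0 • e 1 + p 1 • e 2 + p 2 • e 3,
    m 0 • e 1 + m 1 • e 2 + m 2 • e 3, c • e 4 + s • e 5, -s • e 4 + c • e 5]
  have hv : Orthonormal ℝ v := by
    rw [orthonormal_iff_ite]
    intro i j
    fin_cases i <;> fin_cases j <;>
      simp [v, inner_add_left, inner_add_right, inner_smul_left, inner_smul_right,
        e.inner_eq_ite, -inner_self_eq_norm_sq_to_K] <;> grind [hR.qq, hR.pp, hR.mm, hR.qp, hR.qm, hR.pm]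
  have hr : Module.finrank ℝ V = Fintype.card (Fin 6) := Module.finrank_eq_card_basis e.toBasis
  obtain ⟨f, hf⟩ := Orthonormal.exists_orthonormalBasis_extension_of_card_eq (s := Set.univ) hr
    (v := v) (hv.comp _ Subtype.val_injective)
  exact ⟨f, hR, hf 0 trivial, hf 1 trivial, hf 2 trivial, hf 3 trivial, hf 4 trivial, hf 5 trivial⟩

/-- A rotation matrix respects the quaternion relations, so the triple of the new frame is the
rotated triple; the plane rotation commutes with that of the frame change. -/
theorem IsFrameChange.frameEndo_eq {q p m : Fin 3 → ℝ} {c s : ℝ} (h : IsFrameChange e f q p m c s)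
    (x y z d : ℝ) : frameEndo f x y z d = frameEndo e (x * q 0 + y * p 0 + z * m 0)
      (x * q 1 + y * p 1 + z * m 1) (x * q 2 + y * p 2 + z * m 2) d := by
  obtain ⟨qq, pp, mm, qp, qm, pm, m0, m1, m2, q0, q1, q2, p0, p1, p2, -, -, -⟩ := h.rotation
  refine f.toBasis.ext fun i => ?_
  rw [f.coe_toBasis]
  fin_cases i
  · change frameEndo f x y z d (f 0) = frameEndo e _ _ _ d (f 0)
    rw [frameEndo_zero, h.zero, h.one, h.two, h.three, frameEndo_zero]
    module
  · change frameEndo f x y z d (f 1) = frameEndo e _ _ _ d (f 1)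
    rw [frameEndo_one, h.zero, h.one, h.two, h.three]
    simp only [map_add, map_smul, frameEndo_one, frameEndo_two, frameEndo_three]
    match_scalars <;> grind
  · change frameEndo f x y z d (f 2) = frameEndo e _ _ _ d (f 2)
    rw [frameEndo_two, h.zero, h.one, h.two, h.three]
    simp only [map_add, map_smul, frameEndo_one, frameEndo_two, frameEndo_three]
    match_scalars <;> grind
  · change frameEndo f x y z d (f 3) = frameEndo e _ _ _ d (f 3)
    rw [frameEndo_three, h.zero, h.one, h.two, h.three]
    simp only [map_add, map_smul, frameEndo_one, frameEndo_two, frameEndo_three]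
    match_scalars <;> grind
  · change frameEndo f x y z d (f 4) = frameEndo e _ _ _ d (f 4)
    rw [frameEndo_four, h.four, h.five]
    simp only [map_add, map_smul, frameEndo_four, frameEndo_five]
    module
  · change frameEndo f x y z d (f 5) = frameEndo e _ _ _ d (f 5)
    rw [frameEndo_five, h.four, h.five]
    simp only [map_add, map_smul, frameEndo_four, frameEndo_five]
    module

theorem IsFrameChange.frameEndo_base {q p m : Fin 3 → ℝ} {c s : ℝ}
    (h : IsFrameChange e f q p m c s) (d : ℝ) :
    frameEndo e 1 0 0 d = frameEndo f (q 0) (p 0) (m 0) d := by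
  rw [h.frameEndo_eq]
  congr 1
  · exact h.rotation.c0.symm
  · exact h.rotation.c1.symm
  · exact h.rotation.c2.symm

theorem IsFrameChange.frameEndo_first {q p m : Fin 3 → ℝ} {c s : ℝ}
    (h : IsFrameChange e f q p m c s) (d : ℝ) :
    frameEndo f 1 0 0 d = frameEndo e (q 0) (q 1) (q 2) d := by
  rw [h.frameEndo_eq]
  simp

/-- The transformations by unit quaternions. -/
def IsSU2Endo (e : OrthonormalBasis (Fin 6) ℝ V) (g : V →ₗ[ℝ] V) : Prop :=
  ∃ c₀ c₁ c₂ c₃ : ℝ, c₀ ^ 2 + c₁ ^ 2 + c₂ ^ 2 + c₃ ^ 2 = 1 ∧ g = su2Endo e c₀ c₁ c₂ c₃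

/-- By `exists_eq_su2Endo`, SU(2) is described by isometry, fixing the last plane and commuting with
the span of the triple. A frame change preserves that plane and that span. -/
theorem IsFrameChange.isSU2Endo {q p m : Fin 3 → ℝ} {c s : ℝ} (h : IsFrameChange e f q p m c s)
    {g : V →ₗ[ℝ] V} (hg : IsSU2Endo e g) : IsSU2Endo f g := by
  obtain ⟨c₀, c₁, c₂, c₃, hc, rfl⟩ := hg
  refine exists_eq_su2Endo f (inner_su2Endo e hc) ?_ ?_ fun x y z v => ?_
  · rw [h.four, map_add, map_smul, map_smul, su2Endo_four, su2Endo_five]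
  · rw [h.five, map_add, map_smul, map_smul, su2Endo_four, su2Endo_five]
  · rw [h.frameEndo_eq, su2Endo_frameEndo_comm]

/-- [I_b, I_a] = -2 I_{a×b}, and an imaginary quaternion commuting with I₁ and I₂ vanishes;
evaluating at `e 0` already detects this. -/
theorem commutator_frameEndo {a₁ a₂ a₃ b₁ b₂ b₃ : ℝ}
    (h : ∀ x y z v, frameEndo e b₁ b₂ b₃ 0 (frameEndo e a₁ a₂ a₃ 0 (frameEndo e x y z 0 v)) -
        frameEndo e a₁ a₂ a₃ 0 (frameEndo e b₁ b₂ b₃ 0 (frameEndo e x y z 0 v)) =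
      frameEndo e x y z 0 (frameEndo e b₁ b₂ b₃ 0 (frameEndo e a₁ a₂ a₃ 0 v) -
        frameEndo e a₁ a₂ a₃ 0 (frameEndo e b₁ b₂ b₃ 0 v))) :
    a₂ * b₃ = a₃ * b₂ ∧ a₃ * b₁ = a₁ * b₃ ∧ a₁ * b₂ = a₂ * b₁ := by
  have h1 := congrArg e.repr (h 1 0 0 (e 0))
  have h2 := congrArg e.repr (h 0 1 0 (e 0))
  simp only [map_sub, repr_frameEndo, e.repr_self] at h1 h2
  have h12 := congrArg (fun w : EuclideanSpace ℝ (Fin 6) => w 2) h1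
  have h13 := congrArg (fun w : EuclideanSpace ℝ (Fin 6) => w 3) h1
  have h23 := congrArg (fun w : EuclideanSpace ℝ (Fin 6) => w 3) h2
  simp at h12 h13 h23
  refine ⟨?_, ?_, ?_⟩ <;> linarith

theorem wedgeForm_smul_add (L : V →ₗ[ℝ] V) (s t : ℝ) (ζ η X Y Z : V) :
    wedgeForm L (s • ζ + t • η) X Y Z = s * wedgeForm L ζ X Y Z + t * wedgeForm L η X Y Z := by
  simp only [wedgeForm, inner_add_left, real_inner_smul_left]
  ring

theorem frameEndo_smul (e : OrthonormalBasis (Fin 6) ℝ V) (s a b c : ℝ) :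
    frameEndo e (s * a) (s * b) (s * c) 0 = s • frameEndo e a b c 0 := by
  ext v
  apply e.repr.injective
  rw [LinearMap.smul_apply, map_smul]
  simp only [repr_frameEndo]
  ext i
  fin_cases i <;> simp <;> ring

theorem wedgeForm_frameEndo_smul (s a b c : ℝ) (ζ X Y Z : V) :
    wedgeForm (frameEndo e (s * a) (s * b) (s * c) 0) ζ X Y Z =
      s * wedgeForm (frameEndo e a b c 0) ζ X Y Z := by
  simp only [wedgeForm, frameEndo_smul, LinearMap.smul_apply, real_inner_smul_left]
  ring

/-- The frame in which a decomposable torsion form has the normal form `r (e₁₂ + e₃₄) ∧ e₅`. -/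
theorem exists_frame_wedgeForm (e : OrthonormalBasis (Fin 6) ℝ V) {a₁ a₂ a₃ b₁ b₂ b₃ : ℝ}
    (h₁ : a₂ * b₃ = a₃ * b₂) (h₂ : a₃ * b₁ = a₁ * b₃) (h₃ : a₁ * b₂ = a₂ * b₁) :
    ∃ (f : OrthonormalBasis (Fin 6) ℝ V) (r : ℝ) (q p m : Fin 3 → ℝ) (c s : ℝ), 0 ≤ r ∧
      IsFrameChange e f q p m c s ∧ ∀ X Y Z, wedgeForm (frameEndo e a₁ a₂ a₃ 0) (e 4) X Y Z +
        wedgeForm (frameEndo e b₁ b₂ b₃ 0) (e 5) X Y Z =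
          r * wedgeForm (frameEndo f 1 0 0 0) (f 4) X Y Z := by
  -- Here a = s u and b = t u, so the form is ω_u ∧ (s e₅ + t e₆). Polar coordinates of (s, t) give
  -- `r` and the rotation of the last plane.
  obtain ⟨u, s, t, hu, ⟨rfl, rfl, rfl⟩, rfl, rfl, rfl⟩ := exists_parallel h₁ h₂ h₃
  obtain ⟨r, c, d, hr, hcd, rfl, rfl⟩ := exists_polar s t
  obtain ⟨p, m, -, hR, -⟩ := exists_isRotation u hu
  obtain ⟨f, hf⟩ := exists_isFrameChange e hR hcd
  refine ⟨f, r, u, p, m, c, d, hr, hf, fun X Y Z => ?_⟩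
  rw [wedgeForm_frameEndo_smul, wedgeForm_frameEndo_smul, hf.frameEndo_first, hf.four,
    wedgeForm_smul_add]
  ring

/-- The normal form of the torsion form with respect to the almost complex structure with parameter
`q`. -/
theorem exists_frame_normalForm (e : OrthonormalBasis (Fin 6) ℝ V) (r : ℝ) (hr : 0 ≤ r)
    (q : Fin 3 → ℝ) (hq : q 0 ^ 2 + q 1 ^ 2 + q 2 ^ 2 = 1) :
    ∃ (p m : Fin 3 → ℝ) (σ α₁ α₅ : ℝ), 0 ≤ α₁ ∧ 0 ≤ α₅ ∧ α₁ ^ 2 + α₅ ^ 2 = r ^ 2 ∧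
      α₅ = r * |q 0| ∧
      ∃ f, IsFrameChange e f q p m σ 0 ∧ ∀ X Y Z,
        r * wedgeForm (frameEndo e 1 0 0 0) (e 4) X Y Z =
          normalForm α₁ α₅ (f.repr X) (f.repr Y) (f.repr Z) := by
  obtain ⟨p, m, σ, hR, hσ, hp, hq0, hm0⟩ := exists_isRotation q hq
  obtain ⟨f, hf⟩ := exists_isFrameChange e hR (c := σ) (s := 0) (by simpa using hσ)
  have hc := hR.c0
  refine ⟨p, m, σ, r * (σ * m 0), r * (σ * q 0), by positivity, by positivity, ?_, ?_, f, hf,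
    fun X Y Z => ?_⟩
  · rw [hp] at hc
    linear_combination r ^ 2 * (m 0 ^ 2 + q 0 ^ 2) * hσ + r ^ 2 * hc
  · have : |σ| = 1 := by rw [← sq_eq_sq₀ (abs_nonneg _) one_pos.le, sq_abs, hσ, one_pow]
    rw [← abs_of_nonneg hq0, abs_mul, this, one_mul]
  -- The frame change turns the last plane by 0 or π; as σ² = 1, the sign moves into the
  -- coefficients and makes them non-negative.
  · have h4 : e 4 = σ • f 4 + (0 : ℝ) • f 4 := by
      rw [hf.four, zero_smul, zero_smul, add_zero, add_zero, smul_smul, ← pow_two, hσ, one_smul]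
    have hw := wedgeForm_frameEndo_smul (e := f) (r * σ) (q 0) 0 (m 0) (f 4) X Y Z
    rw [mul_zero, mul_assoc, mul_assoc] at hw
    rw [normalForm_eq_wedgeForm, hw, hf.frameEndo_base, hp, h4, wedgeForm_smul_add]
    ring

end FrameChange

/-! ### Normal form of the torsion in transported frames -/

section ParallelFrames

variable {M : Type*} [TopologicalSpace M] [ChartedSpace E6 M] [IsManifold (𝓡 6) ∞ M]
  [RiemannianBundle (fun x : M => TangentSpace (𝓡 6) x)]
  [IsContMDiffRiemannianBundle (𝓡 6) ∞ E6 (fun x : M => TangentSpace (𝓡 6) x)]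
  {J : OrthogonalACS M} {cov : AffineConnection M}

theorem exists_mem_specialUnitaryGroup {c₀ c₁ c₂ c₃ : ℝ}
    (h : c₀ ^ 2 + c₁ ^ 2 + c₂ ^ 2 + c₃ ^ 2 = 1) :
    !![⟨c₀, c₁⟩, ⟨-c₂, c₃⟩; ⟨c₂, c₃⟩, ⟨c₀, -c₁⟩] ∈ Matrix.specialUnitaryGroup (Fin 2) ℂ := by
  rw [Matrix.mem_specialUnitaryGroup_iff, Matrix.mem_unitaryGroup_iff]
  constructor
  · ext i j
    fin_cases i <;> fin_cases j <;>
      simp [Matrix.mul_apply, Fin.sum_univ_two, Matrix.star_eq_conjTranspose, Complex.ext_iff] <;>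
      grind
  · simp [Matrix.det_fin_two, Complex.ext_iff]
    grind

theorem specialUnitaryGroup_entries {A : Matrix (Fin 2) (Fin 2) ℂ}
    (hA : A ∈ Matrix.specialUnitaryGroup (Fin 2) ℂ) :
    A 1 1 = star (A 0 0) ∧ A 0 1 = -star (A 1 0) ∧
      (A 0 0).re ^ 2 + (A 0 0).im ^ 2 + (A 1 0).re ^ 2 + (A 1 0).im ^ 2 = 1 := by
  rw [Matrix.mem_specialUnitaryGroup_iff, Matrix.mem_unitaryGroup_iff] at hA
  obtain ⟨h1, h2⟩ := hA
  -- With determinant 1 the inverse is the adjugate, and by unitarity it is also the conjugate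
  -- transpose; comparing entries gives the shape of `A`.
  have h3 : star A = A.adjugate := by
    rw [← one_mul (star A), ← one_smul ℂ (1 : Matrix (Fin 2) (Fin 2) ℂ), ← h2,
      ← Matrix.adjugate_mul, mul_assoc, h1, mul_one]
  rw [Matrix.adjugate_fin_two] at h3
  have e1 : star (A 0 0) = A 1 1 := congrFun (congrFun h3 0) 0
  have e2 : star (A 1 0) = -A 0 1 := congrFun (congrFun h3 0) 1
  refine ⟨e1.symm, by rw [e2, neg_neg], ?_⟩
  rw [Matrix.det_fin_two, ← e1, ← neg_eq_iff_eq_neg.2 e2] at h2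
  have := congrArg Complex.re h2
  simp at this
  linarith

/-- The dictionary is that `A` has first column `c₀ + i c₁`, `c₂ + i c₃`, the coordinates of the
unit quaternion. -/
theorem mem_SU2At_iff {x : M} (e : OrthonormalBasis (Fin 6) ℝ (TangentSpace (𝓡 6) x))
    (a : TangentSpace (𝓡 6) x →ₗ[ℝ] TangentSpace (𝓡 6) x) : a ∈ SU2At e ↔ IsSU2Endo e a := by
  constructor
  · rintro ⟨A, hA, h⟩
    obtain ⟨h11, h01, hc⟩ := specialUnitaryGroup_entries hA
    refine ⟨_, _, _, _, hc, e.toBasis.ext fun i => ?_⟩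
    have key : ∀ z : Fin 3 → ℂ, ∀ v, ofComplex e z = v →
        a v = ofComplex e ((blockMatrix A).mulVec z) := fun z v hv => by rw [← hv, h]
    rw [e.coe_toBasis]
    fin_cases i
    · change a (e 0) = su2Endo e _ _ _ _ (e 0)
      rw [key ![1, 0, 0] (e 0) (by simp [ofComplex]), su2Endo_zero]
      simp [ofComplex, blockMatrix, Matrix.mulVec, Matrix.vecHead, Matrix.vecTail]
    · change a (e 1) = su2Endo e _ _ _ _ (e 1)
      rw [key ![Complex.I, 0, 0] (e 1) (by simp [ofComplex]), su2Endo_one]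
      simp [ofComplex, blockMatrix, Matrix.mulVec, Matrix.vecHead, Matrix.vecTail]
      module
    · change a (e 2) = su2Endo e _ _ _ _ (e 2)
      rw [key ![0, 1, 0] (e 2) (by simp [ofComplex]), su2Endo_two]
      simp [ofComplex, blockMatrix, Matrix.mulVec, Matrix.vecHead, Matrix.vecTail, h11, h01]
      module
    · change a (e 3) = su2Endo e _ _ _ _ (e 3)
      rw [key ![0, Complex.I, 0] (e 3) (by simp [ofComplex]), su2Endo_three]
      simp [ofComplex, blockMatrix, Matrix.mulVec, Matrix.vecHead, Matrix.vecTail, h11, h01]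
      module
    · change a (e 4) = su2Endo e _ _ _ _ (e 4)
      rw [key ![0, 0, 1] (e 4) (by simp [ofComplex]), su2Endo_four]
      simp [ofComplex, blockMatrix, Matrix.mulVec, Matrix.vecHead, Matrix.vecTail]
    · change a (e 5) = su2Endo e _ _ _ _ (e 5)
      rw [key ![0, 0, Complex.I] (e 5) (by simp [ofComplex]), su2Endo_five]
      simp [ofComplex, blockMatrix, Matrix.mulVec, Matrix.vecHead, Matrix.vecTail]
  · rintro ⟨c₀, c₁, c₂, c₃, hc, rfl⟩
    refine ⟨_, exists_mem_specialUnitaryGroup hc, fun z => ?_⟩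
    simp only [ofComplex, map_add, map_smul, su2Endo_zero, su2Endo_one, su2Endo_two, su2Endo_three,
      su2Endo_four, su2Endo_five]
    simp [blockMatrix, Matrix.mulVec, Matrix.vecHead, Matrix.vecTail]
    module

theorem IsAdapted.frameEndo_eq {x : M} {e : OrthonormalBasis (Fin 6) ℝ (TangentSpace (𝓡 6) x)}
    (he : IsAdapted J e) (v : TangentSpace (𝓡 6) x) : J x v = frameEndo e 1 0 0 1 v := by
  obtain ⟨h0, h2, h4⟩ := he
  have h1 : J x (e 1) = -e 0 := by rw [← h0, J.sq]
  have h3 : J x (e 3) = -e 2 := by rw [← h2, J.sq]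
  have h5 : J x (e 5) = -e 4 := by rw [← h4, J.sq]
  rw [frame_expand e v]
  simp only [map_add, map_smul, frameEndo_zero, frameEndo_one, frameEndo_two, frameEndo_three,
    frameEndo_four, frameEndo_five, h0, h1, h2, h3, h4, h5]
  module

theorem isAdapted_of_eq_frameEndo {x : M}
    {e : OrthonormalBasis (Fin 6) ℝ (TangentSpace (𝓡 6) x)}
    (h : ∀ v, J x v = frameEndo e 1 0 0 1 v) : IsAdapted J e := by
  refine ⟨?_, ?_, ?_⟩
  · rw [h, frameEndo_zero]
    simp
  · rw [h, frameEndo_two]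
    simp
  · rw [h, frameEndo_four]
    simp

theorem torsionForm_skew_left (x : M) (X Y Z : TangentSpace (𝓡 6) x) :
    torsionForm cov x X Y Z = -torsionForm cov x Y X Z := by
  rw [torsionForm, cov.torsion_antisymm, inner_neg_left]
  rfl

/-- The torsion form of an almost hermitian structure with parallel torsion related to `SU(2)`, at
one point. -/
theorem exists_torsionForm_eq (hJ : IsCharacteristicConnection J cov) {x : M}
    {e : OrthonormalBasis (Fin 6) ℝ (TangentSpace (𝓡 6) x)}
    (he : SU2At e ⊆ isotropyGroup J cov x) :
    ∃ a₁ a₂ a₃ b₁ b₂ b₃ : ℝ, ∀ X Y Z, torsionForm cov x X Y Z =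
      wedgeForm (frameEndo e a₁ a₂ a₃ 0) (e 4) X Y Z +
        wedgeForm (frameEndo e b₁ b₂ b₃ 0) (e 5) X Y Z := by
  refine exists_eq_wedgeForm e (T := torsionTrilin cov x) (fun X Y Z => torsionForm_skew_left x X Y Z)
    (fun X Y Z => hJ.skew x X Y Z) fun c₀ c₁ c₂ c₃ hc X Y Z => ?_
  exact (he ((mem_SU2At_iff e _).2 ⟨c₀, c₁, c₂, c₃, hc, rfl⟩)).2.2 X Y Z

theorem torsion_frame {x : M} {e : OrthonormalBasis (Fin 6) ℝ (TangentSpace (𝓡 6) x)}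
    {a₁ a₂ a₃ b₁ b₂ b₃ : ℝ} (h : ∀ X Y Z, torsionForm cov x X Y Z =
      wedgeForm (frameEndo e a₁ a₂ a₃ 0) (e 4) X Y Z +
        wedgeForm (frameEndo e b₁ b₂ b₃ 0) (e 5) X Y Z) (v : TangentSpace (𝓡 6) x) :
    cov.torsion x (e 4) v = frameEndo e a₁ a₂ a₃ 0 v ∧
      cov.torsion x (e 5) v = frameEndo e b₁ b₂ b₃ 0 v := by
  constructor
  · refine ext_inner_right ℝ fun w => ?_
    refine (h (e 4) v w).trans ?_
    have h0 : (inner ℝ (frameEndo e a₁ a₂ a₃ 0 w) (e 4) : ℝ) = 0 ∧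
        (inner ℝ (frameEndo e b₁ b₂ b₃ 0 w) (e 4) : ℝ) = 0 := by
      simp [inner_frameEndo_left, frameEndo_four]
    simp [wedgeForm, frameEndo_four, h0, e.inner_eq_ite]
  · refine ext_inner_right ℝ fun w => ?_
    refine (h (e 5) v w).trans ?_
    have h0 : (inner ℝ (frameEndo e a₁ a₂ a₃ 0 w) (e 5) : ℝ) = 0 ∧
        (inner ℝ (frameEndo e b₁ b₂ b₃ 0 w) (e 5) : ℝ) = 0 := by
      simp [inner_frameEndo_left, frameEndo_five]
    simp [wedgeForm, frameEndo_five, h0, e.inner_eq_ite]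

theorem frameEndo_map {V V' : Type*} [NormedAddCommGroup V] [InnerProductSpace ℝ V]
    [NormedAddCommGroup V'] [InnerProductSpace ℝ V'] (e : OrthonormalBasis (Fin 6) ℝ V)
    (U : V ≃ₗᵢ[ℝ] V') (a b c d : ℝ) (v : V) :
    frameEndo (e.map U) a b c d (U v) = U (frameEndo e a b c d v) := by
  apply (e.map U).repr.injective
  have hU : ∀ w, (e.map U).repr (U w) = e.repr w := fun w => by
    ext i
    simp [OrthonormalBasis.repr_apply_apply]
  rw [repr_frameEndo, hU, hU, repr_frameEndo]

theorem wedgeForm_map {V V' : Type*} [NormedAddCommGroup V] [InnerProductSpace ℝ V]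
    [NormedAddCommGroup V'] [InnerProductSpace ℝ V'] (e : OrthonormalBasis (Fin 6) ℝ V)
    (U : V ≃ₗᵢ[ℝ] V') (a b c d : ℝ) (X Y Z : V) :
    wedgeForm (frameEndo (e.map U) a b c d) (e.map U 4) (U X) (U Y) (U Z) =
      wedgeForm (frameEndo e a b c d) (e 4) X Y Z := by
  simp [wedgeForm, frameEndo_map]

/-- A parallel transport as an isometry. -/
def IsReversibleTransport.isometry {x y : M} {P : TangentSpace (𝓡 6) x ≃ₗ[ℝ] TangentSpace (𝓡 6) y}
    (hP : IsReversibleTransport J cov P) : TangentSpace (𝓡 6) x ≃ₗᵢ[ℝ] TangentSpace (𝓡 6) y :=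
  P.isometryOfInner hP.inner_map

theorem IsReversibleTransport.isometry_apply {x y : M}
    {P : TangentSpace (𝓡 6) x ≃ₗ[ℝ] TangentSpace (𝓡 6) y}
    (hP : IsReversibleTransport J cov P) (v : TangentSpace (𝓡 6) x) : hP.isometry v = P v := rfl

/-- `e 4`, `e 5` and the triple are holonomy invariant, so they extend to parallel fields with T(ξ,
η) = 0. Then `torsion_commutator_commute` provides the hypothesis of `commutator_frameEndo`. -/
theorem torsion_relations [T2Space M] [ConnectedSpace M] (hJ : IsCharacteristicConnection J cov)
    (hT : HasParallelTorsion cov) {x : M}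
    {e : OrthonormalBasis (Fin 6) ℝ (TangentSpace (𝓡 6) x)} (hol : holonomyGroup cov x ⊆ SU2At e)
    {a₁ a₂ a₃ b₁ b₂ b₃ : ℝ} (h : ∀ X Y Z, torsionForm cov x X Y Z =
      wedgeForm (frameEndo e a₁ a₂ a₃ 0) (e 4) X Y Z +
        wedgeForm (frameEndo e b₁ b₂ b₃ 0) (e 5) X Y Z) :
    a₂ * b₃ = a₃ * b₂ ∧ a₃ * b₁ = a₁ * b₃ ∧ a₁ * b₂ = a₂ * b₁ := by
  choose P hP using exists_transport hJ hT x
  have hol4 : ∀ f ∈ holonomyGroup cov x, f (e 4) = e 4 := by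
    intro f hf
    obtain ⟨_, _, _, _, -, rfl⟩ := (mem_SU2At_iff e f).1 (hol hf)
    exact su2Endo_four e _ _ _ _
  have hol5 : ∀ f ∈ holonomyGroup cov x, f (e 5) = e 5 := by
    intro f hf
    obtain ⟨_, _, _, _, -, rfl⟩ := (mem_SU2At_iff e f).1 (hol hf)
    exact su2Endo_five e _ _ _ _
  have holK : ∀ c₁ c₂ c₃, ∀ f ∈ holonomyGroup cov x, ∀ v,
      f (frameEndo e c₁ c₂ c₃ 0 v) = frameEndo e c₁ c₂ c₃ 0 (f v) := by
    intro c₁ c₂ c₃ f hf v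
    obtain ⟨_, _, _, _, -, rfl⟩ := (mem_SU2At_iff e f).1 (hol hf)
    exact su2Endo_frameEndo_comm e _ _ _ _ _ _ _ _ _
  -- The chosen transport from `x` to itself need not be the identity, but as a holonomy element it
  -- respects all the data.
  have hPx : (P x).toLinearMap ∈ holonomyGroup cov x := (hP x).transport
  have hP4 : P x (e 4) = e 4 := hol4 _ hPx
  have hP5 : P x (e 5) = e 5 := hol5 _ hPx
  refine commutator_frameEndo (e := e) fun c₁ c₂ c₃ v => ?_
  have key := torsion_commutator_commute hJ hT (isInvariantField_of_holonomy hP hol4)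
    (isInvariantField_of_holonomy hP hol5) (fun y => ?_)
    (isInvariantEndo_of_holonomy hP (holK c₁ c₂ c₃)) x v
  · have hL : ∀ w, endoCLM ((P x).toLinearMap ∘ₗ frameEndo e c₁ c₂ c₃ 0 ∘ₗ
        (P x).symm.toLinearMap) w = frameEndo e c₁ c₂ c₃ 0 w := by
      intro w
      have := holK c₁ c₂ c₃ _ hPx ((P x).symm w)
      simpa using this
    rw [hL, hL, hP4, hP5] at key
    simpa only [(torsion_frame h _).1, (torsion_frame h _).2] using key
  · rw [← (hP y).map_torsion, (torsion_frame h _).1, frameEndo_five, neg_zero, zero_smul, map_zero]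

/-- A parallel family of orthonormal frames in which the almost complex structure, the torsion form
and the holonomy have a standard form. -/
theorem exists_parallel_frames [T2Space M] [ConnectedSpace M] (hJ : IsRelatedToSU2 J cov)
    (hT : ∃ x : M, cov.torsion x ≠ 0) :
    ∃ (E : (x : M) → OrthonormalBasis (Fin 6) ℝ (TangentSpace (𝓡 6) x)) (r : ℝ) (q : Fin 3 → ℝ),
      0 < r ∧ q 0 ^ 2 + q 1 ^ 2 + q 2 ^ 2 = 1 ∧
      (∀ x v, J x v = frameEndo (E x) (q 0) (q 1) (q 2) 1 v) ∧
      (∀ x X Y Z, torsionForm cov x X Y Z =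
        r * wedgeForm (frameEndo (E x) 1 0 0 0) (E x 4) X Y Z) ∧
      (∀ x, holonomyGroup cov x ⊆ SU2At (E x)) ∧
      ∀ a b c d, IsInvariantEndo J cov fun x => endoCLM (frameEndo (E x) a b c d) := by
  obtain ⟨x, hx⟩ := hT
  obtain ⟨e, heJ, hol, hiso⟩ := hJ.su2 x
  obtain ⟨a₁, a₂, a₃, b₁, b₂, b₃, hform⟩ := exists_torsionForm_eq hJ.characteristic hiso
  obtain ⟨h₁, h₂, h₃⟩ := torsion_relations hJ.characteristic hJ.parallel hol hform
  obtain ⟨f, r, q, p, m, c, s, hr, hef, hf⟩ := exists_frame_wedgeForm e h₁ h₂ h₃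
  choose P hP using exists_transport hJ.characteristic hJ.parallel x
  have hTf : ∀ X Y Z, torsionForm cov x X Y Z =
      r * wedgeForm (frameEndo f 1 0 0 0) (f 4) X Y Z := fun X Y Z => by rw [hform, hf]
  have hJf : ∀ v, J x v = frameEndo f (q 0) (p 0) (m 0) 1 v := fun v => by
    rw [heJ.frameEndo_eq, hef.frameEndo_base]
  have holf : ∀ g ∈ holonomyGroup cov x, IsSU2Endo f g := fun g hg =>
    hef.isSU2Endo ((mem_SU2At_iff e g).1 (hol hg))
  have hPE : ∀ y a b c d v, frameEndo (f.map (hP y).isometry) a b c d (P y v) =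
      P y (frameEndo f a b c d v) := fun y a b c d v => frameEndo_map f (hP y).isometry a b c d v
  -- The transported frames depend on arbitrary choices of paths and need not vary continuously;
  -- only the endomorphisms built from them are independent of the choices. The parameter of `J` is
  -- the first column of the rotation, because I₁ of `e` has these coordinates in the triple of `f`.
  refine ⟨fun y => f.map (hP y).isometry, r, ![q 0, p 0, m 0], ?_, ?_, ?_, ?_, ?_, ?_⟩
  · refine lt_of_le_of_ne hr fun h0 => hx ?_
    ext X Y
    refine ext_inner_right ℝ fun Z => ?_
    have := hTf X Y Z
    rw [← h0, zero_mul] at this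
    simpa using! this
  · have := hef.rotation.c0
    simpa [pow_two] using this
  · intro y v
    obtain ⟨v, rfl⟩ := (P y).surjective v
    exact ((hP y).map_acs v).symm.trans (by rw [hJf, ← hPE]; rfl)
  · intro y X Y Z
    obtain ⟨X, rfl⟩ := (P y).surjective X
    obtain ⟨Y, rfl⟩ := (P y).surjective Y
    obtain ⟨Z, rfl⟩ := (P y).surjective Z
    have h1 := wedgeForm_map f (hP y).isometry 1 0 0 0 X Y Z
    rw [torsionForm, ← (hP y).map_torsion, (hP y).inner_map]
    refine (hTf X Y Z).trans ?_
    rw [← h1]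
    rfl
  · intro y g hg
    -- A loop at `y` is conjugated by the chosen transport to a loop at `x`.
    obtain ⟨A, hA, h⟩ := (mem_SU2At_iff f _).2 (holf _
      (((hP y).transport.trans hg).trans (hP y).transport_symm))
    refine ⟨A, hA, fun z => ?_⟩
    have hz : ∀ z, ofComplex (f.map (hP y).isometry) z = P y (ofComplex f z) := fun z => by
      simp [ofComplex, (hP y).isometry_apply]
    have := h z
    rw [LinearMap.comp_apply, LinearMap.comp_apply, LinearEquiv.coe_coe, LinearEquiv.coe_coe,
      LinearEquiv.symm_apply_eq] at this
    rw [hz, hz, this]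
  · intro a b c d
    have h1 := isInvariantEndo_of_holonomy hP (L := frameEndo f a b c d) fun g hg v => by
      obtain ⟨_, _, _, _, -, rfl⟩ := holf g hg
      exact su2Endo_frameEndo_comm f _ _ _ _ _ _ _ _ _
    convert h1 using 2 with y
    ext v
    obtain ⟨v, rfl⟩ := (P y).surjective v
    simp [hPE]

end ParallelFrames

/-! ### The sphere of almost complex structures and type W₄ -/

section SphereFamily

variable {M : Type*} [TopologicalSpace M] [ChartedSpace E6 M] [IsManifold (𝓡 6) ∞ M]
  [RiemannianBundle (fun x : M => TangentSpace (𝓡 6) x)]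
  [IsContMDiffRiemannianBundle (𝓡 6) ∞ E6 (fun x : M => TangentSpace (𝓡 6) x)]
  {J : OrthogonalACS M} {cov : AffineConnection M}
  {E : (x : M) → OrthonormalBasis (Fin 6) ℝ (TangentSpace (𝓡 6) x)}

theorem S2.sum_sq (q : S2) : q.1 0 ^ 2 + q.1 1 ^ 2 + q.1 2 ^ 2 = 1 := by
  have h := q.2
  rw [mem_sphere_zero_iff_norm] at h
  have := EuclideanSpace.real_norm_sq_eq q.1
  rw [h, Fin.sum_univ_three] at this
  linarith

/-- The point of the sphere with given coordinates. -/
def S2.mk (a b c : ℝ) (h : a ^ 2 + b ^ 2 + c ^ 2 = 1) : S2 :=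
  ⟨!₂[a, b, c], by
    rw [mem_sphere_zero_iff_norm, EuclideanSpace.norm_eq, Fin.sum_univ_three]
    simp [h]⟩

theorem S2.contMDiff_apply (i : Fin 3) : ContMDiff (𝓡 2) 𝓘(ℝ, ℝ) ∞ (fun q : S2 => q.1 i) := by
  have : Fact (Module.finrank ℝ (EuclideanSpace ℝ (Fin 3)) = 2 + 1) := ⟨by simp⟩
  have h1 : ContMDiff (𝓡 2) 𝓘(ℝ, EuclideanSpace ℝ (Fin 3)) ∞
      ((↑) : S2 → EuclideanSpace ℝ (Fin 3)) := contMDiff_coe_sphere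
  exact (EuclideanSpace.proj (𝕜 := ℝ) i).contDiff.contMDiff.comp h1

theorem frameEndo_eq_sum_smul {V : Type*} [NormedAddCommGroup V] [InnerProductSpace ℝ V]
    (e : OrthonormalBasis (Fin 6) ℝ V) (a b c : ℝ) (v : V) : frameEndo e a b c 1 v =
      a • frameEndo e 1 0 0 0 v + b • frameEndo e 0 1 0 0 v +
        c • frameEndo e 0 0 1 0 v + frameEndo e 0 0 0 1 v := by
  apply e.repr.injective
  rw [map_add, map_add, map_add, map_smul, map_smul, map_smul]
  simp only [repr_frameEndo]
  ext i
  fin_cases i <;> simp <;> ring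

/-- The endomorphism is affine in the parameter, so joint smoothness reduces to that of four fixed
endomorphism fields and of the coordinates on the sphere. -/
theorem contMDiff_frameEndo
    (hE : ∀ a b c d, ContMDiff (𝓡 6) ((𝓡 6).prod 𝓘(ℝ, E6 →L[ℝ] E6)) ∞
      (fun x => TotalSpace.mk' (E6 →L[ℝ] E6)
        (E := fun x : M => TangentSpace (𝓡 6) x →L[ℝ] TangentSpace (𝓡 6) x) x
          (endoCLM (frameEndo (E x) a b c d)))) :
    ContMDiff ((𝓡 2).prod (𝓡 6)) ((𝓡 6).prod 𝓘(ℝ, E6 →L[ℝ] E6)) ∞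
      (fun p : S2 × M => TotalSpace.mk' (E6 →L[ℝ] E6)
        (E := fun x : M => TangentSpace (𝓡 6) x →L[ℝ] TangentSpace (𝓡 6) x) p.2
          (endoCLM (frameEndo (E p.2) (p.1.1 0) (p.1.1 1) (p.1.1 2) 1))) := by
  intro p₀
  rw [contMDiffAt_hom_bundle]
  refine ⟨contMDiffAt_snd, ?_⟩
  have hA : ∀ a b c d, ContMDiffAt ((𝓡 2).prod (𝓡 6)) 𝓘(ℝ, E6 →L[ℝ] E6) ∞
      (fun p : S2 × M => ContinuousLinearMap.inCoordinates E6 (TangentSpace (𝓡 6) : M → Type) E6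
        (TangentSpace (𝓡 6) : M → Type) p₀.2 p.2 p₀.2 p.2
          (endoCLM (frameEndo (E p.2) a b c d))) p₀ := by
    intro a b c d
    have h1 := ((contMDiffAt_hom_bundle _).1 (hE a b c d p₀.2)).2
    exact h1.comp p₀ contMDiffAt_snd
  have hq : ∀ i, ContMDiffAt ((𝓡 2).prod (𝓡 6)) 𝓘(ℝ, ℝ) ∞ (fun p : S2 × M => p.1.1 i) p₀ := by
    intro i
    exact (S2.contMDiff_apply i p₀.1).comp p₀ contMDiffAt_fst
  refine ((((hq 0).smul (hA 1 0 0 0)).add ((hq 1).smul (hA 0 1 0 0))).add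
    ((hq 2).smul (hA 0 0 1 0))).add (hA 0 0 0 1) |>.congr_of_eventuallyEq (.of_forall fun p => ?_)
  ext1 v
  set s : TangentSpace (𝓡 6) p.2 :=
    (trivializationAt E6 (TangentSpace (𝓡 6) : M → Type) p₀.2).symmL ℝ p.2 v
  set t := (trivializationAt E6 (TangentSpace (𝓡 6) : M → Type) p₀.2).continuousLinearMapAt ℝ p.2
  change t (frameEndo (E p.2) (p.1.1 0) (p.1.1 1) (p.1.1 2) 1 s) =
    p.1.1 0 • t (frameEndo (E p.2) 1 0 0 0 s) + p.1.1 1 • t (frameEndo (E p.2) 0 1 0 0 s) +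
      p.1.1 2 • t (frameEndo (E p.2) 0 0 1 0 s) + t (frameEndo (E p.2) 0 0 0 1 s)
  rw [frameEndo_eq_sum_smul (E p.2), map_add, map_add, map_add, map_smul, map_smul, map_smul]

/-- The almost complex structures of the family. -/
def sphereACS (E : (x : M) → OrthonormalBasis (Fin 6) ℝ (TangentSpace (𝓡 6) x))
    (hE : ∀ a b c d, ContMDiff (𝓡 6) ((𝓡 6).prod 𝓘(ℝ, E6 →L[ℝ] E6)) ∞
      (fun x => TotalSpace.mk' (E6 →L[ℝ] E6)
        (E := fun x : M => TangentSpace (𝓡 6) x →L[ℝ] TangentSpace (𝓡 6) x) x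
          (endoCLM (frameEndo (E x) a b c d)))) (q : S2) : OrthogonalACS M where
  toFun x := endoCLM (frameEndo (E x) (q.1 0) (q.1 1) (q.1 2) 1)
  smooth := hE _ _ _ _
  sq _ v := frameEndo_frameEndo _ q.sum_sq v
  orthogonal _ v w := inner_frameEndo_frameEndo _ q.sum_sq v w

theorem isSphereFamily_sphereACS
    (hE : ∀ a b c d, ContMDiff (𝓡 6) ((𝓡 6).prod 𝓘(ℝ, E6 →L[ℝ] E6)) ∞
      (fun x => TotalSpace.mk' (E6 →L[ℝ] E6)
        (E := fun x : M => TangentSpace (𝓡 6) x →L[ℝ] TangentSpace (𝓡 6) x) x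
          (endoCLM (frameEndo (E x) a b c d)))) : IsSphereFamily (sphereACS E hE) where
  smooth := contMDiff_frameEndo hE
  injective x q q' h := by
    -- The parameter is read off from the image of the first frame vector.
    have h0 := congrArg (fun L : TangentSpace (𝓡 6) x →L[ℝ] TangentSpace (𝓡 6) x =>
      (E x).repr (L (E x 0))) h
    have h1 : (E x).repr (frameEndo (E x) (q.1 0) (q.1 1) (q.1 2) 1 (E x 0)) =
      (E x).repr (frameEndo (E x) (q'.1 0) (q'.1 1) (q'.1 2) 1 (E x 0)) := h0
    simp only [repr_frameEndo, (E x).repr_self] at h1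
    have e1 := congrArg (fun w : EuclideanSpace ℝ (Fin 6) => w 1) h1
    have e2 := congrArg (fun w : EuclideanSpace ℝ (Fin 6) => w 2) h1
    have e3 := congrArg (fun w : EuclideanSpace ℝ (Fin 6) => w 3) h1
    simp at e1 e2 e3
    refine Subtype.ext ?_
    ext i
    fin_cases i
    · exact e1
    · exact e2
    · exact e3

/-- The frame may vary with `x`, but the coefficients are explicit functions of `r` and `q`, which
gives one orbit for all points. -/
theorem exists_adapted_normalForm {r : ℝ} (hr : 0 < r)
    (hE : ∀ a b c d, ContMDiff (𝓡 6) ((𝓡 6).prod 𝓘(ℝ, E6 →L[ℝ] E6)) ∞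
      (fun x => TotalSpace.mk' (E6 →L[ℝ] E6)
        (E := fun x : M => TangentSpace (𝓡 6) x →L[ℝ] TangentSpace (𝓡 6) x) x
          (endoCLM (frameEndo (E x) a b c d))))
    (hform : ∀ x X Y Z, torsionForm cov x X Y Z =
      r * wedgeForm (frameEndo (E x) 1 0 0 0) (E x 4) X Y Z) (q : S2) (x : M) :
    ∃ f : OrthonormalBasis (Fin 6) ℝ (TangentSpace (𝓡 6) x), IsAdapted (sphereACS E hE q) f ∧
      (∀ g, IsSU2Endo (E x) g → IsSU2Endo f g) ∧
      ∀ X Y Z, torsionForm cov x X Y Z = normalForm (√(r ^ 2 - (r * |q.1 0|) ^ 2)) (r * |q.1 0|)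
        (f.repr X) (f.repr Y) (f.repr Z) := by
  obtain ⟨p, m, σ, α₁, α₅, h1, h5, hs, rfl, f, hf, hn⟩ :=
    exists_frame_normalForm (E x) r hr.le q.1 q.sum_sq
  refine ⟨f, isAdapted_of_eq_frameEndo fun v => ?_, fun g hg => hf.isSU2Endo hg, fun X Y Z => ?_⟩
  · rw [hf.frameEndo_first]
    rfl
  · rw [hform, hn, ← hs, add_sub_cancel_right, Real.sqrt_sq h1]

/-- Invariance makes each structure of the family parallel for `cov`. The frame adapted to it
defines the same SU(2), and this group preserves the structure and the normal form. -/
theorem isRelatedToSU2_sphereACS [T2Space M] (hJ : IsRelatedToSU2 J cov) {r : ℝ} (hr : 0 < r)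
    (hE : ∀ a b c d, ContMDiff (𝓡 6) ((𝓡 6).prod 𝓘(ℝ, E6 →L[ℝ] E6)) ∞
      (fun x => TotalSpace.mk' (E6 →L[ℝ] E6)
        (E := fun x : M => TangentSpace (𝓡 6) x →L[ℝ] TangentSpace (𝓡 6) x) x
          (endoCLM (frameEndo (E x) a b c d))))
    (hform : ∀ x X Y Z, torsionForm cov x X Y Z =
      r * wedgeForm (frameEndo (E x) 1 0 0 0) (E x 4) X Y Z)
    (hol : ∀ x, holonomyGroup cov x ⊆ SU2At (E x))
    (hinv : ∀ a b c d, IsInvariantEndo J cov fun x => endoCLM (frameEndo (E x) a b c d)) (q : S2) :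
    IsRelatedToSU2 (sphereACS E hE q) cov where
  characteristic :=
    { smooth := hJ.characteristic.smooth
      metric := hJ.characteristic.metric
      complex := fun _ _ hY v => (hinv _ _ _ _).cov_apply hJ.characteristic hJ.parallel hY v
      skew := hJ.characteristic.skew }
  parallel := hJ.parallel
  su2 x := by
    obtain ⟨f, hf, hfE, hfT⟩ := exists_adapted_normalForm hr hE hform q x
    refine ⟨f, hf, fun g hg => (mem_SU2At_iff f g).2 (hfE g ((mem_SU2At_iff _ g).1 (hol x hg))),
      fun g hg => ?_⟩
    obtain ⟨c₀, c₁, c₂, c₃, hc, rfl⟩ := (mem_SU2At_iff f g).1 hg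
    refine ⟨inner_su2Endo f hc, fun X => ?_, fun X Y Z => ?_⟩
    · rw [hf.frameEndo_eq, hf.frameEndo_eq, su2Endo_frameEndo_comm]
    · rw [hfT, hfT, normalForm_eq_wedgeForm, normalForm_eq_wedgeForm, wedgeForm_su2Endo f hc]

/-- The Levi-Civita connection of a metric connection with skew-symmetric torsion. -/
theorem isLeviCivita_addOneForm (hJ : IsCharacteristicConnection J cov) :
    -- The differentiated field enters the torsion in the first slot, so this is ∇_v σ - ½ T(v, σ).
    IsLeviCivita (cov.addOneForm fun x => (1 / 2 : ℝ) • cov.torsion x) := by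
  constructor
  · rw [CovariantDerivative.isMetricCompatible_iff]
    intro x X σ τ _ hσ hτ
    rw [hJ.metric.mvfderiv_inner_eq X hσ hτ]
    have h1 : (inner ℝ (cov.torsion x (σ x) (X x)) (τ x) : ℝ) =
        -inner ℝ (σ x) (cov.torsion x (τ x) (X x)) := by
      have e1 := torsionForm_skew_left (cov := cov) x (σ x) (X x) (τ x)
      have e2 := hJ.skew x (X x) (σ x) (τ x)
      have e3 := torsionForm_skew_left (cov := cov) x (τ x) (X x) (σ x)
      simp only [torsionForm] at e1 e2 e3
      linarith [real_inner_comm (σ x) (cov.torsion x (τ x) (X x))]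
    simp only [CovariantDerivative.addOneForm]
    change _ = inner ℝ (cov σ x (X x) + (1 / 2 : ℝ) • cov.torsion x (σ x) (X x)) (τ x) +
      inner ℝ (σ x) (cov τ x (X x) + (1 / 2 : ℝ) • cov.torsion x (τ x) (X x))
    rw [inner_add_left, inner_add_right, real_inner_smul_left, real_inner_smul_right, h1]
    ring
  · intro x
    ext1 u
    ext1 v
    have hu := FiberBundle.mdifferentiableAt_extend (𝓡 6) E6 (V := fun x : M => TangentSpace (𝓡 6) x) u
    have hv := FiberBundle.mdifferentiableAt_extend (𝓡 6) E6 (V := fun x : M => TangentSpace (𝓡 6) x) v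
    have e1 := CovariantDerivative.torsion_apply
      (cov.addOneForm fun x => (1 / 2 : ℝ) • cov.torsion x) hu hv
    have e2 := cov.torsion_apply hu hv
    rw [FiberBundle.extend_apply_self, FiberBundle.extend_apply_self] at e1 e2
    rw [e1]
    change (cov (FiberBundle.extend E6 v) x u +
        (1 / 2 : ℝ) • cov.torsion x (FiberBundle.extend E6 v x) u) -
      (cov (FiberBundle.extend E6 u) x v +
        (1 / 2 : ℝ) • cov.torsion x (FiberBundle.extend E6 u x) v) - _ = 0
    rw [FiberBundle.extend_apply_self, FiberBundle.extend_apply_self, cov.torsion_antisymm v u]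
    rw [← sub_eq_zero] at e2
    have : ∀ a b c t : TangentSpace (𝓡 6) x, t - (a - b - c) = 0 →
        a + (1 / 2 : ℝ) • -t - (b + (1 / 2 : ℝ) • t) - c = 0 := by
      intro a b c t h
      have e : a + (1 / 2 : ℝ) • -t - (b + (1 / 2 : ℝ) • t) - c = -(t - (a - b - c)) := by module
      rw [e, h, neg_zero]
    exact this _ _ _ _ e2

/-- The intrinsic torsion in terms of the torsion of the characteristic connection. -/
theorem intrinsicTorsion_eq (hJ : IsCharacteristicConnection J cov) (x : M) :
    intrinsicTorsion J (cov.addOneForm fun x => (1 / 2 : ℝ) • cov.torsion x) x =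
      thetaMap J x (torsionForm cov x) := by
  ext X Y Z
  have hY : IsDiffAt (FiberBundle.extend E6 Y) x :=
    FiberBundle.mdifferentiableAt_extend (𝓡 6) E6 (V := fun x : M => TangentSpace (𝓡 6) x) Y
  have hd : derivJ J (cov.addOneForm fun x => (1 / 2 : ℝ) • cov.torsion x) x X Y =
      (1 / 2 : ℝ) • (cov.torsion x (J x Y) X - J x (cov.torsion x Y X)) := by
    change (cov (fun y => J y (FiberBundle.extend E6 Y y)) x X +
        (1 / 2 : ℝ) • cov.torsion x (J x (FiberBundle.extend E6 Y x)) X) -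
      J x (cov (FiberBundle.extend E6 Y) x X +
        (1 / 2 : ℝ) • cov.torsion x (FiberBundle.extend E6 Y x) X) = _
    rw [hJ.complex x _ hY, FiberBundle.extend_apply_self, map_add, map_smul]
    module
  rw [intrinsicTorsion, hd, real_inner_smul_left, inner_sub_left, J.orthogonal, thetaMap]
  have e1 := torsionForm_skew_left (cov := cov) x (J x Y) X (J x Z)
  have e2 := torsionForm_skew_left (cov := cov) x Y X Z
  rw [torsionForm] at e1 e2
  rw [e1, e2]
  ring

theorem isStrictTypeW4_of_torsionForm (hJ : IsCharacteristicConnection J cov) {r : ℝ} (hr : 0 < r)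
    (hJE : ∀ x v, J x v = frameEndo (E x) 1 0 0 1 v)
    (hform : ∀ x X Y Z, torsionForm cov x X Y Z =
      r * wedgeForm (frameEndo (E x) 1 0 0 0) (E x 4) X Y Z) : IsStrictTypeW4 J := by
  refine ⟨_, isLeviCivita_addOneForm hJ, fun x => ⟨⟨r • E x 4, ?_⟩, fun h => ?_⟩⟩
  · rw [intrinsicTorsion_eq hJ]
    congr 1
    ext X Y Z
    rw [hform, ← wedgeForm_frameEndo_one]
    simp only [kahlerWedge, kahlerForm, wedgeForm, hJE, real_inner_smul_left]
    ring
  -- On these vectors T(e₁, e₂, e₅) = r, while the term with J applied is T(e₁, -e₁, e₆) = 0, so the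
  -- intrinsic torsion is non-zero.
  · have h1 := congrFun (congrFun (congrFun h (E x 0)) (E x 1)) (E x 4)
    rw [intrinsicTorsion_eq hJ] at h1
    simp [thetaMap, hform, hJE, wedgeForm, frameEndo_zero, frameEndo_one, frameEndo_four,
      (E x).inner_eq_ite] at h1
    exact hr.ne' h1

end SphereFamily

theorem mainTheorem6 {M : Type*} [TopologicalSpace M] [T2Space M] [SecondCountableTopology M]
    [ConnectedSpace M] [ChartedSpace E6 M] [IsManifold (𝓡 6) ∞ M]
    [RiemannianBundle (fun x : M => TangentSpace (𝓡 6) x)]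
    [IsContMDiffRiemannianBundle (𝓡 6) ∞ E6 (fun x : M => TangentSpace (𝓡 6) x)]
    (J : OrthogonalACS M) (cov : AffineConnection M)
    (hJ : IsRelatedToSU2 J cov) (hT : ∃ x : M, cov.torsion x ≠ 0) :
    ∃ Jt : S2 → OrthogonalACS M,
      IsSphereFamily Jt ∧ (∃ q, Jt q = J) ∧
      (∀ q, IsRelatedToSU2 (Jt q) cov) ∧
      (∃ r : ℝ, 0 < r ∧
        (∀ q, ∃ α₁ α₅ : ℝ, 0 ≤ α₁ ∧ 0 ≤ α₅ ∧ α₁ ^ 2 + α₅ ^ 2 = r ^ 2 ∧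
          HasTorsionOrbit (Jt q) cov α₁ α₅) ∧
        (∀ α₁ α₅ : ℝ, 0 ≤ α₁ → 0 ≤ α₅ → α₁ ^ 2 + α₅ ^ 2 = r ^ 2 →
          ∃ q, HasTorsionOrbit (Jt q) cov α₁ α₅)) ∧
      (∃ q, IsStrictTypeW4 (Jt q)) := by
  obtain ⟨E, r, q₀, hr, hq₀, hJE, hform, hol, hinv⟩ := exists_parallel_frames hJ hT
  have hE := fun a b c d => (hinv a b c d).contMDiff hJ.characteristic hJ.parallel
  have hrel := isRelatedToSU2_sphereACS hJ hr hE hform hol hinv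
  have horb : ∀ q, HasTorsionOrbit (sphereACS E hE q) cov (√(r ^ 2 - (r * |q.1 0|) ^ 2))
      (r * |q.1 0|) := fun q x => by
    obtain ⟨f, hf, -, hfT⟩ := exists_adapted_normalForm hr hE hform q x
    exact ⟨f, hf, hfT⟩
  refine ⟨sphereACS E hE, isSphereFamily_sphereACS hE, ⟨S2.mk (q₀ 0) (q₀ 1) (q₀ 2) hq₀, ?_⟩, hrel,
    ⟨r, hr, fun q => ⟨_, _, Real.sqrt_nonneg _, by positivity, ?_, horb q⟩,
      fun α₁ α₅ h1 h5 hs => ?_⟩, S2.mk 1 0 0 (by norm_num), ?_⟩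
  · ext x v
    exact (hJE x v).symm
  · rw [Real.sq_sqrt, sub_add_cancel]
    rw [mul_pow, sq_abs, sub_nonneg]
    have := q.sum_sq
    nlinarith [sq_nonneg (q.1 1), sq_nonneg (q.1 2), sq_nonneg r]
  -- Only the first coordinate of `q` matters for the orbit; it must be `α₅ / r`, and the rest
  -- completes it to a unit vector.
  · have hq : (α₅ / r) ^ 2 + (α₁ / r) ^ 2 + 0 ^ 2 = 1 := by
      field_simp
      linarith
    refine ⟨S2.mk (α₅ / r) (α₁ / r) 0 hq, ?_⟩
    have h0 := horb (S2.mk (α₅ / r) (α₁ / r) 0 hq)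
    have e5 : r * |(S2.mk (α₅ / r) (α₁ / r) 0 hq).1 0| = α₅ := by
      change r * |α₅ / r| = α₅
      rw [abs_of_nonneg (by positivity), mul_div_cancel₀ _ hr.ne']
    rwa [e5, ← hs, add_sub_cancel_right, Real.sqrt_sq h1] at h0
  -- For q = (1, 0, 0) the structure is I₁ plus the plane rotation, so its Kähler form contains ω₁
  -- itself.
  · exact isStrictTypeW4_of_torsionForm (hrel _).characteristic hr (fun x v => rfl) hform

end
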